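/- **Setting.** There are $m\ge 1$ tasks. Task $j$ has a data distribution $P_j$, a loss $\ell_j(\theta,\eta,z)$ with $\theta\in\mathbb R^d$ and $\eta$ in a normed space $\mathcal H_j$, risk $R_j(\theta,\eta)=\mathbb E_{P_j}\ell_j(\theta,\eta,Z)$, true parameters $(\theta_j^*,\eta_j^*)$, and a set $\mathcal T_j\subseteq\mathcal H_j$ of nuisance realizations. The evaluation data $Z_{ji}\sim P_j$ ($1\le i\le n_j$, $n_j\ge 1$) are independent over all $j,i$, and the nuisance estimators $(\hat\eta_j)_j$ are jointly independent of them. A partition of $[m]$ into nonempty clusters $S_1,\dots,S_K$ has centroids $\beta_k^*$ with $\|\beta_k^*-\beta_{k'}^*\|_2\ge\delta>0$ for $k\neq k'$, and $\|\theta_j^*-\beta_k^*\|_2\le\xi_k$ for $j\in S_k$. Write $n_{\min},n_{\max}$ for the extreme $n_j$, $N_k=\sum_{j\in S_k}n_j$, $N_{\min}=\min_kN_k$, $m_k=|S_k|$, $\xi_{\max}=\max_k\xi_k$. Let $\mathcal B_{x,M}$ be the closed ball of radius $M>0$ around $x$. **Loss regularity.** For fixed $\rho,\kappa,\sigma_1,\dots,\sigma_5>0$,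 $r_1,r_2>2$ and every $j$: $\ell_j(\cdot,\eta,z)$ is convex on $\mathbb R^d$ for all $\eta\in\mathcal B_{\eta_j^*,M}$ and $z$; $\ell_j$ is measurable, its risk is well defined for such $\eta$, and the derivatives below exist; and (1) $\rho I\preceq H_j(\theta):=\nabla_\theta^2R_j(\theta,\eta_j^*)\preceq\kappa I$ for $\theta\in\mathcal B_{\theta_j^*,M}$; (2) $\nabla_\theta R_j(\theta_j^*,\eta_j^*)=0$ and $\mathbb E\|\nabla_\theta\ell_j(\theta_j^*,\eta_j^*,Z)\|_2^{r_1}\le\sigma_1$; (3) $\mathbb E|\langle v,(\nabla_\theta^2\ell_j(\theta,\eta_j^*,Z)-H_j(\theta))v\rangle|^{r_2}\le\sigma_2$ for all unit $v$ and $\theta\in\mathcal B_{\theta_j^*,M}$; (4) $\mathbb E\sup\frac{\|\nabla_\theta^2\ell_j(\theta,\eta,Z)-\nabla_\theta^2\ell_j(\theta',\eta',Z)\|_2}{\|\theta-\theta'\|_2+\|\eta-\eta'\|}\le\sigma_3$, the supremum being over distinct pairs $(\theta,\eta)\ne(\theta',\eta')$ in $\mathcal B_{\theta_j^*,M}\times\mathcal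 B_{\eta_j^*,M}$; (5) for $\eta\in\mathcal T_j$ and $h=\eta-\eta_j^*$, the Gateaux derivative $D_\eta\nabla_\theta R_j(\theta_j^*,\eta_j^*)[h]$ is $0$; (6) for such $h$ and every $\bar\eta$ on the segment from $\eta_j^*$ to $\eta$, both $\mathbb E\|D_\eta\nabla_\theta\ell_j(\theta_j^*,\bar\eta,Z)[h]\|_2^2$ and $\mathbb E\|D^2_\eta\nabla_\theta\ell_j(\theta_j^*,\bar\eta,Z)[h,h]\|_2$ are at most $\sigma_5\|h\|^2$. **Nuisance and pilot estimators.** $\mathbb E\|\hat\eta_j-\eta_j^*\|^2\le\sigma_4/s(n_j)^2$, where $s$ is a positive nondecreasing rate function with $s(n)=\omega(n^{1/4})$ and $s(n)\lesssim n^{1/2}$. The pilot estimators satisfy, for every $\epsilon>0$, $\mathbb P(\forall j:\ n_j^\alpha\|\hat\theta_j^{\rm init}-\theta_j^*\|_2<\epsilon)\ge1-p_\epsilon(n_{\min})$, with $\alpha\in(0,1/2]$ and $p_\epsilon(n)\downarrow0$ as $n\uparrow\infty$. **Estimator.** $(\hat\theta_1,\dots,\hat\theta_m)$ minimizes $\sum_j\sum_i\ell_j(\theta_j,\hat\eta_j,Z_{ji})+\sum_{j'<j}\lambda_{jj'}\|\theta_j-\theta_{j'}\|_2$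 over $(\mathbb R^d)^m$, where $w_{jj'}=c_w\|\hat\theta_j^{\rm init}-\hat\theta_{j'}^{\rm init}\|_2^{-\gamma}$ ($=\infty$ if the pilots coincide), and $\lambda_{jj'}=\varepsilon_n$ if $w_{jj'}\le\tau$, $\lambda_{jj'}=w_{jj'}$ otherwise. **Theorem.** Let $c_\xi>0$. There are constants $c_1,c_3,C,\tilde C>0$, depending only on $d,M,\delta,\rho,\kappa,\sigma_1,\dots,\sigma_5,r_1,r_2,\alpha,c_\xi,s$, and for all $c_w>0$, $\gamma\ge0$ a constant $c_0>0$ that may depend on $c_w,\gamma$ as well, such that the following holds in the setting above. Suppose $\xi_k\le c_\xi\min_{j\in S_k}n_j^{-1/2}$ for every $k$, $n_{\min}^{\alpha\gamma}\ge c_0n_{\max}$, $0\le\varepsilon_n\le c_1m^{-2}N_{\min}^{\zeta}$ for some $\zeta<1/2$, and $$c_w(\delta/2)^{-\gamma}<\tau<c_w\bigl\{\tfrac{\delta}{2}n_{\min}^{-\alpha}+2\xi_{\max}\bigr\}^{-\gamma}.$$ Then for every $t$ with $1<t<a:=c_3m^{-1}\min\{n_{\min}^{r_2/(2(r_2+d))},\,s(n_{\min})\}$,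 with probability at least $$1-t^{-1}-p_{\delta/4}(n_{\min})-\mathbb P(\exists j:\hat\eta_j\notin\mathcal T_j)$$ the minimizer exists and every minimizer satisfies: (1) (exact clustering) $\hat\theta_j=\hat\theta_{j'}$ if $j,j'$ lie in the same cluster, and $\hat\theta_j\neq\hat\theta_{j'}$ if they lie in different clusters; (2) (oracle rate) for every $k$ and $j\in S_k$, $$\|\hat\theta_j-\theta_j^*\|_2\le C\,(K^{1/r_1}+b_{k,n})N_k^{-1/2}\,t+\tilde C\,(N_k^{\zeta-1}+\xi_k),\qquad b_{k,n}=K\,m_k^{1/2}\max_{j\in S_k}n_j^{1/2}s(n_j)^{-2}.$$ -/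

import Mathlib

open MeasureTheory ProbabilityTheory Filter Topology Asymptotics
open scoped ENNReal

namespace AdaptiveFusion

noncomputable section

/-- The space `ℝ^d` of target parameters, with its Euclidean norm. -/
abbrev Param (d : ℕ) : Type := EuclideanSpace ℝ (Fin d)

/-! ### One task: risk, score, Hessian, Gateaux derivatives -/

/-- Population risk `R(θ, η) = E_P[ℓ(θ, η, Z)]`. -/
def risk {d : ℕ} {H Z : Type*} [MeasurableSpace Z] (P : Measure Z)
    (ℓ : Param d → H → Z → ℝ) (θ : Param d) (η : H) : ℝ :=
  ∫ z, ℓ θ η z ∂P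

/-- Hessian of `g : ℝ^d → ℝ` at `θ`: the derivative of the gradient. -/
def hess {d : ℕ} (g : Param d → ℝ) (θ : Param d) : Param d →L[ℝ] Param d :=
  fderiv ℝ (fun x => gradient g x) θ

/-- Score `∇_θ ℓ(θ, η, z)`. -/
def score {d : ℕ} {H Z : Type*} (ℓ : Param d → H → Z → ℝ) (θ : Param d) (η : H) (z : Z) :
    Param d :=
  gradient (fun x => ℓ x η z) θ

/-- Hessian `∇_θ² ℓ(θ, η, z)` of the loss. -/
def lossHess {d : ℕ} {H Z : Type*} (ℓ : Param d → H → Z → ℝ) (θ : Param d) (η : H) (z : Z) :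
    Param d →L[ℝ] Param d :=
  hess (fun x => ℓ x η z) θ

/-- First Gateaux derivative of the score in the nuisance, `D_η ∇_θ ℓ(θ, η, z)[h]`. -/
def scoreD {d : ℕ} {H Z : Type*} [NormedAddCommGroup H] [NormedSpace ℝ H]
    (ℓ : Param d → H → Z → ℝ) (θ : Param d) (η : H) (z : Z) (h : H) : Param d :=
  lineDeriv ℝ (fun η' => score ℓ θ η' z) η h

/-- Second Gateaux derivative of the score in the nuisance, `D_η² ∇_θ ℓ(θ, η, z)[h, h]`. -/
def scoreD2 {d : ℕ} {H Z : Type*} [NormedAddCommGroup H] [NormedSpace ℝ H]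
    (ℓ : Param d → H → Z → ℝ) (θ : Param d) (η : H) (z : Z) (h : H) : Param d :=
  lineDeriv ℝ (fun η' => scoreD ℓ θ η' z h) η h

/-- The Lipschitz constant of `(θ, η) ↦ ∇_θ² ℓ(θ, η, z)` (operator norm) over the product of the
closed balls of radius `M` around the true parameters, for the distance
`‖θ - θ'‖ + ‖η - η'‖`. -/
def hessLip {d : ℕ} {H Z : Type*} [NormedAddCommGroup H]
    (ℓ : Param d → H → Z → ℝ) (θs : Param d) (ηs : H) (M : ℝ) (z : Z) : ℝ≥0∞ :=
  ⨆ (x : Param d × H) (_ : x.1 ∈ Metric.closedBall θs M ∧ x.2 ∈ Metric.closedBall ηs M)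
    (y : Param d × H) (_ : y.1 ∈ Metric.closedBall θs M ∧ y.2 ∈ Metric.closedBall ηs M)
    (_ : x ≠ y),
    ENNReal.ofReal (‖lossHess ℓ x.1 x.2 z - lossHess ℓ y.1 y.2 z‖ /
      (‖x.1 - y.1‖ + ‖x.2 - y.2‖))

/-- Loss regularity for one task with distribution `P`, loss `ℓ`, true parameters `(θs, ηs)` and
nuisance realization set `T`.  Expectations of nonnegative quantities are taken in `[0, ∞]`, so
each bound includes finiteness.  The fields `meas`, `integrable`, `diff₁`, `diff₂`, `gdiff₁`,
`gdiff₂` say that the risk and the derivatives that occur in the other fields exist. -/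
structure LossRegularity {d : ℕ} {H Z : Type*} [NormedAddCommGroup H] [NormedSpace ℝ H]
    [MeasurableSpace H] [MeasurableSpace Z] (M ρ κ σ₁ σ₂ σ₃ σ₅ r₁ r₂ : ℝ)
    (P : Measure Z) (ℓ : Param d → H → Z → ℝ) (θs : Param d) (ηs : H) (T : Set H) : Prop where
  meas : Measurable fun x : Param d × H × Z => ℓ x.1 x.2.1 x.2.2
  integrable : ∀ θ : Param d, ∀ η ∈ Metric.closedBall ηs M, Integrable (fun z => ℓ θ η z) P
  convex : ∀ η ∈ Metric.closedBall ηs M, ∀ z : Z, ConvexOn ℝ Set.univ fun θ => ℓ θ η z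
  diff₁ : ∀ θ ∈ Metric.closedBall θs M, ∀ η ∈ Metric.closedBall ηs M, ∀ z : Z,
    DifferentiableAt ℝ (fun x => ℓ x η z) θ
  diff₂ : ∀ θ ∈ Metric.closedBall θs M, ∀ η ∈ Metric.closedBall ηs M, ∀ z : Z,
    DifferentiableAt ℝ (fun x => score ℓ x η z) θ
  /-- Curvature: `ρ I ≼ ∇_θ² R(θ, ηs) ≼ κ I` near `θs`. -/
  curvature : ∀ θ ∈ Metric.closedBall θs M, ∀ v : Param d,
    ρ * ‖v‖ ^ 2 ≤ inner ℝ v (hess (fun x => risk P ℓ x ηs) θ v) ∧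
    inner ℝ v (hess (fun x => risk P ℓ x ηs) θ v) ≤ κ * ‖v‖ ^ 2
  /-- Score: stationarity of the risk and a bounded moment of order `r₁`. -/
  score_mean : gradient (fun x => risk P ℓ x ηs) θs = 0
  score_moment : ∫⁻ z, ‖score ℓ θs ηs z‖ₑ ^ r₁ ∂P ≤ ENNReal.ofReal σ₁
  /-- Hessian moment of order `r₂`. -/
  hess_moment : ∀ θ ∈ Metric.closedBall θs M, ∀ v : Param d, ‖v‖ = 1 →
    ∫⁻ z, ‖inner ℝ v ((lossHess ℓ θ ηs z - hess (fun x => risk P ℓ x ηs) θ) v)‖ₑ ^ r₂ ∂P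
      ≤ ENNReal.ofReal σ₂
  /-- Uniform Lipschitzness of the Hessian, in expectation. -/
  hess_lip_meas : AEMeasurable (hessLip ℓ θs ηs M) P
  hess_lip : ∫⁻ z, hessLip ℓ θs ηs M z ∂P ≤ ENNReal.ofReal σ₃
  /-- Neyman orthogonality: `D_η ∇_θ R(θs, ηs)[η - ηs]` exists and vanishes. -/
  orthogonal : ∀ η ∈ T,
    HasLineDerivAt ℝ (fun η' => gradient (fun x => risk P ℓ x η') θs) 0 ηs (η - ηs)
  /-- The score is twice Gateaux differentiable along the segment from `ηs` to `η ∈ T`. -/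
  gdiff₁ : ∀ η ∈ T, ∀ ηb ∈ segment ℝ ηs η, ∀ z : Z,
    LineDifferentiableAt ℝ (fun η' => score ℓ θs η' z) ηb (η - ηs)
  gdiff₂ : ∀ η ∈ T, ∀ ηb ∈ segment ℝ ηs η, ∀ z : Z,
    LineDifferentiableAt ℝ (fun η' => scoreD ℓ θs η' z (η - ηs)) ηb (η - ηs)
  /-- Bounds on the moments of the Gateaux derivatives. -/
  gmoment₁ : ∀ η ∈ T, ∀ ηb ∈ segment ℝ ηs η,
    ∫⁻ z, ‖scoreD ℓ θs ηb z (η - ηs)‖ₑ ^ (2 : ℝ) ∂P ≤ ENNReal.ofReal (σ₅ * ‖η - ηs‖ ^ 2)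
  gmoment₂ : ∀ η ∈ T, ∀ ηb ∈ segment ℝ ηs η,
    ∫⁻ z, ‖scoreD2 ℓ θs ηb z (η - ηs)‖ₑ ∂P ≤ ENNReal.ofReal (σ₅ * ‖η - ηs‖ ^ 2)

/-- A rate function for the nuisance estimators: positive, nondecreasing, `s(n) = ω(n^{1/4})` and
`s(n) ≲ n^{1/2}`. -/
structure IsNuisanceRate (s : ℕ → ℝ) : Prop where
  pos : ∀ n, 1 ≤ n → 0 < s n
  mono : Monotone s
  lower : (fun n : ℕ => (n : ℝ) ^ (1 / 4 : ℝ)) =o[atTop] s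
  upper : s =O[atTop] fun n : ℕ => (n : ℝ) ^ (1 / 2 : ℝ)

/-! ### Sample sizes and clusters

A partition of the `m` tasks into `K` clusters is given by a surjective labelling
`cl : Fin m → Fin K`; the cluster `S_k` is the fibre over `k`. -/

/-- Smallest task sample size. -/
def nMin {m : ℕ} (n : Fin m → ℕ) : ℕ := ⨅ j, n j

/-- Largest task sample size. -/
def nMax {m : ℕ} (n : Fin m → ℕ) : ℕ := ⨆ j, n j

/-- The cluster `S_k`. -/
def cluster {m K : ℕ} (cl : Fin m → Fin K) (k : Fin K) : Finset (Fin m) :=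
  Finset.univ.filter fun j => cl j = k

/-- Pooled sample size `N_k` of the cluster `S_k`. -/
def pooled {m K : ℕ} (n : Fin m → ℕ) (cl : Fin m → Fin K) (k : Fin K) : ℕ :=
  ∑ j ∈ cluster cl k, n j

/-- Smallest pooled sample size. -/
def pooledMin {m K : ℕ} (n : Fin m → ℕ) (cl : Fin m → Fin K) : ℕ := ⨅ k, pooled n cl k

/-- `b_{k,n} = K |S_k|^{1/2} max_{j ∈ S_k} n_j^{1/2} s(n_j)^{-2}`. -/
def bTerm {m K : ℕ} (s : ℕ → ℝ) (n : Fin m → ℕ) (cl : Fin m → Fin K) (k : Fin K) : ℝ :=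
  (K : ℝ) * ((cluster cl k).card : ℝ) ^ (1 / 2 : ℝ) *
    ⨆ j : {j // j ∈ cluster cl k}, (n j : ℝ) ^ (1 / 2 : ℝ) * (s (n j)) ^ (-2 : ℝ)

/-- Upper limit of the confidence parameter,
`a(n_min) = c m^{-1} min {n_min^{r₂ / (2 (r₂ + d))}, s(n_min)}`. -/
def tMax (c r₂ : ℝ) (d : ℕ) (s : ℕ → ℝ) {m : ℕ} (n : Fin m → ℕ) : ℝ :=
  c * (m : ℝ)⁻¹ * min ((nMin n : ℝ) ^ (r₂ / (2 * (r₂ + d)))) (s (nMin n))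

/-! ### The adaptive fusion estimator -/

/-- Adaptive weight `w = c_w ‖a - b‖^{-γ}` of two pilot estimates; it is `∞` when they coincide
(and `γ > 0`). -/
def weight {d : ℕ} (cw γ : ℝ) (a b : Param d) : ℝ≥0∞ :=
  ENNReal.ofReal cw * ENNReal.ofReal ‖a - b‖ ^ (-γ)

/-- Penalty level: `ε` if the weight is at most `τ`, and the weight itself otherwise. -/
def penalty {d : ℕ} (cw γ τ ε : ℝ) (a b : Param d) : ℝ≥0∞ :=
  if weight cw γ a b ≤ ENNReal.ofReal τ then ENNReal.ofReal ε else weight cw γ a b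

/-- Fused objective
`∑_j ∑_i ℓ_j(θ_j, η_j, Z_{ji}) + ∑_{j' < j} λ_{jj'} ‖θ_j - θ_{j'}‖`; a penalty level `∞` forces
`θ_j = θ_{j'}`. -/
def objective {d m : ℕ} {H Z : Fin m → Type*} (ℓ : ∀ j, Param d → H j → Z j → ℝ)
    {n : Fin m → ℕ} (η : ∀ j, H j) (z : ∀ j, Fin (n j) → Z j) (lam : Fin m → Fin m → ℝ≥0∞)
    (θ : Fin m → Param d) : EReal :=
  ((∑ j, ∑ i, ℓ j (θ j) (η j) (z j i) : ℝ) : EReal) +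
    ((∑ j, ∑ j' ∈ Finset.univ.filter (fun j' => j' < j),
      lam j j' * ENNReal.ofReal ‖θ j - θ j'‖ : ℝ≥0∞) : EReal)

/-- `θ` is an adaptive fusion estimate: a minimizer of the fused objective with plug-in nuisances
`η`, evaluation data `z`, pilot estimates `pilot` and tuning parameters `cw, γ, τ, ε`. -/
def IsFusionEstimate {d m : ℕ} {H Z : Fin m → Type*} (ℓ : ∀ j, Param d → H j → Z j → ℝ)
    {n : Fin m → ℕ} (cw γ τ ε : ℝ) (η : ∀ j, H j) (z : ∀ j, Fin (n j) → Z j)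
    (pilot : Fin m → Param d) (θ : Fin m → Param d) : Prop :=
  ∀ θ' : Fin m → Param d,
    objective ℓ η z (fun j j' => penalty cw γ τ ε (pilot j) (pilot j')) θ ≤
      objective ℓ η z (fun j j' => penalty cw γ τ ε (pilot j) (pilot j')) θ'

/-! ### Probability -/

/-- The event `S` (possibly not measurable) has probability at least `x`. -/
def HoldsWithProb {Ω : Type*} [MeasurableSpace Ω] (μ : Measure Ω) (S : Set Ω) (x : ℝ) : Prop :=
  ∃ A ⊆ S, MeasurableSet A ∧ x ≤ μ.real A

/-- Sampling scheme: the evaluation data `Z_{ji}` are independent over all tasks and units, `Z_{ji}`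
has law `P_j`, and the nuisance estimators are (jointly) independent of them. -/
structure SplitSample {m : ℕ} {Ω : Type*} [MeasurableSpace Ω] (μ : Measure Ω)
    {H Z : Fin m → Type*} [∀ j, MeasurableSpace (H j)] [∀ j, MeasurableSpace (Z j)]
    (P : ∀ j, Measure (Z j)) {n : Fin m → ℕ}
    (D : ∀ j, Fin (n j) → Ω → Z j) (ηhat : ∀ j, Ω → H j) : Prop where
  data_meas : ∀ j i, Measurable (D j i)
  nuis_meas : ∀ j, Measurable (ηhat j)
  law : ∀ j i, μ.map (D j i) = P j
  indep : iIndepFun (fun (p : Σ j, Fin (n j)) => D p.1 p.2) μ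
  split : IndepFun (fun ω j => ηhat j ω) (fun ω (p : Σ j, Fin (n j)) => D p.1 p.2 ω) μ

/-- Nuisance regularity: `E ‖η̂_j - η_j*‖² ≤ σ₄ / s(n_j)²` for every task. -/
def NuisanceRegularity {m : ℕ} {Ω : Type*} [MeasurableSpace Ω] (μ : Measure Ω)
    {H : Fin m → Type*} [∀ j, NormedAddCommGroup (H j)] (s : ℕ → ℝ) (σ₄ : ℝ) (n : Fin m → ℕ)
    (ηs : ∀ j, H j) (ηhat : ∀ j, Ω → H j) : Prop :=
  ∀ j, ∫⁻ ω, ‖ηhat j ω - ηs j‖ₑ ^ (2 : ℝ) ∂μ ≤ ENNReal.ofReal (σ₄ / s (n j) ^ 2)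

/-- Consistent pilot estimators: for every `ε > 0`, with probability at least `1 - p_ε(n_min)`,
`n_j^α ‖pilot_j - θ_j*‖ < ε` for all tasks at once, where `p_ε(n)` decreases to `0`. -/
structure PilotConsistency {d m : ℕ} {Ω : Type*} [MeasurableSpace Ω] (μ : Measure Ω)
    (α : ℝ) (p : ℝ → ℕ → ℝ) (n : Fin m → ℕ) (θs : Fin m → Param d)
    (pilot : Fin m → Ω → Param d) : Prop where
  meas : ∀ j, Measurable (pilot j)
  anti : ∀ ε, 0 < ε → Antitone (p ε)
  tendsto : ∀ ε, 0 < ε → Tendsto (p ε) atTop (𝓝 0)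
  prob : ∀ ε, 0 < ε →
    1 - p ε (nMin n) ≤ μ.real {ω | ∀ j, (n j : ℝ) ^ α * ‖pilot j ω - θs j‖ < ε}

end

end AdaptiveFusion

open AdaptiveFusion

universe u v w

/-! The proof splits into a deterministic statement about convex fusion and a probabilistic
statement that its hypotheses hold.

Deterministic part. When every pilot is within `δ/4 * nMin^(-α)` of its target, the window for `τ`
makes each cross-cluster penalty equal to `ε` and each within-cluster penalty at least a level `Λ`,
which the condition on `nMin^(αγ)` makes larger than a prescribed multiple of `nMax`
(`penalty_of_pilot`, `rpow_separation_ge`). Near the centroids the task losses are Lipschitz with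
constant of order `nMax`, so a cluster whose parameters differ pays more in penalty than it can gain
in loss: collapsing it onto one of its own points lowers the objective (`exists_merge_lt`). Once a
cluster moves as one block, its pooled loss on the sphere of radius `2 R k` around `β k` exceeds its
value at `β k` by more than the cross-cluster penalties can return, so the block stays inside that
ball (`relocate_center_lt`). `fused_minimizers` turns these two moves into a statement about all
global minimizers. The radius `R k` is a multiple of `clusterScale`. The scores of a cluster enter
it only through the norm of their sum, and this is the source of the pooled rate. As `R k ≤ δ/4`,
distinct clusters cannot share an estimate.

Probabilistic part. The growth of the empirical risk at scale `R k` needs no uniform law: for a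
nonnegative convex function vanishing at 0, two-sided quadratic bounds on a fixed finite net scaled
by `R k` already control it from below outside the ball and from above inside a larger one
(`exists_net_convex_growth`). Chebyshev's inequality at the net points suffices, and the Hessian
Lipschitz condition pays for the estimated nuisance. The score at the estimated nuisance is the true
score, plus a fluctuation centred given the nuisance, plus a bias. The first has an `r₁`-th moment
of Rosenthal type (`exists_integral_norm_rpow_sum_le`), which becomes `K^(1/r₁)` after a union over
clusters; the second is controlled by its conditional variance; the third is quadratic in the
nuisance error by Neyman orthogonality (`norm_integral_score_sub_le`) and produces `bTerm`. All
failure events together have probability at most `t⁻¹`, because `m * t` is below a small multiple of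
`s nMin` (`exists_measure_not_goodSample_le`). -/

namespace AdaptiveFusion

/-! ### Convex functions controlled on a finite set of directions -/

section Convex

variable {E : Type*} [NormedAddCommGroup E] [NormedSpace ℝ E]

-- A simplex with 0 in its interior, dilated until it swallows the ball. A convex function is then
-- bounded on the whole ball by its values at finitely many points.
open scoped Pointwise in
theorem exists_finset_ball_subset_convexHull [FiniteDimensional ℝ E] (r : ℝ) (hr : 0 < r) :
    ∃ V : Finset E, Metric.closedBall (0 : E) r ⊆ convexHull ℝ (V : Set E) := by
  classical
  obtain ⟨b, hb, -⟩ := exists_mem_interior_convexHull_affineBasis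
    (Filter.univ_mem : (Set.univ : Set E) ∈ 𝓝 (0 : E))
  obtain ⟨e, he, hsub⟩ := Metric.isOpen_iff.1 isOpen_interior 0 hb
  refine ⟨(Set.finite_range fun i => (2 * r / e) • b i).toFinset, fun x hx => ?_⟩
  have h1 : (e / (2 * r)) • x ∈ convexHull ℝ (Set.range b) := by
    apply interior_subset (hsub _)
    rw [mem_ball_zero_iff, norm_smul, Real.norm_of_nonneg (by positivity)]
    rw [mem_closedBall_zero_iff] at hx
    calc e / (2 * r) * ‖x‖ ≤ e / (2 * r) * r := by gcongr
      _ < e := by field_simp; linarith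
  have h2 : (Set.range fun i => (2 * r / e) • b i) = (2 * r / e) • Set.range b := by
    ext y; simp [Set.mem_smul_set]
  rw [Set.Finite.coe_toFinset, h2, convexHull_smul]
  refine ⟨_, h1, ?_⟩
  simp only [smul_smul]
  rw [show 2 * r / e * (e / (2 * r)) = 1 by field_simp, one_smul]

theorem _root_.ConvexOn.smul_le_of_map_zero {Q : E → ℝ} (hQ : ConvexOn ℝ Set.univ Q)
    (h0 : Q 0 = 0) {a : ℝ} (ha : 0 ≤ a) (ha1 : a ≤ 1) (x : E) : Q (a • x) ≤ a * Q x := by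
  have := hQ.2 (Set.mem_univ x) (Set.mem_univ 0) ha (sub_nonneg.2 ha1) (by ring)
  simpa [h0] using this

/-- The net and the constants depend on neither `Q` nor the scale `R`, so one net serves every task
and sample. The upper bound holds because a convex function on a hull is maximal at a vertex. For
the lower bound, `W` also contains the halves of a net of the unit sphere: for `v` near `u`, the
point `R • v / 2` is the midpoint of `R • u` and the short vector `R • (v - u)`, at which `Q` is
small by the upper bound, so `Q (R • u)` inherits the lower bound. Convexity along rays carries it
outside the sphere. -/
theorem exists_net_convex_growth [FiniteDimensional ℝ E] {lo hi : ℝ} (hlo : 0 < lo)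
    (hhi : 0 < hi) :
    ∃ (W : Finset E) (c C : ℝ), 0 < c ∧ 0 < C ∧
      ∀ Q : E → ℝ, ConvexOn ℝ Set.univ Q → (∀ x, 0 ≤ Q x) → Q 0 = 0 → ∀ R : ℝ, 0 < R →
        (∀ w ∈ W, lo * (‖w‖ * R) ^ 2 ≤ Q (R • w) ∧ Q (R • w) ≤ hi * (‖w‖ * R) ^ 2) →
        (∀ u, R ≤ ‖u‖ → c * R ^ 2 ≤ Q u) ∧ ∀ u, ‖u‖ ≤ 4 * R → Q u ≤ C * R ^ 2 := by
  classical
  obtain ⟨V, hV⟩ := exists_finset_ball_subset_convexHull (E := E) 4 (by norm_num)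
  set B : ℝ := ∑ v ∈ V, ‖v‖ with hB
  have hB0 : 0 ≤ B := Finset.sum_nonneg fun _ _ => norm_nonneg _
  set C : ℝ := hi * (B + 1) ^ 2 with hC
  have hC0 : 0 < C := by positivity
  -- The mesh is chosen so that `e * C ≤ lo / 4`. The midpoint argument yields `lo / 2 - e * C`, of
  -- which `lo / 4` remains.
  set e : ℝ := min 1 (lo / (4 * C)) with he
  have he0 : 0 < e := lt_min one_pos (by positivity)
  obtain ⟨N, hNs, hNf, hN⟩ := (isCompact_sphere (0 : E) 1).finite_cover_balls he0
  refine ⟨V ∪ hNf.toFinset.image (fun v => (1 / 2 : ℝ) • v), lo / 4, C, by positivity, hC0, ?_⟩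
  intro Q hQ hpos h0 R hR hW
  have hub : ∀ u, ‖u‖ ≤ 4 * R → Q u ≤ C * R ^ 2 := by
    intro u hu
    have hmem : R⁻¹ • u ∈ convexHull ℝ (V : Set E) := by
      apply hV
      rw [mem_closedBall_zero_iff, norm_smul, norm_inv, Real.norm_of_nonneg hR.le,
        inv_mul_le_iff₀ hR]
      linarith
    have hcv : ConvexOn ℝ Set.univ (fun x => Q (R • x)) :=
      hQ.comp_linearMap (R • (LinearMap.id : E →ₗ[ℝ] E))
    obtain ⟨v, hv, hle⟩ := hcv.exists_ge_of_mem_convexHull (Set.subset_univ _) hmem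
    rw [show R • R⁻¹ • u = u by rw [smul_smul, mul_inv_cancel₀ hR.ne', one_smul]] at hle
    have hvB : ‖v‖ ≤ B + 1 := by
      have := Finset.single_le_sum (f := fun v : E => ‖v‖) (fun _ _ => norm_nonneg _) hv
      linarith
    calc Q u ≤ Q (R • v) := hle
      _ ≤ hi * (‖v‖ * R) ^ 2 := (hW v (Finset.mem_union_left _ hv)).2
      _ ≤ hi * ((B + 1) * R) ^ 2 := by gcongr
      _ = C * R ^ 2 := by rw [hC]; ring
  refine ⟨?_, hub⟩
  have hsph : ∀ u : E, ‖u‖ = 1 → lo / 4 * R ^ 2 ≤ Q (R • u) := by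
    intro u hu
    obtain ⟨v, hvN, hvu⟩ : ∃ v ∈ N, u ∈ Metric.ball v e := by
      simpa using hN (show u ∈ Metric.sphere (0 : E) 1 by simpa using hu)
    have hv1 : ‖v‖ = 1 := by simpa using hNs hvN
    have hW' := (hW ((1 / 2 : ℝ) • v) (Finset.mem_union_right _
      (Finset.mem_image_of_mem _ (hNf.mem_toFinset.2 hvN)))).1
    rw [norm_smul, hv1] at hW'
    have h1 := hQ.2 (Set.mem_univ (R • u)) (Set.mem_univ (R • (v - u)))
      (by norm_num : (0 : ℝ) ≤ 1 / 2) (by norm_num : (0 : ℝ) ≤ 1 / 2) (by norm_num)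
    have h2 : (1 / 2 : ℝ) • R • u + (1 / 2 : ℝ) • R • (v - u) = R • (1 / 2 : ℝ) • v := by
      module
    rw [h2] at h1
    have h3 : Q (R • (v - u)) ≤ e * (C * R ^ 2) := by
      have h4 : R • (v - u) = e • (R • e⁻¹ • (v - u)) := by
        rw [smul_comm R, smul_smul, mul_inv_cancel₀ he0.ne', one_smul]
      rw [h4]
      refine (hQ.smul_le_of_map_zero h0 he0.le (min_le_left _ _) _).trans ?_
      gcongr
      apply hub
      rw [norm_smul, norm_smul, norm_inv, Real.norm_of_nonneg hR.le, Real.norm_of_nonneg he0.le]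
      have h5 : ‖v - u‖ < e := by rwa [mem_ball_iff_norm, norm_sub_rev] at hvu
      have : e⁻¹ * ‖v - u‖ ≤ 1 := by
        rw [inv_mul_le_iff₀ he0]; linarith
      nlinarith
    have h6 : e * (C * R ^ 2) ≤ lo / 4 * R ^ 2 := by
      have : e * C ≤ lo / 4 := by
        calc e * C ≤ lo / (4 * C) * C := by gcongr; exact min_le_right _ _
          _ = lo / 4 := by field_simp
      nlinarith [sq_nonneg R]
    simp only [smul_eq_mul] at h1
    norm_num at hW'
    nlinarith
  intro u hu
  have hu0 : 0 < ‖u‖ := hR.trans_le hu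
  have h1 := hsph (‖u‖⁻¹ • u) (by rw [norm_smul, norm_inv, norm_norm, inv_mul_cancel₀ hu0.ne'])
  have h2 : R • ‖u‖⁻¹ • u = (R / ‖u‖) • u := by rw [smul_smul]; rfl
  have hle : R / ‖u‖ ≤ 1 := (div_le_one hu0).2 hu
  rw [h2] at h1
  have h3 := hQ.smul_le_of_map_zero h0 (by positivity : 0 ≤ R / ‖u‖) hle u
  have h4 : R / ‖u‖ * Q u ≤ Q u := mul_le_of_le_one_left (hpos u) hle
  linarith

/-- A nonnegative convex function bounded by `A` on the ball of radius `r + s` is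
`A / s`-Lipschitz on the ball of radius `r`. -/
theorem _root_.ConvexOn.sub_le_of_bounded {Q : E → ℝ} (hQ : ConvexOn ℝ Set.univ Q)
    (hpos : ∀ x, 0 ≤ Q x) {r s A : ℝ} (hs : 0 < s) (hA : ∀ x, ‖x‖ ≤ r + s → Q x ≤ A)
    {x y : E} (hx : ‖x‖ ≤ r) : Q x - Q y ≤ A / s * ‖x - y‖ := by
  rcases eq_or_ne x y with rfl | hxy
  · simp
  have hd : 0 < ‖x - y‖ := norm_pos_iff.2 (sub_ne_zero.2 hxy)
  set l := ‖x - y‖ with hl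
  set z : E := x + (s / l) • (x - y) with hz
  have hzA : Q z ≤ A := by
    apply hA
    calc ‖z‖ ≤ ‖x‖ + ‖(s / l) • (x - y)‖ := norm_add_le _ _
      _ = ‖x‖ + s := by
        rw [norm_smul, Real.norm_of_nonneg (by positivity), ← hl, div_mul_cancel₀ _ hd.ne']
      _ ≤ r + s := by linarith
  have h := hQ.2 (Set.mem_univ y) (Set.mem_univ z) (by positivity : 0 ≤ s / (l + s))
    (by positivity : 0 ≤ l / (l + s)) (by field_simp; ring)
  have hxz : (s / (l + s)) • y + (l / (l + s)) • z = x := by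
    have : (l / (l + s)) * (s / l) = s / (l + s) := by field_simp
    rw [hz, smul_add, smul_smul, this]
    have h1 : s / (l + s) + l / (l + s) = 1 := by field_simp; ring
    calc (s / (l + s)) • y + ((l / (l + s)) • x + (s / (l + s)) • (x - y))
        = (s / (l + s) + l / (l + s)) • x := by module
      _ = x := by rw [h1, one_smul]
  rw [hxz] at h
  simp only [smul_eq_mul] at h
  have hA0 : 0 ≤ A := (hpos z).trans hzA
  have h2 : l / (l + s) * Q z ≤ A / s * l := by
    calc l / (l + s) * Q z ≤ l / s * A := by
          gcongr
          · exact hpos z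
          · linarith
      _ = A / s * l := by ring
  have h3 : s / (l + s) * Q y ≤ Q y :=
    mul_le_of_le_one_left (hpos y) ((div_le_one (by positivity)).2 (by linarith))
  linarith

end Convex

/-! ### The fused objective with finite penalties -/

section Fused

variable {E ι κ : Type*} [NormedAddCommGroup E] [Fintype ι] [DecidableEq κ]

/-- Fused objective with penalty level `Λ` inside clusters and `ε` across clusters. -/
noncomputable def fused (f : ι → E → ℝ) (cl : ι → κ) (Λ ε : ℝ) (θ : ι → E) : ℝ :=
  ∑ j, f j (θ j) + 1 / 2 * ∑ j, ∑ j', (if cl j = cl j' then Λ else ε) * ‖θ j - θ j'‖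

/-- Replace all the parameters of the cluster `k` by `y`. -/
def relocate (cl : ι → κ) (θ : ι → E) (k : κ) (y : E) : ι → E :=
  fun j => if cl j = k then y else θ j

/-- The part of the fused objective that does not involve the cluster `k`. -/
noncomputable def fusedOff (f : ι → E → ℝ) (cl : ι → κ) (Λ ε : ℝ) (k : κ) (θ : ι → E) : ℝ :=
  ∑ j with ¬ cl j = k, f j (θ j) + 1 / 2 * ∑ j with ¬ cl j = k, ∑ j' with ¬ cl j' = k,
    (if cl j = cl j' then Λ else ε) * ‖θ j - θ j'‖

theorem fused_split (f : ι → E → ℝ) (cl : ι → κ) (Λ ε : ℝ) (k : κ) (θ : ι → E) :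
    fused f cl Λ ε θ = fusedOff f cl Λ ε k θ + ∑ j with cl j = k, f j (θ j) +
      ε * ∑ j with cl j = k, ∑ l with ¬ cl l = k, ‖θ j - θ l‖ +
      Λ / 2 * ∑ j with cl j = k, ∑ j' with cl j' = k, ‖θ j - θ j'‖ := by
  classical
  have h1 : ∀ g : ι → ℝ, ∑ j, g j = ∑ j with cl j = k, g j + ∑ j with ¬ cl j = k, g j :=
    fun g => (Finset.sum_filter_add_sum_filter_not _ _ _).symm
  have hin : ∑ j with cl j = k, ∑ j' with cl j' = k,
      (if cl j = cl j' then Λ else ε) * ‖θ j - θ j'‖ =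
      Λ * ∑ j with cl j = k, ∑ j' with cl j' = k, ‖θ j - θ j'‖ := by
    rw [Finset.mul_sum]
    refine Finset.sum_congr rfl fun j hj => ?_
    rw [Finset.mul_sum]
    refine Finset.sum_congr rfl fun j' hj' => ?_
    rw [Finset.mem_filter] at hj hj'
    rw [if_pos (hj.2.trans hj'.2.symm)]
  have hcross : ∑ j with cl j = k, ∑ l with ¬ cl l = k,
      (if cl j = cl l then Λ else ε) * ‖θ j - θ l‖ =
      ε * ∑ j with cl j = k, ∑ l with ¬ cl l = k, ‖θ j - θ l‖ := by
    rw [Finset.mul_sum]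
    refine Finset.sum_congr rfl fun j hj => ?_
    rw [Finset.mul_sum]
    refine Finset.sum_congr rfl fun l hl => ?_
    rw [Finset.mem_filter] at hj hl
    rw [if_neg (fun h => hl.2 (h.symm.trans hj.2))]
  have hcross' : ∑ l with ¬ cl l = k, ∑ j with cl j = k,
      (if cl l = cl j then Λ else ε) * ‖θ l - θ j‖ =
      ε * ∑ j with cl j = k, ∑ l with ¬ cl l = k, ‖θ j - θ l‖ := by
    rw [Finset.sum_comm, ← hcross]
    refine Finset.sum_congr rfl fun j _ => Finset.sum_congr rfl fun l _ => ?_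
    rw [norm_sub_rev]
    simp only [eq_comm]
  unfold fused fusedOff
  rw [h1 (fun j => f j (θ j)), h1 (fun j => ∑ j', _)]
  simp_rw [h1 (fun j' => (if cl _ = cl j' then Λ else ε) * ‖θ _ - θ j'‖), Finset.sum_add_distrib]
  rw [hin, hcross, hcross']
  ring

theorem fused_relocate (f : ι → E → ℝ) (cl : ι → κ) (Λ ε : ℝ) (k : κ) (θ : ι → E) (y : E) :
    fused f cl Λ ε (relocate cl θ k y) =
      fusedOff f cl Λ ε k θ + ∑ j with cl j = k, f j y +
        ε * ∑ j with cl j = k, ∑ l with ¬ cl l = k, ‖y - θ l‖ := by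
  classical
  have hp : ∀ j ∈ Finset.univ.filter (fun j => cl j = k), relocate cl θ k y j = y := by
    intro j hj; simp only [relocate, if_pos (Finset.mem_filter.1 hj).2]
  have hn : ∀ j ∈ Finset.univ.filter (fun j => ¬ cl j = k), relocate cl θ k y j = θ j := by
    intro j hj; simp only [relocate, if_neg (Finset.mem_filter.1 hj).2]
  rw [fused_split f cl Λ ε k]
  have e1 : fusedOff f cl Λ ε k (relocate cl θ k y) = fusedOff f cl Λ ε k θ := by
    unfold fusedOff
    congr 1
    · exact Finset.sum_congr rfl fun j hj => by rw [hn j hj]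
    · congr 1
      exact Finset.sum_congr rfl fun j hj => Finset.sum_congr rfl fun l hl => by
        rw [hn j hj, hn l hl]
  have e2 : ∑ j with cl j = k, f j (relocate cl θ k y j) = ∑ j with cl j = k, f j y :=
    Finset.sum_congr rfl fun j hj => by rw [hp j hj]
  have e3 : ∑ j with cl j = k, ∑ l with ¬ cl l = k,
      ‖relocate cl θ k y j - relocate cl θ k y l‖ =
      ∑ j with cl j = k, ∑ l with ¬ cl l = k, ‖y - θ l‖ :=
    Finset.sum_congr rfl fun j hj => Finset.sum_congr rfl fun l hl => by
        rw [hp j hj, hn l hl]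
  have e4 : ∑ j with cl j = k, ∑ j' with cl j' = k,
      ‖relocate cl θ k y j - relocate cl θ k y j'‖ = 0 :=
    Finset.sum_eq_zero fun j hj => Finset.sum_eq_zero fun l hl => by
        rw [hp j hj, hp l hl, sub_self, norm_zero]
  rw [e1, e2, e3, e4]; ring

/-- The cluster collapses onto the member whose total distance to the other clusters is least, so
the cross-cluster penalty cannot increase. The losses rise by at most `G * D`, while the lost
within-cluster penalty is at least `Λ / 2 * D`. -/
theorem exists_merge_lt {f : ι → E → ℝ} {cl : ι → κ} {Λ ε G : ℝ} {k : κ} {θ : ι → E}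
    (hε : 0 ≤ ε) (hΛ : 2 * G < Λ) (hΛ0 : 0 ≤ Λ)
    (hL : ∀ i j, cl i = k → cl j = k → f j (θ i) - f j (θ j) ≤ G * ‖θ i - θ j‖)
    (hne : ∃ i j, cl i = k ∧ cl j = k ∧ θ i ≠ θ j) :
    ∃ i, cl i = k ∧ fused f cl Λ ε (relocate cl θ k (θ i)) < fused f cl Λ ε θ := by
  classical
  obtain ⟨i₁, i₂, h₁, h₂, hne⟩ := hne
  obtain ⟨i, hi, hmin⟩ := Finset.exists_min_image (Finset.univ.filter fun j => cl j = k)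
    (fun j => ∑ l with ¬ cl l = k, ‖θ j - θ l‖) ⟨i₁, by simp [h₁]⟩
  have hik : cl i = k := (Finset.mem_filter.1 hi).2
  refine ⟨i, hik, ?_⟩
  rw [fused_relocate, fused_split f cl Λ ε k θ]
  have hcross : ∑ j with cl j = k, ∑ l with ¬ cl l = k, ‖θ i - θ l‖ ≤
      ∑ j with cl j = k, ∑ l with ¬ cl l = k, ‖θ j - θ l‖ :=
    Finset.sum_le_sum fun j hj => hmin j hj
  set D := ∑ j with cl j = k, ‖θ i - θ j‖ with hD
  have hDpos : 0 < D := by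
    have hz : ∀ j ∈ Finset.univ.filter (fun j => cl j = k), 0 ≤ ‖θ i - θ j‖ :=
      fun _ _ => norm_nonneg _
    refine lt_of_le_of_ne (Finset.sum_nonneg hz) fun h0 => hne ?_
    rw [hD, eq_comm, Finset.sum_eq_zero_iff_of_nonneg hz] at h0
    have e1 := h0 i₁ (by simp [h₁])
    have e2 := h0 i₂ (by simp [h₂])
    rw [norm_eq_zero, sub_eq_zero] at e1 e2
    exact e1.symm.trans e2
  have hf : ∑ j with cl j = k, f j (θ i) ≤ ∑ j with cl j = k, f j (θ j) + G * D := by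
    rw [hD, Finset.mul_sum, ← Finset.sum_add_distrib]
    refine Finset.sum_le_sum fun j hj => ?_
    have := hL i j hik (Finset.mem_filter.1 hj).2
    linarith
  -- A single row of the double sum is enough, which is why the threshold is `2 * G < Λ`.
  have hw : D ≤ ∑ j with cl j = k, ∑ j' with cl j' = k, ‖θ j - θ j'‖ :=
    Finset.single_le_sum (f := fun j => ∑ j' with cl j' = k, ‖θ j - θ j'‖)
      (fun j _ => Finset.sum_nonneg fun _ _ => norm_nonneg _) hi
  have h1 := mul_le_mul_of_nonneg_left hcross hε
  have h2 := mul_le_mul_of_nonneg_left hw (by positivity : 0 ≤ Λ / 2)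
  nlinarith

variable [NormedSpace ℝ E]

/-- Convexity along the segment from `b` to `x` extends the gap on the sphere of radius `r` to a gap
proportional to `‖x - b‖`. By the triangle inequality the cross-cluster penalty changes by at most
`ε * card² * ‖x - b‖`, which the gap beats. -/
theorem relocate_center_lt {f : ι → E → ℝ} {cl : ι → κ} {Λ ε r : ℝ} {k : κ} {θ : ι → E}
    {b x : E} (hf : ∀ j, ConvexOn ℝ Set.univ (f j)) (hε : 0 ≤ ε) (hr : 0 < r)
    (hH : ∀ y, ‖y - b‖ = r →
      ∑ j with cl j = k, f j b + ε * (Fintype.card ι : ℝ) ^ 2 * r < ∑ j with cl j = k, f j y)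
    (hθ : ∀ j, cl j = k → θ j = x) (hx : r ≤ ‖x - b‖) :
    fused f cl Λ ε (relocate cl θ k b) < fused f cl Λ ε θ := by
  classical
  have hθx : relocate cl θ k x = θ := by
    funext j; unfold relocate; split_ifs with h
    · exact (hθ j h).symm
    · rfl
  have hx' := fused_relocate f cl Λ ε k θ x
  rw [hθx] at hx'
  rw [hx', fused_relocate]
  have hd : 0 < ‖x - b‖ := hr.trans_le hx
  set a := r / ‖x - b‖ with ha
  have ha0 : 0 < a := by positivity
  have ha1 : a ≤ 1 := (div_le_one hd).2 hx
  have hy := hH (b + a • (x - b)) (by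
    rw [add_sub_cancel_left, norm_smul, Real.norm_of_nonneg ha0.le, ha, div_mul_cancel₀ _ hd.ne'])
  have hcv : ∑ j with cl j = k, f j (b + a • (x - b)) ≤
      (1 - a) * ∑ j with cl j = k, f j b + a * ∑ j with cl j = k, f j x := by
    rw [Finset.mul_sum, Finset.mul_sum, ← Finset.sum_add_distrib]
    refine Finset.sum_le_sum fun j _ => ?_
    have := (hf j).2 (Set.mem_univ b) (Set.mem_univ x) (sub_nonneg.2 ha1) ha0.le (by ring)
    rwa [show (1 - a) • b + a • x = b + a • (x - b) by module] at this
  set c : ℝ := (Fintype.card ι : ℝ) ^ 2 with hc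
  have hra : r = a * ‖x - b‖ := by rw [ha, div_mul_cancel₀ _ hd.ne']
  have hgap : ε * c * ‖x - b‖ < ∑ j with cl j = k, f j x - ∑ j with cl j = k, f j b := by
    have : a * (ε * c * ‖x - b‖) <
        a * (∑ j with cl j = k, f j x - ∑ j with cl j = k, f j b) := by
      have e : ε * c * r = a * (ε * c * ‖x - b‖) := by rw [hra]; ring
      rw [← e]; linarith
    exact lt_of_mul_lt_mul_left this ha0.le
  have hcross : ∑ j with cl j = k, ∑ l with ¬ cl l = k, ‖b - θ l‖ ≤
      ∑ j with cl j = k, ∑ l with ¬ cl l = k, ‖x - θ l‖ + c * ‖x - b‖ := by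
    have h1 : ∀ l, ‖b - θ l‖ ≤ ‖x - θ l‖ + ‖x - b‖ := fun l => by
      have := norm_sub_le (x - θ l) (x - b)
      rwa [show x - θ l - (x - b) = b - θ l by abel] at this
    calc ∑ j with cl j = k, ∑ l with ¬ cl l = k, ‖b - θ l‖
        ≤ ∑ j with cl j = k, ∑ l with ¬ cl l = k, (‖x - θ l‖ + ‖x - b‖) :=
          Finset.sum_le_sum fun _ _ => Finset.sum_le_sum fun l _ => h1 l
      _ = ∑ j with cl j = k, ∑ l with ¬ cl l = k, ‖x - θ l‖ +
          ((Finset.univ.filter fun j => cl j = k).card : ℝ) *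
            ((Finset.univ.filter fun j => ¬ cl j = k).card : ℝ) * ‖x - b‖ := by
          simp only [Finset.sum_add_distrib, Finset.sum_const, nsmul_eq_mul]; ring
      _ ≤ _ := by
          have e1 : ((Finset.univ.filter fun j => cl j = k).card : ℝ) ≤ Fintype.card ι := by
            exact_mod_cast Finset.card_le_univ _
          have e2 : ((Finset.univ.filter fun j => ¬ cl j = k).card : ℝ) ≤ Fintype.card ι := by
            exact_mod_cast Finset.card_le_univ _
          have e3 := mul_le_mul e1 e2 (Nat.cast_nonneg _) (Nat.cast_nonneg _)
          rw [← sq] at e3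
          exact add_le_add_right (mul_le_mul_of_nonneg_right e3 (norm_nonneg _)) _
  have := mul_le_mul_of_nonneg_left hcross hε
  nlinarith

theorem convexOn_fused {f : ι → E → ℝ} {cl : ι → κ} {Λ ε : ℝ}
    (hf : ∀ j, ConvexOn ℝ Set.univ (f j)) (hε : 0 ≤ ε) (hΛ : 0 ≤ Λ) :
    ConvexOn ℝ Set.univ (fused f cl Λ ε) := by
  refine ⟨convex_univ, fun θ _ θ' _ a b ha hb hab => ?_⟩
  unfold fused
  have h1 : ∀ j, f j ((a • θ + b • θ') j) ≤ a * f j (θ j) + b * f j (θ' j) := fun j => by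
    simpa using (hf j).2 (Set.mem_univ (θ j)) (Set.mem_univ (θ' j)) ha hb hab
  have h2 : ∀ j j', (if cl j = cl j' then Λ else ε) * ‖(a • θ + b • θ') j - (a • θ + b • θ') j'‖ ≤
      a * ((if cl j = cl j' then Λ else ε) * ‖θ j - θ j'‖) +
      b * ((if cl j = cl j' then Λ else ε) * ‖θ' j - θ' j'‖) := fun j j' => by
    have e : (a • θ + b • θ') j - (a • θ + b • θ') j' = a • (θ j - θ j') + b • (θ' j - θ' j') := by
      simp only [Pi.add_apply, Pi.smul_apply]; module
    have h3 : ‖(a • θ + b • θ') j - (a • θ + b • θ') j'‖ ≤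
        a * ‖θ j - θ j'‖ + b * ‖θ' j - θ' j'‖ := by
      rw [e]
      refine (norm_add_le _ _).trans ?_
      rw [norm_smul, norm_smul, Real.norm_of_nonneg ha, Real.norm_of_nonneg hb]
    have h4 : 0 ≤ (if cl j = cl j' then Λ else ε) := by split_ifs <;> assumption
    nlinarith [mul_le_mul_of_nonneg_left h3 h4]
  have h1' := Finset.sum_le_sum fun j (_ : j ∈ Finset.univ) => h1 j
  have h2' := Finset.sum_le_sum fun j (_ : j ∈ Finset.univ) =>
    Finset.sum_le_sum fun j' (_ : j' ∈ Finset.univ) => h2 j j'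
  simp only [Finset.sum_add_distrib, ← Finset.mul_sum] at h1' h2'
  simp only [smul_eq_mul]
  linarith

/-- The Lipschitz bound `hL` is available only in the balls, so merging is legitimate only there. A
minimizer over the compact product of balls exists; merging makes it constant on clusters,
recentring puts it in the interior, and convexity makes it a global minimizer. Any other global
minimizer is then tied to this one along a segment. -/
theorem fused_minimizers [FiniteDimensional ℝ E] {f : ι → E → ℝ} {cl : ι → κ} {Λ ε G : ℝ}
    {b : κ → E} {r : κ → ℝ}
    (hf : ∀ j, ConvexOn ℝ Set.univ (f j)) (hε : 0 ≤ ε) (hΛ : 2 * G < Λ) (hΛ0 : 0 ≤ Λ)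
    (hr : ∀ k, 0 < r k)
    (hH : ∀ k y, ‖y - b k‖ = r k →
      ∑ j with cl j = k, f j (b k) + ε * (Fintype.card ι : ℝ) ^ 2 * r k <
        ∑ j with cl j = k, f j y)
    (hL : ∀ j x y, ‖x - b (cl j)‖ ≤ r (cl j) → ‖y - b (cl j)‖ ≤ r (cl j) →
      f j x - f j y ≤ G * ‖x - y‖) :
    (∃ θ, ∀ θ', fused f cl Λ ε θ ≤ fused f cl Λ ε θ') ∧
      ∀ θ, (∀ θ', fused f cl Λ ε θ ≤ fused f cl Λ ε θ') →
        (∀ j j', cl j = cl j' → θ j = θ j') ∧ ∀ j, ‖θ j - b (cl j)‖ < r (cl j) := by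
  classical
  set B : Set (ι → E) := Set.univ.pi fun j => Metric.closedBall (b (cl j)) (r (cl j)) with hB
  have hcv := convexOn_fused (cl := cl) hf hε hΛ0
  have hmem : ∀ {θ : ι → E}, θ ∈ B ↔ ∀ j, ‖θ j - b (cl j)‖ ≤ r (cl j) := by
    intro θ; simp [hB, Set.mem_pi, dist_eq_norm]
  have hrel : ∀ {θ : ι → E} {k : κ} {y : E}, θ ∈ B → ‖y - b k‖ ≤ r k →
      relocate cl θ k y ∈ B := by
    intro θ k y hθ hy
    rw [hmem] at hθ ⊢
    intro j
    unfold relocate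
    split_ifs with h
    · rw [h]; exact hy
    · exact hθ j
  have hconst : ∀ θ ∈ B, (∀ θ' ∈ B, fused f cl Λ ε θ ≤ fused f cl Λ ε θ') →
      ∀ j j', cl j = cl j' → θ j = θ j' := by
    intro θ hθ hmin j j' hjj
    by_contra hne
    obtain ⟨i, hi, hlt⟩ := exists_merge_lt (f := f) (cl := cl) (k := cl j) (θ := θ) hε hΛ hΛ0
      (fun i i' hi hi' => by
        apply hL
        · rw [hi', ← hi]; exact hmem.1 hθ i
        · exact hmem.1 hθ i') ⟨j, j', rfl, hjj.symm, hne⟩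
    exact absurd (hmin _ (hrel hθ (by rw [← hi]; exact hmem.1 hθ i))) (not_le.2 hlt)
  have hcen : ∀ (θ : ι → E) (j : ι), (∀ j j', cl j = cl j' → θ j = θ j') →
      r (cl j) ≤ ‖θ j - b (cl j)‖ →
      fused f cl Λ ε (relocate cl θ (cl j) (b (cl j))) < fused f cl Λ ε θ :=
    fun θ j hc hle => relocate_center_lt hf hε (hr _) (hH _) (fun j' h => hc j' j h) hle
  have hcont : Continuous (fused f cl Λ ε) := by
    have : ∀ j, Continuous (f j) := fun j =>
      continuousOn_univ.1 ((hf j).continuousOn isOpen_univ)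
    unfold fused
    fun_prop
  have hBc : IsCompact B := isCompact_univ_pi fun j => isCompact_closedBall _ _
  have hBne : B.Nonempty := ⟨fun j => b (cl j), hmem.2 fun j => by simpa using (hr _).le⟩
  obtain ⟨θ₀, hθ₀, hmin₀⟩ := hBc.exists_isMinOn hBne hcont.continuousOn
  have hmin₀' : ∀ θ' ∈ B, fused f cl Λ ε θ₀ ≤ fused f cl Λ ε θ' := fun θ' h => hmin₀ h
  have hc₀ := hconst θ₀ hθ₀ hmin₀'
  have hint : ∀ j, ‖θ₀ j - b (cl j)‖ < r (cl j) := by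
    intro j
    by_contra hle
    exact absurd (hmin₀' _ (hrel hθ₀ (by simpa using (hr _).le)))
      (not_le.2 (hcen θ₀ j hc₀ (not_lt.1 hle)))
  have hnhds : B ∈ 𝓝 θ₀ := by
    refine set_pi_mem_nhds Set.finite_univ fun j _ => ?_
    exact Filter.mem_of_superset (Metric.isOpen_ball.mem_nhds (mem_ball_iff_norm.2 (hint j)))
      Metric.ball_subset_closedBall
  have hglob : ∀ θ', fused f cl Λ ε θ₀ ≤ fused f cl Λ ε θ' :=
    IsMinOn.of_isLocalMin_of_convex_univ (hmin₀.isLocalMin hnhds) hcv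
  refine ⟨⟨θ₀, hglob⟩, fun θ hθ => ?_⟩
  -- `θ` may lie outside the balls. Points of the segment from `θ₀` close to `θ₀` are again
  -- minimizers and lie in `B`, hence are constant on clusters. As `θ₀` is too, so is the
  -- difference, and therefore `θ`.
  have hcθ : ∀ j j', cl j = cl j' → θ j = θ j' := by
    have hlim : Tendsto (fun s : ℝ => (1 - s) • θ₀ + s • θ) (𝓝[>] 0) (𝓝 θ₀) := by
      have : Continuous (fun s : ℝ => (1 - s) • θ₀ + s • θ) := by fun_prop
      have h := this.tendsto 0
      simp only [sub_zero, one_smul, zero_smul, add_zero] at h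
      exact h.mono_left nhdsWithin_le_nhds
    have hev := (hlim.eventually hnhds).and
      (Ioo_mem_nhdsGT (zero_lt_one : (0 : ℝ) < 1))
    obtain ⟨s, hsB, hs0, hs1⟩ := hev.exists
    have hle : fused f cl Λ ε ((1 - s) • θ₀ + s • θ) ≤ fused f cl Λ ε θ₀ := by
      have h := hcv.2 (Set.mem_univ θ₀) (Set.mem_univ θ) (sub_nonneg.2 hs1.le) hs0.le (by ring)
      refine h.trans ?_
      simp only [smul_eq_mul]
      nlinarith [hθ θ₀]
    have hcs := hconst _ hsB fun θ' h => hle.trans (hglob θ')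
    intro j j' hjj
    have h1 := hcs j j' hjj
    simp only [Pi.add_apply, Pi.smul_apply, hc₀ j j' hjj, add_right_inj] at h1
    exact smul_right_injective E hs0.ne' h1
  refine ⟨hcθ, fun j => ?_⟩
  by_contra hle
  exact absurd (hθ _) (not_le.2 (hcen θ j hcθ (not_lt.1 hle)))

end Fused

/-! ### From convex growth to localization -/

section Growth

variable {E ι : Type*} [NormedAddCommGroup E] [InnerProductSpace ℝ E]

/-- First-order Taylor remainder at `x₀` with respect to the slope `g`. -/
def remainder (f : E → ℝ) (x₀ g v : E) : ℝ := f (x₀ + v) - f x₀ - inner ℝ g v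

theorem remainder_zero (f : E → ℝ) (x₀ g : E) : remainder f x₀ g 0 = 0 := by
  simp [remainder]

theorem convexOn_remainder {f : E → ℝ} (hf : ConvexOn ℝ Set.univ f) (x₀ g : E) :
    ConvexOn ℝ Set.univ (remainder f x₀ g) := by
  refine ⟨convex_univ, fun v _ w _ a b ha hb hab => ?_⟩
  have h := hf.2 (Set.mem_univ (x₀ + v)) (Set.mem_univ (x₀ + w)) ha hb hab
  have e : a • (x₀ + v) + b • (x₀ + w) = x₀ + (a • v + b • w) := by
    rw [smul_add, smul_add, add_add_add_comm, ← add_smul, hab, one_smul]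
  rw [e] at h
  simp only [remainder, smul_eq_mul, inner_add_right, inner_smul_right] at h ⊢
  have : f x₀ = a * f x₀ + b * f x₀ := by rw [← add_mul, hab, one_mul]
  linarith

/-- Two-sided growth of the remainder of `f` at `x₀`, at scale `R`, with sample size `N`. -/
structure HasGrowth (f : E → ℝ) (x₀ g : E) (N c C R : ℝ) : Prop where
  convex : ConvexOn ℝ Set.univ f
  nonneg : ∀ v, 0 ≤ remainder f x₀ g v
  lower : ∀ v, R ≤ ‖v‖ → N * (c * R ^ 2) ≤ remainder f x₀ g v
  upper : ∀ v, ‖v‖ ≤ 4 * R → remainder f x₀ g v ≤ N * (C * R ^ 2)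

/-- Boundedness on the ball of radius `4R` leaves a margin `R` around the ball of radius `3R`, on
which the remainder is therefore Lipschitz. The linear part contributes `‖g‖`. -/
theorem HasGrowth.sub_le {f : E → ℝ} {x₀ g : E} {N c C R : ℝ} (h : HasGrowth f x₀ g N c C R)
    (hR : 0 < R) {x y : E} (hx : ‖x - x₀‖ ≤ 3 * R) :
    f x - f y ≤ (‖g‖ + N * (C * R)) * ‖x - y‖ := by
  have h1 := (convexOn_remainder h.convex x₀ g).sub_le_of_bounded h.nonneg (r := 3 * R) (s := R)
    hR (fun v hv => h.upper v (by linarith)) hx (y := y - x₀)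
  simp only [remainder, add_sub_cancel, sub_sub_sub_cancel_right] at h1
  have h2 : inner ℝ g (x - x₀) - inner ℝ g (y - x₀) ≤ ‖g‖ * ‖x - y‖ := by
    rw [← inner_sub_right, sub_sub_sub_cancel_right]
    exact real_inner_le_norm _ _
  have h3 : N * (C * R ^ 2) / R = N * (C * R) := by field_simp
  rw [h3] at h1
  linarith

/-- The remainder is convex and vanishes at 0, so shrinking a point of norm at most `R` by the
factor `ξ / R` gains that factor. This linear gain in `ξ` is what lets the cluster heterogeneity
enter the final rate additively. -/
theorem HasGrowth.small {f : E → ℝ} {x₀ g : E} {N c C R ξ : ℝ} (h : HasGrowth f x₀ g N c C R)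
    (hR : 0 < R) (hξ : ξ ≤ R) {v : E} (hv : ‖v‖ ≤ ξ) :
    remainder f x₀ g v ≤ N * (C * R * ξ) := by
  have hξ0 : 0 ≤ ξ := (norm_nonneg v).trans hv
  rcases hξ0.eq_or_lt with rfl | hpos
  · rw [norm_le_zero_iff] at hv
    rw [hv, remainder_zero]; simp
  have h1 := (convexOn_remainder h.convex x₀ g).smul_le_of_map_zero (remainder_zero _ _ _)
    (by positivity : 0 ≤ ξ / R) ((div_le_one hR).2 hξ) ((R / ξ) • v)
  rw [smul_smul, show ξ / R * (R / ξ) = 1 by field_simp, one_smul] at h1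
  refine h1.trans ?_
  have h2 : ‖(R / ξ) • v‖ ≤ 4 * R := by
    rw [norm_smul, Real.norm_of_nonneg (by positivity)]
    calc R / ξ * ‖v‖ ≤ R / ξ * ξ := by gcongr
      _ = R := by field_simp
      _ ≤ 4 * R := by linarith
  calc ξ / R * remainder f x₀ g ((R / ξ) • v) ≤ ξ / R * (N * (C * R ^ 2)) := by
        gcongr; exact h.upper _ h2
    _ = N * (C * R * ξ) := by field_simp

/-- The growth of each task is around its own `x₀ j`, not around the centre `b`. A sphere of radius
`2R` stays at distance at least `R` from every `x₀ j`, and moving the base point from `x₀ j` to `b`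
costs only `N j * (C * R * ξ)`. Summing before applying Cauchy–Schwarz keeps the norm of the pooled
gradient rather than the sum of the norms. -/
theorem sum_lt_sum_on_sphere {f : ι → E → ℝ} {x₀ g : ι → E} {N : ι → ℝ} {c C R ξ e : ℝ}
    {S : Finset ι} {b : E} (h : ∀ j ∈ S, HasGrowth (f j) (x₀ j) (g j) (N j) c C R)
    (hR : 0 < R) (hξR : ξ ≤ R) (hξ : ∀ j ∈ S, ‖x₀ j - b‖ ≤ ξ)
    (hsmall : C * ξ * ∑ j ∈ S, N j + 2 * ‖∑ j ∈ S, g j‖ + 2 * e < c * R * ∑ j ∈ S, N j)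
    {y : E} (hy : ‖y - b‖ = 2 * R) :
    ∑ j ∈ S, f j b + e * (2 * R) < ∑ j ∈ S, f j y := by
  have h1 : ∀ j ∈ S, inner ℝ (g j) (y - b) + N j * (c * R ^ 2) - N j * (C * R * ξ) ≤
      f j y - f j b := by
    intro j hj
    have hy' : R ≤ ‖y - x₀ j‖ := by
      have : ‖y - b‖ ≤ ‖y - x₀ j‖ + ‖x₀ j - b‖ := norm_sub_le_norm_sub_add_norm_sub _ _ _
      have := hξ j hj
      linarith
    have e1 := (h j hj).lower _ hy'
    have e2 := (h j hj).small hR hξR (v := b - x₀ j) (by rw [norm_sub_rev]; exact hξ j hj)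
    simp only [remainder, add_sub_cancel] at e1 e2
    have e3 : inner ℝ (g j) (y - b) = inner ℝ (g j) (y - x₀ j) - inner ℝ (g j) (b - x₀ j) := by
      rw [← inner_sub_right, sub_sub_sub_cancel_right]
    linarith
  have h2 := Finset.sum_le_sum h1
  rw [Finset.sum_sub_distrib, Finset.sum_add_distrib, ← sum_inner, ← Finset.sum_mul,
    ← Finset.sum_mul, Finset.sum_sub_distrib] at h2
  have h3 : -(‖∑ j ∈ S, g j‖ * (2 * R)) ≤ inner ℝ (∑ j ∈ S, g j) (y - b) := by
    rw [← hy]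
    exact (abs_le.1 (abs_real_inner_le_norm _ _)).1
  nlinarith

end Growth

/-! ### The extended-real objective -/

section Objective

variable {d m K : ℕ} {H Z : Fin m → Type*}

theorem sum_sum_eq_two_mul_sum_lt {a : Fin m → Fin m → ℝ} (hs : ∀ i j, a i j = a j i)
    (h0 : ∀ i, a i i = 0) :
    ∑ i, ∑ j, a i j = 2 * ∑ i, ∑ j with j < i, a i j := by
  have h1 : ∀ i, ∑ j, a i j = ∑ j with j < i, a i j + ∑ j with i < j, a i j := by
    intro i
    rw [Finset.sum_filter, Finset.sum_filter, ← Finset.sum_add_distrib]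
    refine Finset.sum_congr rfl fun j _ => ?_
    rcases lt_trichotomy j i with h | h | h
    · simp [h, not_lt.2 h.le]
    · simp [h, h0]
    · simp [h, not_lt.2 h.le]
  have h2 : ∑ i, ∑ j with i < j, a i j = ∑ i, ∑ j with j < i, a i j := by
    simp only [Finset.sum_filter]
    rw [Finset.sum_comm]
    exact Finset.sum_congr rfl fun i _ => Finset.sum_congr rfl fun j _ => by rw [hs]
  simp only [h1, Finset.sum_add_distrib, h2]
  ring

theorem fused_eq_sum_lt (f : Fin m → Param d → ℝ) (cl : Fin m → Fin K) (Λ ε : ℝ)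
    (θ : Fin m → Param d) :
    fused f cl Λ ε θ = ∑ j, f j (θ j) +
      ∑ j, ∑ j' with j' < j, (if cl j = cl j' then Λ else ε) * ‖θ j - θ j'‖ := by
  unfold fused
  rw [sum_sum_eq_two_mul_sum_lt]
  · ring
  · intro i j; rw [norm_sub_rev]; simp only [eq_comm]
  · intro i; simp

/-- The true within-cluster levels vary from pair to pair and may be infinite. The finite objective
with the common level `Λ` is a minorant that is exact on cluster-constant points, where those levels
do not matter. -/
theorem fused_le_objective (ℓ : ∀ j, Param d → H j → Z j → ℝ) {n : Fin m → ℕ} (η : ∀ j, H j)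
    (z : ∀ j, Fin (n j) → Z j) {lam : Fin m → Fin m → ℝ≥0∞} {cl : Fin m → Fin K} {Λ ε : ℝ}
    (hε : 0 ≤ ε) (hΛ : 0 ≤ Λ)
    (hd : ∀ j j', cl j ≠ cl j' → lam j j' = ENNReal.ofReal ε)
    (hs : ∀ j j', cl j = cl j' → ENNReal.ofReal Λ ≤ lam j j') (θ : Fin m → Param d) :
    (fused (fun j x => ∑ i, ℓ j x (η j) (z j i)) cl Λ ε θ : EReal) ≤ objective ℓ η z lam θ ∧
      ((∀ j j', cl j = cl j' → θ j = θ j') → objective ℓ η z lam θ =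
        (fused (fun j x => ∑ i, ℓ j x (η j) (z j i)) cl Λ ε θ : EReal)) := by
  have hnn : ∀ j j', 0 ≤ (if cl j = cl j' then Λ else ε) * ‖θ j - θ j'‖ := fun j j' =>
    mul_nonneg (by split_ifs <;> assumption) (norm_nonneg _)
  have hcoe : ((∑ j, ∑ j' with j' < j, (if cl j = cl j' then Λ else ε) * ‖θ j - θ j'‖ : ℝ) : EReal)
      = ((∑ j, ∑ j' with j' < j, ENNReal.ofReal ((if cl j = cl j' then Λ else ε) * ‖θ j - θ j'‖) :
        ℝ≥0∞) : EReal) := by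
    have : ∑ j, ∑ j' with j' < j, ENNReal.ofReal ((if cl j = cl j' then Λ else ε) * ‖θ j - θ j'‖)
        = ENNReal.ofReal (∑ j, ∑ j' with j' < j,
            (if cl j = cl j' then Λ else ε) * ‖θ j - θ j'‖) := by
      rw [ENNReal.ofReal_sum_of_nonneg
        fun j _ => Finset.sum_nonneg fun j' _ => hnn j j']
      exact Finset.sum_congr rfl fun j _ =>
        (ENNReal.ofReal_sum_of_nonneg fun j' _ => hnn j j').symm
    rw [this, EReal.coe_ennreal_ofReal, max_eq_left]
    exact Finset.sum_nonneg fun j _ => Finset.sum_nonneg fun j' _ => hnn j j'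
  rw [fused_eq_sum_lt, EReal.coe_add, hcoe]
  unfold objective
  constructor
  · refine add_le_add le_rfl ?_
    rw [EReal.coe_ennreal_le_coe_ennreal_iff]
    refine Finset.sum_le_sum fun j _ => Finset.sum_le_sum fun j' _ => ?_
    rw [ENNReal.ofReal_mul (by split_ifs <;> assumption)]
    gcongr
    split_ifs with h
    · exact hs j j' h
    · exact (hd j j' h).ge
  · intro hc
    congr 2
    refine Finset.sum_congr rfl fun j _ => Finset.sum_congr rfl fun j' _ => ?_
    by_cases h : cl j = cl j'
    · rw [hc j j' h]; simp
    · rw [if_neg h, hd j j' h, ENNReal.ofReal_mul hε]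

/-- All minimizers of the minorant `fused` are cluster-constant, and there it agrees with
`objective`. Hence the two minimal values agree, and each minimizer of `objective` also minimizes
`fused`. -/
theorem fusionEstimate_of_fused (ℓ : ∀ j, Param d → H j → Z j → ℝ) {n : Fin m → ℕ} (η : ∀ j, H j)
    (z : ∀ j, Fin (n j) → Z j) {lam : Fin m → Fin m → ℝ≥0∞} {cl : Fin m → Fin K} {Λ ε G : ℝ}
    {b : Fin K → Param d} {r : Fin K → ℝ}
    (hd : ∀ j j', cl j ≠ cl j' → lam j j' = ENNReal.ofReal ε)
    (hs : ∀ j j', cl j = cl j' → ENNReal.ofReal Λ ≤ lam j j')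
    (hf : ∀ j, ConvexOn ℝ Set.univ fun x => ∑ i, ℓ j x (η j) (z j i))
    (hε : 0 ≤ ε) (hΛ : 2 * G < Λ) (hΛ0 : 0 ≤ Λ) (hr : ∀ k, 0 < r k)
    (hH : ∀ k y, ‖y - b k‖ = r k →
      ∑ j with cl j = k, ∑ i, ℓ j (b k) (η j) (z j i) + ε * (m : ℝ) ^ 2 * r k <
        ∑ j with cl j = k, ∑ i, ℓ j y (η j) (z j i))
    (hL : ∀ j x y, ‖x - b (cl j)‖ ≤ r (cl j) → ‖y - b (cl j)‖ ≤ r (cl j) →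
      ∑ i, ℓ j x (η j) (z j i) - ∑ i, ℓ j y (η j) (z j i) ≤ G * ‖x - y‖) :
    (∃ θ, ∀ θ', objective ℓ η z lam θ ≤ objective ℓ η z lam θ') ∧
      ∀ θ, (∀ θ', objective ℓ η z lam θ ≤ objective ℓ η z lam θ') →
        (∀ j j', cl j = cl j' → θ j = θ j') ∧ ∀ j, ‖θ j - b (cl j)‖ < r (cl j) := by
  obtain ⟨⟨θ₀, h₀⟩, hall⟩ := fused_minimizers (b := b) hf hε hΛ hΛ0 hr
    (by simpa only [Fintype.card_fin] using hH) hL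
  have hle := fused_le_objective ℓ η z hε hΛ0 hd hs
  have h₀c := (hall θ₀ h₀).1
  refine ⟨⟨θ₀, fun θ' => ?_⟩, fun θ hθ => hall θ fun θ' => ?_⟩
  · rw [(hle θ₀).2 h₀c]
    exact (EReal.coe_le_coe_iff.2 (h₀ θ')).trans (hle θ').1
  · have h1 := ((hle θ).1.trans (hθ θ₀)).trans_eq ((hle θ₀).2 h₀c)
    exact (EReal.coe_le_coe_iff.1 h1).trans (h₀ θ')

end Objective

/-! ### Moments of sums of independent centred vectors -/

section Moments

variable {E : Type*} [NormedAddCommGroup E] [InnerProductSpace ℝ E]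

theorem exp_le_quadratic (x : ℝ) : Real.exp x ≤ 1 + x + x ^ 2 * Real.exp |x| := by
  have h := Complex.norm_exp_sub_sum_le_norm_mul_exp (x : ℂ) 2
  simp only [Finset.sum_range_succ, Finset.range_zero, Finset.sum_empty, pow_zero,
    Nat.factorial, pow_one, zero_add] at h
  norm_num at h
  rw [← Complex.ofReal_exp, ← Complex.ofReal_one, ← Complex.ofReal_add, ← Complex.ofReal_sub,
    Complex.norm_real, Real.norm_eq_abs] at h
  have := (abs_le.1 h).2
  linarith

/-- A second-order expansion of `‖·‖ ^ p` with the linear term kept exact, so that it integrates to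
zero when `y` is centred and independent of `x`. -/
theorem exists_norm_add_rpow_le (p : ℝ) (hp : 2 ≤ p) : ∃ C : ℝ, 0 < C ∧ ∀ x y : E,
    ‖x + y‖ ^ p ≤ ‖x‖ ^ p + p * (‖x‖ ^ (p - 2) * inner ℝ x y) +
      C * (‖x‖ ^ (p - 2) * ‖y‖ ^ 2 + ‖y‖ ^ p) := by
  set q := p / 2 with hq
  set b := 5 / 4 * q with hb
  set C₁ := 3 ^ p + p * 2 ^ (p - 1) with hC₁
  set C₂ := q + q ^ 2 * Real.exp b * (25 / 4) with hC₂
  have hC₁0 : 0 < C₁ := by positivity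
  have hC₂0 : 0 < C₂ := by positivity
  refine ⟨C₁ + C₂, by positivity, fun x y => ?_⟩
  have hin := abs_le.1 (abs_real_inner_le_norm x y)
  have hx2 : 0 ≤ ‖x‖ ^ (p - 2) := by positivity
  have hyp : 0 ≤ ‖y‖ ^ p := by positivity
  have hxp : 0 ≤ ‖x‖ ^ p := by positivity
  -- For `‖x‖ ≤ 2‖y‖` every term is dominated by `‖y‖ ^ p`. Otherwise `‖x + y‖² = ‖x‖² (1 + h)` with
  -- `h` bounded, and `(1 + h) ^ q ≤ exp (q * h)` reduces the claim to a quadratic bound for the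
  -- exponential.
  rcases le_or_gt ‖x‖ (2 * ‖y‖) with hc | hc
  · have h1 : ‖x + y‖ ^ p ≤ 3 ^ p * ‖y‖ ^ p := by
      rw [← Real.mul_rpow (by norm_num) (norm_nonneg _)]
      exact Real.rpow_le_rpow (norm_nonneg _) ((norm_add_le x y).trans (by linarith)) (by linarith)
    have h2 : ‖x‖ ^ (p - 2) * (‖x‖ * ‖y‖) ≤ 2 ^ (p - 1) * ‖y‖ ^ p := by
      rcases (norm_nonneg y).eq_or_lt with h0 | h0
      · rw [← h0, mul_zero, mul_zero]; positivity
      calc ‖x‖ ^ (p - 2) * (‖x‖ * ‖y‖) ≤ (2 * ‖y‖) ^ (p - 2) * (2 * ‖y‖ * ‖y‖) := by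
            gcongr
        _ = 2 ^ (p - 1) * ‖y‖ ^ p := by
            rw [Real.mul_rpow (by norm_num) (norm_nonneg _), show p - 1 = (p - 2) + 1 by ring,
              Real.rpow_add_one (by norm_num), show p = (p - 2) + 1 + 1 by ring,
              Real.rpow_add_one h0.ne', Real.rpow_add_one h0.ne']
            ring_nf
    have h3 : -(2 ^ (p - 1) * ‖y‖ ^ p) ≤ ‖x‖ ^ (p - 2) * inner ℝ x y := by
      have := mul_le_mul_of_nonneg_left hin.1 hx2
      linarith
    have h4 : 0 ≤ C₂ * (‖x‖ ^ (p - 2) * ‖y‖ ^ 2 + ‖y‖ ^ p) := by positivity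
    have h5 : 0 ≤ C₁ * (‖x‖ ^ (p - 2) * ‖y‖ ^ 2) := by positivity
    have h6 := mul_le_mul_of_nonneg_left h3 (by linarith : 0 ≤ p)
    have h7 : C₁ * ‖y‖ ^ p = 3 ^ p * ‖y‖ ^ p + p * (2 ^ (p - 1) * ‖y‖ ^ p) := by rw [hC₁]; ring
    linarith
  · have ha : 0 < ‖x‖ := by have := norm_nonneg y; linarith
    set a := ‖x‖ with haa
    set h := (2 * inner ℝ x y + ‖y‖ ^ 2) / a ^ 2 with hh
    set u := ‖y‖ / a with hu
    have hu0 : 0 ≤ u := by positivity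
    have hyu : ‖y‖ = u * a := by rw [hu]; field_simp
    have hu1 : u ≤ 1 / 2 := by rw [hu, div_le_iff₀ ha]; linarith
    have hsq : ‖x + y‖ ^ 2 = a ^ 2 * (1 + h) := by
      rw [norm_add_sq_real, hh]; field_simp; ring
    have hha : |h| ≤ 5 / 2 * u := by
      rw [hh, abs_div, abs_of_pos (by positivity : 0 < a ^ 2), div_le_iff₀ (by positivity), abs_le]
      have k1 : a * ‖y‖ = u * a ^ 2 := by rw [hyu]; ring
      have k2 : ‖y‖ ^ 2 = u * (u * a ^ 2) := by rw [hyu]; ring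
      have k3 : u * (u * a ^ 2) ≤ 1 / 2 * (u * a ^ 2) := by gcongr
      rw [k1] at hin
      constructor <;> linarith [hin.1, hin.2, sq_nonneg ‖y‖]
    have h1h : 0 ≤ 1 + h := by
      have : 0 ≤ a ^ 2 * (1 + h) := hsq ▸ sq_nonneg _
      exact nonneg_of_mul_nonneg_right this (by positivity)
    have h1 : ‖x + y‖ ^ p = a ^ p * (1 + h) ^ q := by
      have e : ∀ w : ℝ, 0 ≤ w → w ^ p = (w ^ 2) ^ q := fun w hw => by
        rw [← Real.rpow_natCast w 2, ← Real.rpow_mul hw, hq]; congr 1; push_cast; ring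
      rw [e _ (norm_nonneg _), hsq, Real.mul_rpow (by positivity) h1h, ← e a ha.le]
    have h2 : (1 + h) ^ q ≤ 1 + q * h + q ^ 2 * h ^ 2 * Real.exp b := by
      have e1 : (1 + h) ^ q ≤ Real.exp (q * h) := by
        calc (1 + h) ^ q ≤ (Real.exp h) ^ q :=
              Real.rpow_le_rpow h1h (by linarith [Real.add_one_le_exp h]) (by positivity)
          _ = Real.exp (q * h) := by rw [← Real.exp_mul, mul_comm]
      have e2 : Real.exp |q * h| ≤ Real.exp b := by
        rw [Real.exp_le_exp, abs_mul, abs_of_nonneg (by positivity : 0 ≤ q), hb]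
        nlinarith [(by positivity : 0 ≤ q)]
      have e3 := exp_le_quadratic (q * h)
      have e4 := mul_le_mul_of_nonneg_left e2 (sq_nonneg (q * h))
      rw [mul_pow] at e3 e4
      linarith
    have hh2 : h ^ 2 ≤ 25 / 4 * u ^ 2 := by
      have := pow_le_pow_left₀ (abs_nonneg h) hha 2
      rw [sq_abs] at this; nlinarith
    have hap : a ^ p = a ^ (p - 2) * a ^ 2 := by
      rw [← Real.rpow_natCast a 2, ← Real.rpow_add ha]; congr 1; push_cast; ring
    have h3 : a ^ p * (q * h) = p * (a ^ (p - 2) * inner ℝ x y) + q * (a ^ (p - 2) * ‖y‖ ^ 2) := by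
      rw [hap, hh, hq]; field_simp
    have h4 : a ^ p * (q ^ 2 * h ^ 2 * Real.exp b) ≤
        q ^ 2 * Real.exp b * (25 / 4) * (a ^ (p - 2) * ‖y‖ ^ 2) := by
      calc a ^ p * (q ^ 2 * h ^ 2 * Real.exp b)
          ≤ a ^ p * (q ^ 2 * (25 / 4 * u ^ 2) * Real.exp b) := by gcongr
        _ = _ := by rw [hap, hyu]; ring
    have h5 := mul_le_mul_of_nonneg_left h2 hxp
    have h6 : 0 ≤ C₁ * (a ^ (p - 2) * ‖y‖ ^ 2 + ‖y‖ ^ p) := by positivity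
    have h7 : 0 ≤ C₂ * ‖y‖ ^ p := by positivity
    have h8 : C₂ * (a ^ (p - 2) * ‖y‖ ^ 2) = q * (a ^ (p - 2) * ‖y‖ ^ 2) +
      q ^ 2 * Real.exp b * (25 / 4) * (a ^ (p - 2) * ‖y‖ ^ 2) := by rw [hC₂]; ring
    rw [h1]
    linarith

variable [CompleteSpace E] [MeasurableSpace E] [BorelSpace E]
  {Ω ι : Type*} [MeasurableSpace Ω] {μ : Measure Ω}

theorem integral_inner_eq_zero {U V : Ω → E} (hi : IndepFun U V μ) (hU : Integrable U μ)
    (hV : Integrable V μ) (h0 : ∫ ω, V ω ∂μ = 0) : ∫ ω, inner ℝ (U ω) (V ω) ∂μ = 0 := by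
  have h := hi.integral_bilin hU hV (innerSL ℝ)
  rw [h0, map_zero] at h
  exact h

variable [SecondCountableTopology E] [IsProbabilityMeasure μ]

theorem integral_norm_sq_sum_le {X : ι → Ω → E} (hX : ∀ i, Measurable (X i))
    (hind : iIndepFun X μ) (h2 : ∀ i, MemLp (X i) 2 μ) (h0 : ∀ i, ∫ ω, X i ω ∂μ = 0)
    (s : Finset ι) :
    ∫ ω, ‖∑ i ∈ s, X i ω‖ ^ 2 ∂μ = ∑ i ∈ s, ∫ ω, ‖X i ω‖ ^ 2 ∂μ := by
  classical
  induction s using Finset.induction with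
  | empty => simp
  | insert a s ha ih =>
    have hS : MemLp (fun ω => ∑ i ∈ s, X i ω) 2 μ := memLp_finsetSum s fun i _ => h2 i
    have hi : IndepFun (fun ω => ∑ i ∈ s, X i ω) (X a) μ := by
      have := hind.indepFun_finsetSum_of_notMem hX ha
      rwa [show (∑ j ∈ s, X j) = fun ω => ∑ i ∈ s, X i ω by funext ω; simp] at this
    have hSi := hS.integrable one_le_two
    have hai := (h2 a).integrable one_le_two
    have hin : ∫ ω, inner ℝ (∑ i ∈ s, X i ω) (X a ω) ∂μ = 0 :=
      integral_inner_eq_zero hi hSi hai (h0 a)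
    have hini : Integrable (fun ω => inner ℝ (∑ i ∈ s, X i ω) (X a ω)) μ :=
      hi.integrable_bilin hSi hai (innerSL ℝ)
    have hSq : Integrable (fun ω => ‖∑ i ∈ s, X i ω‖ ^ 2) μ := hS.integrable_norm_pow two_ne_zero
    have haq : Integrable (fun ω => ‖X a ω‖ ^ 2) μ := (h2 a).integrable_norm_pow two_ne_zero
    rw [Finset.sum_insert ha, ← ih]
    simp_rw [Finset.sum_insert ha, add_comm (X a _), norm_add_sq_real]
    have hadd : Integrable (fun ω => ‖∑ i ∈ s, X i ω‖ ^ 2 +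
        2 * inner ℝ (∑ i ∈ s, X i ω) (X a ω)) μ := hSq.add (hini.const_mul 2)
    rw [integral_add hadd haq, integral_add hSq (hini.const_mul 2), integral_const_mul, hin]
    ring

theorem rpow_sub_two_le {p u L : ℝ} (hp : 2 ≤ p) (hu : 0 ≤ u) (hL : 0 < L) :
    u ^ (p - 2) ≤ u ^ p / L ^ 2 + L ^ (p - 2) := by
  rcases le_or_gt u L with h | h
  · have := Real.rpow_le_rpow hu h (by linarith : 0 ≤ p - 2)
    have : 0 ≤ u ^ p / L ^ 2 := by positivity
    linarith
  · have hu' : 0 < u := hL.trans h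
    have e : u ^ p = u ^ (p - 2) * u ^ 2 := by
      rw [← Real.rpow_natCast u 2, ← Real.rpow_add hu']; congr 1; push_cast; ring
    have h1 : u ^ (p - 2) ≤ u ^ p / L ^ 2 := by
      rw [le_div_iff₀ (by positivity), e]
      gcongr
    have : 0 ≤ L ^ (p - 2) := by positivity
    linarith

/-- Adding one summand raises the `p`-th moment by a multiple of `E‖S‖ ^ (p - 2)` plus a constant,
the linear term vanishing by independence. Truncation at `√(lam * n)` bounds that lower moment by a
small multiple of `n⁻¹ E‖S‖ ^ p` plus a term of order `n ^ (p/2 - 1)`, which is the order of the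
increment of `n ^ (p/2)`; so the induction closes. -/
theorem exists_integral_norm_rpow_sum_le (p B : ℝ) (hp : 2 ≤ p) (hB : 0 ≤ B) :
    ∃ A : ℝ, 0 < A ∧ ∀ {Ω : Type*} {ι : Type*} [MeasurableSpace Ω] {μ : Measure Ω}
      [IsProbabilityMeasure μ] {X : ι → Ω → E}, (∀ i, Measurable (X i)) → iIndepFun X μ →
      (∀ i, MemLp (X i) (ENNReal.ofReal p) μ) → (∀ i, ∫ ω, X i ω ∂μ = 0) →
      (∀ i, ∫ ω, ‖X i ω‖ ^ p ∂μ ≤ B) → ∀ s : Finset ι,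
      ∫ ω, ‖∑ i ∈ s, X i ω‖ ^ p ∂μ ≤ A * (s.card : ℝ) ^ (p / 2) := by
  classical
  obtain ⟨C, hC, hpt⟩ := exists_norm_add_rpow_le (E := E) p hp
  -- With this `lam` the part of the increment that feeds back through the induction hypothesis is
  -- only `A / 4 * w`. `A` is then taken so large that the remaining terms are at most `A / 2 * w`.
  set lam := 4 * C * (B + 1) with hlam
  have hlam0 : 0 < lam := by positivity
  set A := 2 * (C * (B + 1) * lam ^ ((p - 2) / 2) + C * B) + B + 1 with hA
  have hA0 : 0 < A := by positivity
  refine ⟨A, hA0, ?_⟩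
  intro Ω ι _ μ _ X hX hind hpX h0 hBX s
  have hpt2 : (2 : ℝ≥0∞) ≤ ENNReal.ofReal p := by
    rw [← ENNReal.ofReal_ofNat]; exact ENNReal.ofReal_le_ofReal hp
  have hp1 : (1 : ℝ≥0∞) ≤ ENNReal.ofReal p := one_le_two.trans hpt2
  have hp0 : ENNReal.ofReal p ≠ 0 := (zero_lt_one.trans_le hp1).ne'
  have hpR : (ENNReal.ofReal p).toReal = p := ENNReal.toReal_ofReal (by linarith)
  have hpow : ∀ {Y : Ω → E}, MemLp Y (ENNReal.ofReal p) μ → Integrable (fun ω => ‖Y ω‖ ^ p) μ := by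
    intro Y hY
    have := hY.integrable_norm_rpow hp0 ENNReal.ofReal_ne_top
    rwa [hpR] at this
  induction s using Finset.induction with
  | empty =>
    simp only [Finset.sum_empty, norm_zero, Finset.card_empty, Nat.cast_zero]
    rw [Real.zero_rpow (by linarith), Real.zero_rpow (by linarith)]
    simp
  | insert a s ha ih =>
    rw [Finset.card_insert_of_notMem ha]
    rcases s.eq_empty_or_nonempty with rfl | hne
    · simp only [Finset.card_empty, zero_add, Nat.cast_one, Real.one_rpow, mul_one,
        insert_empty_eq, Finset.sum_singleton]
      have : 0 ≤ 2 * (C * (B + 1) * lam ^ ((p - 2) / 2) + C * B) := by positivity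
      linarith [hBX a]
    set n : ℝ := (s.card : ℝ) with hn
    have hn0 : 0 < n := by rw [hn]; exact_mod_cast hne.card_pos
    have hn1 : 1 ≤ n := by rw [hn]; exact_mod_cast hne.card_pos
    set S : Ω → E := fun ω => ∑ i ∈ s, X i ω with hSd
    have hS : MemLp S (ENNReal.ofReal p) μ := memLp_finsetSum s fun i _ => hpX i
    have hi : IndepFun S (X a) μ := by
      have := hind.indepFun_finsetSum_of_notMem hX ha
      rwa [show (∑ j ∈ s, X j) = S by funext ω; simp [hSd]] at this
    have hSm : Measurable S := Finset.measurable_fun_sum _ fun i _ => hX i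
    have hSp := hpow hS
    have hap := hpow (hpX a)
    have hai := (hpX a).integrable hp1
    have haq : Integrable (fun ω => ‖X a ω‖ ^ 2) μ :=
      ((hpX a).mono_exponent hpt2).integrable_norm_pow two_ne_zero
    -- integrability of lower powers of `S`
    have hlow : ∀ r : ℝ, 0 ≤ r → r ≤ p → Integrable (fun ω => ‖S ω‖ ^ r) μ := by
      intro r hr hrp
      refine (hSp.add (integrable_const 1)).mono'
        ((hSm.norm.pow_const r).aestronglyMeasurable) (ae_of_all _ fun ω => ?_)
      rw [Real.norm_of_nonneg (by positivity)]
      simp only [Pi.add_apply]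
      rcases le_or_gt ‖S ω‖ 1 with h | h
      · have := Real.rpow_le_one (norm_nonneg _) h hr
        have : 0 ≤ ‖S ω‖ ^ p := by positivity
        linarith
      · have := Real.rpow_le_rpow_of_exponent_le h.le hrp
        linarith
    have hUi : Integrable (fun ω => ‖S ω‖ ^ (p - 2) • S ω) μ := by
      refine (hlow (p - 1) (by linarith) (by linarith)).mono'
        (((hSm.norm.pow_const _).smul hSm).aestronglyMeasurable) (ae_of_all _ fun ω => ?_)
      rw [norm_smul, Real.norm_of_nonneg (by positivity)]
      rcases (norm_nonneg (S ω)).eq_or_lt with h | h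
      · rw [← h, mul_zero]; positivity
      · rw [← Real.rpow_add_one h.ne']; exact le_of_eq (by congr 1; ring)
    have hUind : IndepFun (fun ω => ‖S ω‖ ^ (p - 2) • S ω) (X a) μ :=
      hi.comp (φ := fun x : E => ‖x‖ ^ (p - 2) • x) (ψ := id)
        ((measurable_norm.pow_const _).smul measurable_id) measurable_id
    have hin : ∫ ω, ‖S ω‖ ^ (p - 2) * inner ℝ (S ω) (X a ω) ∂μ = 0 := by
      have := integral_inner_eq_zero hUind hUi hai (h0 a)
      simpa only [real_inner_smul_left] using this
    have hini : Integrable (fun ω => ‖S ω‖ ^ (p - 2) * inner ℝ (S ω) (X a ω)) μ := by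
      have : Integrable (fun ω => inner ℝ (‖S ω‖ ^ (p - 2) • S ω) (X a ω)) μ :=
        hUind.integrable_bilin hUi hai (innerSL ℝ)
      simpa only [real_inner_smul_left] using this
    have hVind : IndepFun (fun ω => ‖S ω‖ ^ (p - 2)) (fun ω => ‖X a ω‖ ^ 2) μ :=
      hi.comp (φ := fun x : E => ‖x‖ ^ (p - 2)) (ψ := fun x => ‖x‖ ^ 2)
        (measurable_norm.pow_const _) (measurable_norm.pow_const _)
    have hVi := hlow (p - 2) (by linarith) (by linarith)
    have hprod : ∫ ω, ‖S ω‖ ^ (p - 2) * ‖X a ω‖ ^ 2 ∂μ =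
        (∫ ω, ‖S ω‖ ^ (p - 2) ∂μ) * ∫ ω, ‖X a ω‖ ^ 2 ∂μ :=
      hVind.integral_fun_mul_eq_mul_integral hVi.1 haq.1
    have hprodi : Integrable (fun ω => ‖S ω‖ ^ (p - 2) * ‖X a ω‖ ^ 2) μ :=
      hVind.integrable_mul hVi haq
    have hx2 : ∫ ω, ‖X a ω‖ ^ 2 ∂μ ≤ B + 1 := by
      have h1 : ∫ ω, ‖X a ω‖ ^ 2 ∂μ ≤ ∫ ω, (‖X a ω‖ ^ p + 1) ∂μ := by
        refine integral_mono haq (hap.add (integrable_const 1)) fun ω => ?_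
        simp only
        rcases le_or_gt ‖X a ω‖ 1 with h | h
        · have := pow_le_one₀ (n := 2) (norm_nonneg (X a ω)) h
          have : 0 ≤ ‖X a ω‖ ^ p := by positivity
          linarith
        · have := Real.rpow_le_rpow_of_exponent_le h.le hp
          rw [Real.rpow_ofNat] at this
          linarith
      rw [integral_add hap (integrable_const 1)] at h1
      simp at h1
      linarith [hBX a]
    set IS := ∫ ω, ‖S ω‖ ^ p ∂μ with hIS
    have hSlow : ∫ ω, ‖S ω‖ ^ (p - 2) ∂μ ≤ IS / (lam * n) + (lam * n) ^ ((p - 2) / 2) := by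
      have hL : 0 < Real.sqrt (lam * n) := Real.sqrt_pos.2 (by positivity)
      have h1 : ∫ ω, ‖S ω‖ ^ (p - 2) ∂μ ≤
          ∫ ω, (‖S ω‖ ^ p / (Real.sqrt (lam * n)) ^ 2 + (Real.sqrt (lam * n)) ^ (p - 2)) ∂μ :=
        integral_mono hVi ((hSp.div_const _).add (integrable_const _))
          fun ω => rpow_sub_two_le hp (norm_nonneg _) hL
      rw [integral_add (hSp.div_const _) (integrable_const _), integral_div,
        Real.sq_sqrt (by positivity)] at h1
      simp only [integral_const, probReal_univ, one_smul] at h1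
      rwa [Real.sqrt_eq_rpow, ← Real.rpow_mul (by positivity),
        show 1 / 2 * (p - 2) = (p - 2) / 2 by ring] at h1
    have hmain : ∫ ω, ‖∑ i ∈ insert a s, X i ω‖ ^ p ∂μ ≤
        IS + C * ((∫ ω, ‖S ω‖ ^ (p - 2) ∂μ) * (∫ ω, ‖X a ω‖ ^ 2 ∂μ) + ∫ ω, ‖X a ω‖ ^ p ∂μ) := by
      have h1 : ∫ ω, ‖∑ i ∈ insert a s, X i ω‖ ^ p ∂μ ≤
          ∫ ω, (‖S ω‖ ^ p + p * (‖S ω‖ ^ (p - 2) * inner ℝ (S ω) (X a ω)) +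
            C * (‖S ω‖ ^ (p - 2) * ‖X a ω‖ ^ 2 + ‖X a ω‖ ^ p)) ∂μ := by
        refine integral_mono_of_nonneg (ae_of_all _ fun ω => by positivity)
          ((hSp.add (hini.const_mul p)).add ((hprodi.add hap).const_mul C))
          (ae_of_all _ fun ω => ?_)
        simp only
        rw [Finset.sum_insert ha, add_comm]
        exact hpt _ _
      have hadd : Integrable (fun ω => ‖S ω‖ ^ p +
          p * (‖S ω‖ ^ (p - 2) * inner ℝ (S ω) (X a ω))) μ := hSp.add (hini.const_mul p)
      have hadd' : Integrable (fun ω => C * (‖S ω‖ ^ (p - 2) * ‖X a ω‖ ^ 2 + ‖X a ω‖ ^ p)) μ :=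
        (hprodi.add hap).const_mul C
      rw [integral_add hadd hadd',
        integral_add hSp (hini.const_mul p), integral_const_mul, hin, integral_const_mul,
        integral_add hprodi hap, hprod] at h1
      linarith
    set q := p / 2 with hq
    have hqn : n ^ q = n ^ ((p - 2) / 2) * n := by
      rw [← Real.rpow_add_one hn0.ne']; congr 1; rw [hq]; ring
    set w := n ^ ((p - 2) / 2) with hw
    have hw1 : 1 ≤ w := Real.one_le_rpow hn1 (by linarith)
    -- Bernoulli's inequality; it uses `q = p / 2 ≥ 1`.
    have hbern : n ^ q + w ≤ (n + 1) ^ q := by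
      have h1 := one_add_mul_self_le_rpow_one_add (s := 1 / n) (by
        have : 0 ≤ 1 / n := by positivity
        linarith) (p := q) (by rw [hq]; linarith)
      have h2 : (n + 1) ^ q = n ^ q * (1 + 1 / n) ^ q := by
        rw [← Real.mul_rpow hn0.le (by positivity)]; congr 1; field_simp
      have h3 : n ^ q * (1 + q * (1 / n)) = n ^ q + q * w := by rw [hqn]; field_simp
      have h4 : w ≤ q * w := le_mul_of_one_le_left (by positivity) (by rw [hq]; linarith)
      have h5 := mul_le_mul_of_nonneg_left h1 (by positivity : 0 ≤ n ^ q)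
      rw [h2]; linarith
    have hISn : IS / (lam * n) ≤ A * w / lam := by
      rw [div_le_div_iff₀ (by positivity) hlam0]
      have : IS * lam ≤ A * n ^ q * lam := by gcongr
      rw [hqn] at this; linarith
    have hmul : (lam * n) ^ ((p - 2) / 2) = lam ^ ((p - 2) / 2) * w :=
      Real.mul_rpow hlam0.le hn0.le
    have hIS0 : 0 ≤ ∫ ω, ‖S ω‖ ^ (p - 2) ∂μ := integral_nonneg fun ω => by positivity
    have h1 : (∫ ω, ‖S ω‖ ^ (p - 2) ∂μ) * (∫ ω, ‖X a ω‖ ^ 2 ∂μ) ≤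
        (A * w / lam + lam ^ ((p - 2) / 2) * w) * (B + 1) := by
      refine mul_le_mul ?_ hx2 (integral_nonneg fun ω => by positivity) (by positivity)
      rw [← hmul]; linarith
    have h2 : C * (A * w / lam) * (B + 1) = A / 4 * w := by
      rw [hlam]; field_simp
    have h3 := mul_le_mul_of_nonneg_left (add_le_add h1 (hBX a)) hC.le
    have h4 : C * B ≤ C * B * w := le_mul_of_one_le_right (by positivity) hw1
    have h5 : C * (B + 1) * lam ^ ((p - 2) / 2) + C * B ≤ A / 2 := by rw [hA]; linarith
    have h6 := mul_le_mul_of_nonneg_right h5 (by positivity : 0 ≤ w)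
    have h7 := mul_le_mul_of_nonneg_left hbern hA0.le
    have hAw : 0 ≤ A * w := by positivity
    have h9 : C * ((A * w / lam + lam ^ ((p - 2) / 2) * w) * (B + 1) + B) =
        C * (A * w / lam) * (B + 1) + (C * (B + 1) * lam ^ ((p - 2) / 2)) * w + C * B := by ring
    rw [Nat.cast_add, Nat.cast_one, ← hn]
    linarith

end Moments

/-! ### Measurability of derivatives and moments of Taylor remainders -/

section Calculus

theorem lintegral_rpow_le_lintegral_rpow {α : Type*} [MeasurableSpace α] {μ : Measure α}
    [IsProbabilityMeasure μ] {f : α → ℝ≥0∞} (hf : AEMeasurable f μ) {p : ℝ} (hp : 1 ≤ p) :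
    (∫⁻ a, f a ∂μ) ^ p ≤ ∫⁻ a, f a ^ p ∂μ := by
  have h := eLpNorm'_le_eLpNorm'_of_exponent_le (p := 1) (q := p) one_pos hp μ
    hf.aestronglyMeasurable
  simp only [eLpNorm', enorm_eq_self, ENNReal.rpow_one, div_one] at h
  have h2 := ENNReal.rpow_le_rpow h (by linarith : 0 ≤ p)
  rwa [← ENNReal.rpow_mul, one_div, inv_mul_cancel₀ (by linarith), ENNReal.rpow_one] at h2

theorem measurable_section_indicator {F Z : Type*} [MeasurableSpace F] [Zero F]
    [MeasurableSpace Z] {g : ℝ → Z → F}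
    (hm : Measurable fun x : ℝ × Z => (Set.Ico (0 : ℝ) 1).indicator (fun s => g s x.2) x.1)
    {s : ℝ} (hs : s ∈ Set.Ico (0 : ℝ) 1) : Measurable (g s) := by
  have h := hm.comp (measurable_prodMk_left (x := s))
  convert h using 1
  funext z
  simp [Set.indicator_of_mem hs]

variable {A F : Type*} [MeasurableSpace A] [NormedAddCommGroup F] [NormedSpace ℝ F]
  [MeasurableSpace F] [BorelSpace F] [SecondCountableTopology F]

/-- The derivative is a pointwise limit of measurable difference quotients. The indicator confines
the claim to the set where the derivative is known to exist. -/
theorem measurable_indicator_rightDeriv {g : ℝ → A → F} {g' : A → F} {S : Set A}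
    (hS : MeasurableSet S) (hg : ∀ u, Measurable (g u))
    (hd : ∀ a ∈ S, HasDerivWithinAt (fun u => g u a) (g' a) (Set.Ioi 0) 0) :
    Measurable (S.indicator g') := by
  refine measurable_of_tendsto_metrizable' (𝓝[>] (0 : ℝ))
    (f := fun u => S.indicator fun a => slope (fun u => g u a) 0 u) (fun u => ?_) ?_
  · refine Measurable.indicator ?_ hS
    simp only [slope_def_module]
    exact ((hg u).sub (hg 0)).const_smul _
  · rw [tendsto_pi_nhds]
    intro a
    by_cases ha : a ∈ S
    · simp only [Set.indicator_of_mem ha]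
      exact (hasDerivWithinAt_iff_tendsto_slope' (by simp)).1 (hd a ha)
    · simp only [Set.indicator_of_notMem ha]
      exact tendsto_const_nhds

variable {Z : Type*} [MeasurableSpace Z]

/-- Joint measurability on `[0, 1) × Z` of a derivative in the first variable. -/
theorem measurable_indicator_deriv {g g' : ℝ → Z → F}
    (hm : Measurable fun x : ℝ × Z => (Set.Ico (0 : ℝ) 1).indicator (fun s => g s x.2) x.1)
    (hd : ∀ z, ∀ s ∈ Set.Ico (0 : ℝ) 1, HasDerivAt (fun s => g s z) (g' s z) s) :
    Measurable fun x : ℝ × Z => (Set.Ico (0 : ℝ) 1).indicator (fun s => g' s x.2) x.1 := by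
  have hS : MeasurableSet ((Set.Ico (0 : ℝ) 1) ×ˢ (Set.univ : Set Z)) :=
    measurableSet_Ico.prod MeasurableSet.univ
  have h := measurable_indicator_rightDeriv (A := ℝ × Z)
    (g := fun u x => (Set.Ico (0 : ℝ) 1).indicator (fun s => g s x.2) (x.1 + u))
    (g' := fun x => g' x.1 x.2) hS
    (fun u => hm.comp ((measurable_fst.add_const u).prodMk measurable_snd)) ?_
  · convert h using 1
    funext x
    by_cases hx : x.1 ∈ Set.Ico (0 : ℝ) 1
    · rw [Set.indicator_of_mem hx, Set.indicator_of_mem (Set.mk_mem_prod hx (Set.mem_univ _))]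
    · rw [Set.indicator_of_notMem hx, Set.indicator_of_notMem (fun h => hx h.1)]
  · rintro ⟨s, z⟩ ⟨hs, -⟩
    simp only at hs ⊢
    have h1 : HasDerivAt (fun u : ℝ => g (s + u) z) (g' s z) 0 := by
      have := hd z s hs
      rw [← add_zero s] at this
      have h2 := this.comp_const_add s 0
      rwa [add_zero] at h2
    refine h1.hasDerivWithinAt.congr_of_eventuallyEq ?_ ?_
    -- The interval is half-open so that `s + u` stays in it for small `u > 0`. Right difference
    -- quotients therefore never meet the cut-off of the indicator.
    · have : Set.Ioo 0 (1 - s) ∈ 𝓝[>] (0 : ℝ) := Ioo_mem_nhdsGT (by linarith [hs.2])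
      filter_upwards [this] with u hu
      rw [Set.indicator_of_mem]
      exact ⟨by linarith [hs.1, hu.1], by linarith [hu.2]⟩
    · rw [Set.indicator_of_mem]
      simpa using hs

variable [CompleteSpace F]

/-- Fundamental theorem of calculus in `s`, Jensen, then Tonelli. Only moments of `g'` at each fixed
`s` are assumed. -/
theorem lintegral_enorm_sub_rpow_le {P : Measure Z} [IsProbabilityMeasure P]
    {g g' : ℝ → Z → F}
    (hm : Measurable fun x : ℝ × Z => (Set.Ico (0 : ℝ) 1).indicator (fun s => g s x.2) x.1)
    (hd : ∀ z, ∀ s ∈ Set.Icc (0 : ℝ) 1, HasDerivAt (fun s => g s z) (g' s z) s)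
    {p : ℝ} (hp : 1 ≤ p) {B : ℝ≥0∞} (hBt : B ≠ ∞)
    (hB : ∀ s ∈ Set.Ico (0 : ℝ) 1, ∫⁻ z, ‖g' s z‖ₑ ^ p ∂P ≤ B) :
    ∫⁻ z, ‖g 1 z - g 0 z‖ₑ ^ p ∂P ≤ B := by
  have hm' := measurable_indicator_deriv hm fun z s hs => hd z s (Set.Ico_subset_Icc_self hs)
  set ν : Measure ℝ := volume.restrict (Set.Ico (0 : ℝ) 1) with hν
  have : IsProbabilityMeasure ν := ⟨by simp [hν]⟩
  set D : ℝ → Z → F := fun s z => (Set.Ico (0 : ℝ) 1).indicator (fun s => g' s z) s with hD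
  have hDm : Measurable (Function.uncurry D) := hm'
  have hDe : ∀ z s, s ∈ Set.Ico (0 : ℝ) 1 → D s z = g' s z := fun z s hs => by
    simp only [hD, Set.indicator_of_mem hs]
  have hpm : Measurable (Function.uncurry fun z s => ‖D s z‖ₑ ^ p) :=
    ((hDm.comp measurable_swap).enorm.pow_const p)
  have hswap : ∫⁻ z, ∫⁻ s, ‖D s z‖ₑ ^ p ∂ν ∂P ≤ B := by
    rw [lintegral_lintegral_swap hpm.aemeasurable]
    calc ∫⁻ s, ∫⁻ z, ‖D s z‖ₑ ^ p ∂P ∂ν ≤ ∫⁻ s, B ∂ν := by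
          refine lintegral_mono_ae ?_
          rw [hν]
          filter_upwards [ae_restrict_mem measurableSet_Ico] with s hs
          simp only [hDe _ s hs]
          exact hB s hs
      _ = B := by simp
  -- Nothing is assumed about the continuity of `g'` in `s`. Its integrability for almost every `z`,
  -- which the fundamental theorem needs, comes from the finite double integral.
  have hfin : ∀ᵐ z ∂P, ∫⁻ s, ‖D s z‖ₑ ^ p ∂ν < ∞ := by
    refine ae_lt_top ?_ (ne_top_of_le_ne_top hBt hswap)
    exact hpm.lintegral_prod_right'
  refine le_trans (lintegral_mono_ae ?_) hswap
  filter_upwards [hfin] with z hz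
  have hDz : Measurable fun s => D s z := hDm.comp (measurable_id.prodMk measurable_const)
  have hjen : (∫⁻ s, ‖D s z‖ₑ ∂ν) ^ p ≤ ∫⁻ s, ‖D s z‖ₑ ^ p ∂ν :=
    lintegral_rpow_le_lintegral_rpow hDz.enorm.aemeasurable hp
  have hint : Integrable (fun s => D s z) ν := by
    refine ⟨hDz.aestronglyMeasurable, ?_⟩
    rw [hasFiniteIntegral_iff_enorm]
    exact (ENNReal.rpow_lt_top_iff_of_pos (by linarith)).1 (hjen.trans_lt hz)
  have hintg : IntervalIntegrable (fun s => g' s z) volume 0 1 := by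
    rw [intervalIntegrable_iff_integrableOn_Ico_of_le zero_le_one]
    exact (integrableOn_congr_fun (fun s hs => hDe z s hs) measurableSet_Ico).1 hint
  have hftc := intervalIntegral.integral_eq_sub_of_hasDerivAt
    (fun s hs => hd z s (by rwa [Set.uIcc_of_le zero_le_one] at hs)) hintg
  rw [← hftc, intervalIntegral.integral_of_le zero_le_one, ← integral_Ico_eq_integral_Ioc,
    setIntegral_congr_fun measurableSet_Ico (fun s hs => (hDe z s hs).symm)]
  refine le_trans ?_ hjen
  gcongr
  exact enorm_integral_le_lintegral_enorm _

/-- Moment bound for the first-order Taylor remainder on `[0, 1]`. -/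
theorem lintegral_enorm_taylor_rpow_le {P : Measure Z} [IsProbabilityMeasure P]
    {g g' g'' : ℝ → Z → F}
    (hm : Measurable fun x : ℝ × Z => (Set.Ico (0 : ℝ) 1).indicator (fun s => g s x.2) x.1)
    (hd : ∀ z, ∀ s ∈ Set.Icc (0 : ℝ) 1, HasDerivAt (fun s => g s z) (g' s z) s)
    (hd' : ∀ z, ∀ s ∈ Set.Icc (0 : ℝ) 1, HasDerivAt (fun s => g' s z) (g'' s z) s)
    {p : ℝ} (hp : 1 ≤ p) {B : ℝ≥0∞} (hBt : B ≠ ∞)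
    (hB : ∀ s ∈ Set.Ico (0 : ℝ) 1, ∫⁻ z, ‖g'' s z‖ₑ ^ p ∂P ≤ B) :
    ∫⁻ z, ‖g 1 z - g 0 z - g' 0 z‖ₑ ^ p ∂P ≤ B := by
  have hm' := measurable_indicator_deriv hm fun z s hs => hd z s (Set.Ico_subset_Icc_self hs)
  -- The auxiliary path has increment `g 1 - g 0 - g' 0`, and its derivative `(1 - s) • g''`
  -- contains no first-order term.
  have h := lintegral_enorm_sub_rpow_le (P := P) (g := fun s z => g s z + (1 - s) • g' s z)
    (g' := fun s z => (1 - s) • g'' s z) ?_ (fun z s hs => ?_) hp hBt (fun s hs => ?_)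
  · refine le_trans (le_of_eq (lintegral_congr fun z => ?_)) h
    simp [sub_sub]
  · have : Measurable fun x : ℝ × Z =>
        (Set.Ico (0 : ℝ) 1).indicator (fun s => g s x.2) x.1 +
          (1 - x.1) • (Set.Ico (0 : ℝ) 1).indicator (fun s => g' s x.2) x.1 :=
      hm.add ((measurable_const.sub measurable_fst).smul hm')
    convert this using 1
    funext x
    by_cases hx : x.1 ∈ Set.Ico (0 : ℝ) 1
    · simp only [Set.indicator_of_mem hx]
    · simp only [Set.indicator_of_notMem hx, smul_zero, add_zero]
  · have h1 : HasDerivAt (fun s : ℝ => 1 - s) (-1) s := by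
      simpa using (hasDerivAt_id s).const_sub 1
    exact ((hd z s hs).add (h1.smul (hd' z s hs))).congr_deriv (by module)
  · refine le_trans (lintegral_mono fun z => ?_) (hB s hs)
    gcongr
    rw [enorm_smul]
    have : ‖(1 - s : ℝ)‖ₑ ≤ 1 := by
      rw [Real.enorm_eq_ofReal (by linarith [hs.2]), ENNReal.ofReal_le_one]
      linarith [hs.1]
    calc ‖(1 - s : ℝ)‖ₑ * ‖g'' s z‖ₑ ≤ 1 * ‖g'' s z‖ₑ := by gcongr
      _ = _ := one_mul _

/-- Monotonicity of an auxiliary function replaces the integral remainder, so `g''` needs no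
measurability or integrability. -/
theorem taylor_two_bounds {g g' g'' : ℝ → ℝ} {a b : ℝ}
    (hd : ∀ s ∈ Set.Icc (0 : ℝ) 1, HasDerivAt g (g' s) s)
    (hd' : ∀ s ∈ Set.Icc (0 : ℝ) 1, HasDerivAt g' (g'' s) s)
    (hab : ∀ s ∈ Set.Icc (0 : ℝ) 1, a ≤ g'' s ∧ g'' s ≤ b) :
    a / 2 ≤ g 1 - g 0 - g' 0 ∧ g 1 - g 0 - g' 0 ≤ b / 2 := by
  have key : ∀ c : ℝ, ∀ s ∈ Set.Icc (0 : ℝ) 1,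
      HasDerivAt (fun s => g s + (1 - s) * g' s + c / 2 * (1 - s) ^ 2)
        ((1 - s) * (g'' s - c)) s := by
    intro c s hs
    have h1 : HasDerivAt (fun s : ℝ => 1 - s) (-1) s := by
      simpa using (hasDerivAt_id s).const_sub 1
    have h2 := ((hd s hs).add (h1.mul (hd' s hs))).add ((h1.pow 2).const_mul (c / 2))
    exact h2.congr_deriv (by norm_num; ring)
  have h0 : (0 : ℝ) ∈ Set.Icc (0 : ℝ) 1 := by simp
  have h1 : (1 : ℝ) ∈ Set.Icc (0 : ℝ) 1 := by simp
  constructor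
  · have hmono : MonotoneOn (fun s => g s + (1 - s) * g' s + a / 2 * (1 - s) ^ 2)
        (Set.Icc 0 1) := by
      refine monotoneOn_of_deriv_nonneg (convex_Icc 0 1)
        (fun s hs => (key a s hs).continuousAt.continuousWithinAt)
        (fun s hs => (key a s (interior_subset hs)).differentiableAt.differentiableWithinAt)
        fun s hs => ?_
      rw [(key a s (interior_subset hs)).deriv]
      have := interior_subset hs
      exact mul_nonneg (by linarith [this.2]) (by linarith [(hab s this).1])
    have := hmono h0 h1 zero_le_one
    simp only at this
    linarith
  · have hanti : AntitoneOn (fun s => g s + (1 - s) * g' s + b / 2 * (1 - s) ^ 2)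
        (Set.Icc 0 1) := by
      refine antitoneOn_of_deriv_nonpos (convex_Icc 0 1)
        (fun s hs => (key b s hs).continuousAt.continuousWithinAt)
        (fun s hs => (key b s (interior_subset hs)).differentiableAt.differentiableWithinAt)
        fun s hs => ?_
      rw [(key b s (interior_subset hs)).deriv]
      have := interior_subset hs
      exact mul_nonpos_of_nonneg_of_nonpos (by linarith [this.2]) (by linarith [(hab s this).2])
    have := hanti h0 h1 zero_le_one
    simp only at this
    linarith

end Calculus

/-! ### Differentiation of the risk -/

section Risk

variable {d : ℕ}

theorem measurable_indicator_gradient {A : Type*} [MeasurableSpace A] {F : Param d → A → ℝ}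
    (hF : ∀ x, Measurable (F x)) {θ : Param d} {S : Set A} (hS : MeasurableSet S)
    (hd : ∀ a ∈ S, DifferentiableAt ℝ (fun x => F x a) θ) :
    Measurable (S.indicator fun a => gradient (fun x => F x a) θ) := by
  classical
  set b := stdOrthonormalBasis ℝ (Param d)
  have hw : ∀ w : Param d,
      Measurable (S.indicator fun a => inner ℝ w (gradient (fun x => F x a) θ)) := by
    intro w
    refine measurable_indicator_rightDeriv (g := fun u a => F (θ + u • w) a) hS
      (fun u => hF _) fun a ha => ?_
    have h1 := ((hd a ha).hasGradientAt.hasFDerivAt).hasLineDerivAt w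
    simp only [InnerProductSpace.toDual_apply_apply] at h1
    rw [real_inner_comm]
    exact HasDerivAt.hasDerivWithinAt h1
  have hsum : (S.indicator fun a => gradient (fun x => F x a) θ) = fun a =>
      ∑ i, (S.indicator (fun a => inner ℝ (b i) (gradient (fun x => F x a) θ)) a) • b i := by
    funext a
    by_cases ha : a ∈ S
    · simp only [Set.indicator_of_mem ha]
      exact (b.sum_repr' _).symm
    · simp only [Set.indicator_of_notMem ha, zero_smul, Finset.sum_const_zero]
  rw [hsum]
  exact Finset.measurable_fun_sum _ fun i _ => (hw (b i)).smul_const _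

/-- No domination of the gradient is assumed: convexity supplies it. Integrability at finitely many
points bounds the integrand on a ball, and a bounded convex function is Lipschitz on a smaller ball
with an integrable constant. -/
theorem integrable_gradient_and_hasGradientAt_integral {Z : Type*} [MeasurableSpace Z]
    {P : Measure Z} {F : Param d → Z → ℝ} (hF : ∀ x, Measurable (F x))
    (hint : ∀ x, Integrable (F x) P) (hcv : ∀ z, ConvexOn ℝ Set.univ fun x => F x z)
    {θ : Param d} (hd : ∀ z, DifferentiableAt ℝ (fun x => F x z) θ) :
    Integrable (fun z => gradient (fun x => F x z) θ) P ∧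
      HasGradientAt (fun x => ∫ z, F x z ∂P) (∫ z, gradient (fun x => F x z) θ ∂P) θ := by
  classical
  obtain ⟨V, hV⟩ := exists_finset_ball_subset_convexHull (E := Param d) 2 (by norm_num)
  set B : Z → ℝ := fun z => ∑ v ∈ V, |F (θ + v) z| + |F θ z| with hB
  have hBi : Integrable B P :=
    (integrable_finsetSum _ fun v _ => (hint _).abs).add (hint _).abs
  have hB0 : ∀ z, 0 ≤ B z := fun z => by positivity
  have hup : ∀ z w, ‖w‖ ≤ 2 → F (θ + w) z ≤ B z := by
    intro z w hw
    have hw' : w ∈ convexHull ℝ (V : Set (Param d)) := hV (mem_closedBall_zero_iff.2 hw)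
    have hc : ConvexOn ℝ Set.univ (fun w => F (θ + w) z) := by
      have h := (hcv z).translate_right θ
      rwa [Set.preimage_univ] at h
    obtain ⟨v, hv, hle⟩ := hc.exists_ge_of_mem_convexHull (Set.subset_univ _) hw'
    have h1 := Finset.single_le_sum (f := fun v => |F (θ + v) z|) (fun _ _ => abs_nonneg _) hv
    have h2 := le_abs_self (F (θ + v) z)
    have h3 := abs_nonneg (F θ z)
    simp only [hB] at hle ⊢
    linarith
  -- The vertices of the hull bound the function only from above. The lower bound comes from
  -- reflecting through `θ` and using convexity at the midpoint.
  have habs : ∀ z w, ‖w‖ ≤ 2 → |F (θ + w) z| ≤ 3 * B z := by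
    intro z w hw
    rw [abs_le]
    refine ⟨?_, by linarith [hup z w hw, hB0 z]⟩
    have h := (hcv z).2 (Set.mem_univ (θ + w)) (Set.mem_univ (θ + -w))
      (by norm_num : (0 : ℝ) ≤ 1 / 2) (by norm_num : (0 : ℝ) ≤ 1 / 2) (by norm_num)
    rw [show (1 / 2 : ℝ) • (θ + w) + (1 / 2 : ℝ) • (θ + -w) = θ by module] at h
    have h1 := hup z (-w) (by rwa [norm_neg])
    have h2 : -B z ≤ F θ z := by
      have h3 := neg_abs_le (F θ z)
      have h4 : 0 ≤ ∑ v ∈ V, |F (θ + v) z| := by positivity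
      simp only [hB]; linarith
    simp only [smul_eq_mul] at h
    linarith
  have hlip : ∀ z, LipschitzOnWith (Real.nnabs (6 * B z)) (fun x => F x z) (Metric.ball θ 1) := by
    intro z
    have h := ((hcv z).subset (Set.subset_univ (Metric.ball θ 2))
      (convex_ball θ 2)).lipschitzOnWith_of_abs_le (ε := 1) one_pos (M := 3 * B z) fun a ha => by
        have := habs z (a - θ) (by rw [← dist_eq_norm]; exact ha.le)
        rwa [add_sub_cancel] at this
    have e1 : Real.nnabs (6 * B z) = (2 * (3 * B z) / 1).toNNReal := by
      rw [Real.nnabs_of_nonneg (by linarith [hB0 z])]; congr 1; ring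
    have e2 : Metric.ball θ 1 = Metric.ball θ (2 - 1) := by norm_num
    rwa [e1, e2]
  have hgm : Measurable fun z => gradient (fun x => F x z) θ := by
    have := measurable_indicator_gradient hF (θ := θ) MeasurableSet.univ fun z _ => hd z
    simpa using this
  have hmain := hasFDerivAt_integral_of_dominated_loc_of_lip (μ := P) (𝕜 := ℝ)
    (F := F) (F' := fun z => InnerProductSpace.toDual ℝ (Param d) (gradient (fun x => F x z) θ))
    (bound := fun z => 6 * B z) (Metric.ball_mem_nhds θ one_pos)
    (Eventually.of_forall fun x => (hF x).aestronglyMeasurable) (hint θ)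
    (((InnerProductSpace.toDual ℝ (Param d)).continuous.measurable.comp
      hgm).aestronglyMeasurable) (ae_of_all _ hlip) (hBi.const_mul 6)
    (ae_of_all _ fun z => (hd z).hasGradientAt.hasFDerivAt)
  have hgi : Integrable (fun z => gradient (fun x => F x z) θ) P := by
    refine hmain.1.norm.mono' hgm.aestronglyMeasurable (ae_of_all _ fun z => ?_)
    exact ((InnerProductSpace.toDual ℝ (Param d)).norm_map _).ge
  refine ⟨hgi, ?_⟩
  have hI : ∫ z, InnerProductSpace.toDual ℝ (Param d) (gradient (fun x => F x z) θ) ∂P =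
      InnerProductSpace.toDual ℝ (Param d) (∫ z, gradient (fun x => F x z) θ ∂P) :=
    (InnerProductSpace.toDual ℝ (Param d)).toContinuousLinearEquiv.toContinuousLinearMap
      |>.integral_comp_comm hgi
  rw [hasGradientAt_iff_hasFDerivAt, ← hI]
  exact hmain.2

end Risk

/-! ### Consequences of loss regularity for one task -/

section Line

theorem hasDerivAt_line {E F : Type*} [NormedAddCommGroup E] [NormedSpace ℝ E]
    [NormedAddCommGroup F] [NormedSpace ℝ F] {f : E → F} {L : E →L[ℝ] F} {x v : E} {s : ℝ}
    (h : HasFDerivAt f L (x + s • v)) : HasDerivAt (fun s : ℝ => f (x + s • v)) (L v) s := by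
  have h1 : HasDerivAt (fun s : ℝ => x + s • v) v s := by
    simpa using ((hasDerivAt_id s).smul_const v).const_add x
  exact h.comp_hasDerivAt s h1

/-- The path runs with speed `c`, possibly 0, while the line derivative is taken in the unscaled
direction `v`, the only one for which the regularity assumptions speak. -/
theorem hasDerivAt_of_lineDifferentiableAt {E F : Type*} [AddCommGroup E] [Module ℝ E]
    [NormedAddCommGroup F] [NormedSpace ℝ F] {f : E → F} {x v : E} {c s : ℝ}
    (h : LineDifferentiableAt ℝ f (x + s • c • v) v) :
    HasDerivAt (fun s : ℝ => f (x + s • c • v)) (c • lineDeriv ℝ f (x + s • c • v) v) s := by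
  have h1 : HasDerivAt (fun t : ℝ => f (x + s • c • v + t • v)) (lineDeriv ℝ f (x + s • c • v) v)
      ((s - s) * c) := by
    rw [sub_self, zero_mul]; exact h.hasLineDerivAt
  have h2 : HasDerivAt (fun t : ℝ => (t - s) * c) c s := by
    simpa using ((hasDerivAt_id s).sub_const s).mul_const c
  have e : (fun t : ℝ => f (x + t • c • v)) =
      (fun t : ℝ => f (x + s • c • v + t • v)) ∘ fun t => (t - s) * c := by
    funext t
    simp only [Function.comp]
    congr 1
    module
  rw [e]
  exact h1.scomp s h2

theorem add_smul_mem_closedBall {E : Type*} [NormedAddCommGroup E] [NormedSpace ℝ E] {x v : E}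
    {M : ℝ} (hv : ‖v‖ ≤ M) {s : ℝ} (hs : s ∈ Set.Icc (0 : ℝ) 1) :
    x + s • v ∈ Metric.closedBall x M := by
  rw [mem_closedBall_iff_norm, add_sub_cancel_left, norm_smul, Real.norm_of_nonneg hs.1]
  exact (mul_le_of_le_one_left (norm_nonneg _) hs.2).trans hv

theorem inner_gradient_le_sub {E : Type*} [NormedAddCommGroup E] [InnerProductSpace ℝ E]
    [CompleteSpace E] {f : E → ℝ} (hf : ConvexOn ℝ Set.univ f) {x g : E}
    (hg : HasGradientAt f g x) (v : E) : inner ℝ g v ≤ f (x + v) - f x := by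
  have h0 : HasFDerivAt f (InnerProductSpace.toDual ℝ E g) (x + (0 : ℝ) • v) := by
    simpa using hg.hasFDerivAt
  have h1 := (hasDerivAt_line h0).hasDerivWithinAt (s := Set.Ioi 0)
  rw [hasDerivWithinAt_iff_tendsto_slope' (by simp)] at h1
  refine le_of_tendsto h1 ?_
  filter_upwards [Ioo_mem_nhdsGT (zero_lt_one : (0 : ℝ) < 1)] with s hs
  have h2 := hf.2 (Set.mem_univ x) (Set.mem_univ (x + v)) (sub_nonneg.2 hs.2.le) hs.1.le (by ring)
  rw [show (1 - s) • x + s • (x + v) = x + s • v by module] at h2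
  simp only [slope_def_field, zero_smul, add_zero, sub_zero, smul_eq_mul] at h2 ⊢
  rw [div_le_iff₀ hs.1]
  linarith

theorem measurable_indicator_Ico {F Z : Type*} [MeasurableSpace F] [Zero F] [MeasurableSpace Z]
    {g : ℝ → Z → F} (hg : Measurable fun x : ℝ × Z => g x.1 x.2) :
    Measurable fun x : ℝ × Z => (Set.Ico (0 : ℝ) 1).indicator (fun s => g s x.2) x.1 := by
  classical
  simp only [Set.indicator_apply]
  exact Measurable.ite (measurable_fst measurableSet_Ico) hg measurable_const

end Line

namespace LossRegularity

variable {d : ℕ} {H Z : Type*} [NormedAddCommGroup H] [NormedSpace ℝ H] [MeasurableSpace H]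
  [MeasurableSpace Z] {M ρ κ σ₁ σ₂ σ₃ σ₅ r₁ r₂ : ℝ} {P : Measure Z} {ℓ : Param d → H → Z → ℝ}
  {θs : Param d} {ηs : H} {T : Set H}

section Basic

variable (h : LossRegularity M ρ κ σ₁ σ₂ σ₃ σ₅ r₁ r₂ P ℓ θs ηs T)
include h

theorem measurable_loss (θ : Param d) (η : H) : Measurable (ℓ θ η) :=
  h.meas.comp (measurable_const.prodMk (measurable_const.prodMk measurable_id))

theorem measurable_score {θ : Param d} (hθ : θ ∈ Metric.closedBall θs M) {η : H}
    (hη : η ∈ Metric.closedBall ηs M) : Measurable (score ℓ θ η) := by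
  have := measurable_indicator_gradient (F := fun x z => ℓ x η z)
    (fun x => h.measurable_loss x η) (θ := θ) MeasurableSet.univ fun z _ => h.diff₁ θ hθ η hη z
  rwa [Set.indicator_univ] at this

theorem measurable_score_indicator [BorelSpace H] {θ : Param d}
    (hθ : θ ∈ Metric.closedBall θs M) :
    Measurable ((Metric.closedBall ηs M ×ˢ (Set.univ : Set Z)).indicator
      fun x : H × Z => score ℓ θ x.1 x.2) :=
  measurable_indicator_gradient (F := fun x (a : H × Z) => ℓ x a.1 a.2)
    (fun _ => h.meas.comp (measurable_const.prodMk measurable_id))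
    (Metric.isClosed_closedBall.measurableSet.prod MeasurableSet.univ)
    fun a ha => h.diff₁ θ hθ a.1 ha.1 a.2

theorem integrable_score_and_hasGradientAt_risk {θ : Param d}
    (hθ : θ ∈ Metric.closedBall θs M) {η : H} (hη : η ∈ Metric.closedBall ηs M) :
    Integrable (score ℓ θ η) P ∧
      HasGradientAt (fun x => risk P ℓ x η) (∫ z, score ℓ θ η z ∂P) θ :=
  integrable_gradient_and_hasGradientAt_integral (fun x => h.measurable_loss x η)
    (fun x => h.integrable x η hη) (h.convex η hη) fun z => h.diff₁ θ hθ η hη z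

theorem integral_score_eq_zero (hM : 0 ≤ M) : ∫ z, score ℓ θs ηs z ∂P = 0 := by
  have h1 := (h.integrable_score_and_hasGradientAt_risk (Metric.mem_closedBall_self hM)
    (Metric.mem_closedBall_self hM)).2
  rw [← h1.gradient, h.score_mean]

theorem remainder_nonneg (hM : 0 ≤ M) {η : H} (hη : η ∈ Metric.closedBall ηs M) (z : Z)
    (v : Param d) : 0 ≤ remainder (fun x => ℓ x η z) θs (score ℓ θs η z) v := by
  have h1 := inner_gradient_le_sub (h.convex η hη z)
    (h.diff₁ θs (Metric.mem_closedBall_self hM) η hη z).hasGradientAt v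
  have h2 : inner ℝ (score ℓ θs η z) v ≤ ℓ (θs + v) η z - ℓ θs η z := h1
  simp only [remainder]
  linarith

theorem hasDerivAt_loss {v : Param d} (hv : ‖v‖ ≤ M) {η : H} (hη : η ∈ Metric.closedBall ηs M)
    (z : Z) {s : ℝ} (hs : s ∈ Set.Icc (0 : ℝ) 1) :
    HasDerivAt (fun s : ℝ => ℓ (θs + s • v) η z) (inner ℝ (score ℓ (θs + s • v) η z) v) s :=
  hasDerivAt_line (h.diff₁ _ (add_smul_mem_closedBall hv hs) η hη z).hasGradientAt.hasFDerivAt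

theorem hasDerivAt_score {v : Param d} (hv : ‖v‖ ≤ M) {η : H} (hη : η ∈ Metric.closedBall ηs M)
    (z : Z) {s : ℝ} (hs : s ∈ Set.Icc (0 : ℝ) 1) :
    HasDerivAt (fun s : ℝ => inner ℝ (score ℓ (θs + s • v) η z) v)
      (inner ℝ (lossHess ℓ (θs + s • v) η z v) v) s := by
  have h1 : HasDerivAt (fun s : ℝ => score ℓ (θs + s • v) η z)
      (lossHess ℓ (θs + s • v) η z v) s :=
    hasDerivAt_line (h.diff₂ _ (add_smul_mem_closedBall hv hs) η hη z).hasFDerivAt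
  simpa using h1.inner ℝ (hasDerivAt_const s v)

theorem measurable_remainder (hM : 0 ≤ M) (v : Param d) :
    Measurable fun z => remainder (fun x => ℓ x ηs z) θs (score ℓ θs ηs z) v := by
  have h1 := h.measurable_score (Metric.mem_closedBall_self hM) (Metric.mem_closedBall_self hM)
  exact ((h.measurable_loss _ _).sub (h.measurable_loss _ _)).sub (h1.inner measurable_const)

theorem integral_remainder (hM : 0 ≤ M) (v : Param d) :
    Integrable (fun z => remainder (fun x => ℓ x ηs z) θs (score ℓ θs ηs z) v) P ∧
    ∫ z, remainder (fun x => ℓ x ηs z) θs (score ℓ θs ηs z) v ∂P =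
      risk P ℓ (θs + v) ηs - risk P ℓ θs ηs := by
  have hη : ηs ∈ Metric.closedBall ηs M := Metric.mem_closedBall_self hM
  have h1 := (h.integrable_score_and_hasGradientAt_risk (Metric.mem_closedBall_self hM) hη).1
  have h2 : Integrable (fun z => inner ℝ (score ℓ θs ηs z) v) P := h1.inner_const v
  have h3 := h.integrable (θs + v) ηs hη
  have h4 := h.integrable θs ηs hη
  have h34 : Integrable (fun z => ℓ (θs + v) ηs z - ℓ θs ηs z) P := h3.sub h4
  refine ⟨h34.sub h2, ?_⟩
  simp only [remainder]
  have h5 : ∫ z, inner ℝ (score ℓ θs ηs z) v ∂P = 0 := by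
    have := integral_inner (𝕜 := ℝ) h1 v
    simp only [h.integral_score_eq_zero hM, inner_zero_right] at this
    rw [← this]
    exact integral_congr_ae (ae_of_all _ fun z => real_inner_comm _ _)
  rw [integral_sub h34 h2, integral_sub h3 h4, h5, sub_zero]
  rfl

/-- The scores have mean zero, so the mean remainder is the excess risk, and the curvature
assumption bounds it by a second-order expansion. -/
theorem integral_remainder_bounds (hM : 0 ≤ M) (hρ : 0 < ρ) {v : Param d} (hv : ‖v‖ ≤ M) :
    ρ / 2 * ‖v‖ ^ 2 ≤ ∫ z, remainder (fun x => ℓ x ηs z) θs (score ℓ θs ηs z) v ∂P ∧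
      ∫ z, remainder (fun x => ℓ x ηs z) θs (score ℓ θs ηs z) v ∂P ≤ κ / 2 * ‖v‖ ^ 2 := by
  have hη : ηs ∈ Metric.closedBall ηs M := Metric.mem_closedBall_self hM
  rw [(h.integral_remainder hM v).2]
  rcases eq_or_ne v 0 with rfl | hv0
  · simp
  have hg : ∀ θ ∈ Metric.closedBall θs M, HasGradientAt (fun x => risk P ℓ x ηs)
      (gradient (fun x => risk P ℓ x ηs) θ) θ := fun θ hθ =>
    (h.integrable_score_and_hasGradientAt_risk hθ hη).2.differentiableAt.hasGradientAt
  have hd : ∀ θ ∈ Metric.closedBall θs M,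
      HasFDerivAt (fun x => gradient (fun x => risk P ℓ x ηs) x)
        (hess (fun x => risk P ℓ x ηs) θ) θ := by
    intro θ hθ
    -- `hess` is 0 by default where the gradient is not differentiable. The strictly positive lower
    -- curvature bound in the nonzero direction `v` excludes this.
    by_contra hnd
    have hz : hess (fun x => risk P ℓ x ηs) θ = 0 :=
      fderiv_zero_of_not_differentiableAt fun hd => hnd hd.hasFDerivAt
    have h1 := (h.curvature θ hθ v).1
    rw [hz] at h1
    simp only [zero_apply, inner_zero_right] at h1
    have : 0 < ‖v‖ := norm_pos_iff.2 hv0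
    have : 0 < ρ * ‖v‖ ^ 2 := by positivity
    linarith
  have h1 := taylor_two_bounds (g := fun s => risk P ℓ (θs + s • v) ηs)
    (g' := fun s => inner ℝ (gradient (fun x => risk P ℓ x ηs) (θs + s • v)) v)
    (g'' := fun s => inner ℝ (hess (fun x => risk P ℓ x ηs) (θs + s • v) v) v)
    (a := ρ * ‖v‖ ^ 2) (b := κ * ‖v‖ ^ 2)
    (fun s hs => hasDerivAt_line (hg _ (add_smul_mem_closedBall hv hs)).hasFDerivAt)
    (fun s hs => by
      have := hasDerivAt_line (hd _ (add_smul_mem_closedBall hv hs))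
      simpa using this.inner ℝ (hasDerivAt_const s v))
    (fun s hs => by
      rw [real_inner_comm]
      exact h.curvature _ (add_smul_mem_closedBall hv hs) v)
  simp only [one_smul, zero_smul, add_zero, h.score_mean, inner_zero_left, sub_zero] at h1
  constructor <;> linarith [h1.1, h1.2]

end Basic

end LossRegularity

theorem enorm_add_sq_le {a b κ r : ℝ} (hr : 2 ≤ r) (hb : |b| ≤ κ) :
    ‖a + b‖ₑ ^ (2 : ℝ) ≤ 2 * ‖a‖ₑ ^ r + ENNReal.ofReal (2 + 2 * κ ^ 2) := by
  have h1 : (a + b) ^ 2 ≤ 2 * |a| ^ r + (2 + 2 * κ ^ 2) := by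
    have e1 : (a + b) ^ 2 ≤ 2 * a ^ 2 + 2 * b ^ 2 := by nlinarith [sq_nonneg (a - b)]
    have e2 : b ^ 2 ≤ κ ^ 2 := by
      rw [← sq_abs b]; exact pow_le_pow_left₀ (abs_nonneg _) hb 2
    have e3 : a ^ 2 ≤ |a| ^ r + 1 := by
      rw [← sq_abs a]
      rcases le_or_gt |a| 1 with h | h
      · have := pow_le_one₀ (n := 2) (abs_nonneg a) h
        have : 0 ≤ |a| ^ r := by positivity
        linarith
      · have := Real.rpow_le_rpow_of_exponent_le h.le hr
        rw [Real.rpow_ofNat] at this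
        linarith
    linarith
  have h2 : ‖a + b‖ₑ ^ (2 : ℝ) = ENNReal.ofReal ((a + b) ^ 2) := by
    rw [Real.enorm_eq_ofReal_abs, ENNReal.ofReal_rpow_of_nonneg (abs_nonneg _) (by norm_num),
      Real.rpow_ofNat, sq_abs]
  have h3 : ‖a‖ₑ ^ r = ENNReal.ofReal (|a| ^ r) := by
    rw [Real.enorm_eq_ofReal_abs, ENNReal.ofReal_rpow_of_nonneg (abs_nonneg _) (by linarith)]
  rw [h2, h3, show (2 : ℝ≥0∞) = ENNReal.ofReal 2 by simp, ← ENNReal.ofReal_mul (by norm_num),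
    ← ENNReal.ofReal_add (by positivity) (by positivity)]
  exact ENNReal.ofReal_le_ofReal h1

namespace LossRegularity

variable {d : ℕ} {H Z : Type*} [NormedAddCommGroup H] [NormedSpace ℝ H] [MeasurableSpace H]
  [MeasurableSpace Z] {M ρ κ σ₁ σ₂ σ₃ σ₅ r₁ r₂ : ℝ} {P : Measure Z} {ℓ : Param d → H → Z → ℝ}
  {θs : Param d} {ηs : H} {T : Set H}
  (h : LossRegularity M ρ κ σ₁ σ₂ σ₃ σ₅ r₁ r₂ P ℓ θs ηs T)
include h

/-- The second derivative along `v` is `‖v‖²` times a population part bounded by `κ` and a deviation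
with `r₂`-th moment at most `σ₂`. The factor `‖v‖ ^ 4` makes the relative error in
`measure_remainder_le` independent of the scale. -/
theorem lintegral_remainder_sq_le [IsProbabilityMeasure P] (hM : 0 ≤ M) (hρ : 0 < ρ)
    (hσ₂ : 0 ≤ σ₂) (hr₂ : 2 ≤ r₂) {v : Param d} (hv : ‖v‖ ≤ M) :
    ∫⁻ z, ‖remainder (fun x => ℓ x ηs z) θs (score ℓ θs ηs z) v‖ₑ ^ (2 : ℝ) ∂P ≤
      ENNReal.ofReal ((2 * σ₂ + (2 + 2 * κ ^ 2)) * ‖v‖ ^ 4) := by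
  have hη : ηs ∈ Metric.closedBall ηs M := Metric.mem_closedBall_self hM
  rcases eq_or_ne v 0 with rfl | hv0
  · simp [remainder_zero]
  have hvp : 0 < ‖v‖ := norm_pos_iff.2 hv0
  set u : Param d := ‖v‖⁻¹ • v with hu
  have hu1 : ‖u‖ = 1 := by rw [hu, norm_smul, norm_inv, norm_norm, inv_mul_cancel₀ hvp.ne']
  have hvu : v = ‖v‖ • u := by rw [hu, smul_smul, mul_inv_cancel₀ hvp.ne', one_smul]
  have hmain := lintegral_enorm_taylor_rpow_le (P := P) (g := fun s z => ℓ (θs + s • v) ηs z)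
    (g' := fun s z => inner ℝ (score ℓ (θs + s • v) ηs z) v)
    (g'' := fun s z => inner ℝ (lossHess ℓ (θs + s • v) ηs z v) v) ?_
    (fun z s hs => h.hasDerivAt_loss hv hη z hs) (fun z s hs => h.hasDerivAt_score hv hη z hs)
    one_le_two (B := ENNReal.ofReal ((2 * σ₂ + (2 + 2 * κ ^ 2)) * ‖v‖ ^ 4))
    ENNReal.ofReal_ne_top ?_
  · simpa [remainder] using hmain
  · have h1 : Measurable fun x : ℝ × Z => (θs + x.1 • v, ηs, x.2) :=
      ((by fun_prop : Measurable fun s : ℝ => θs + s • v).comp measurable_fst).prodMk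
        (measurable_const.prodMk measurable_snd)
    exact measurable_indicator_Ico (h.meas.comp h1)
  · intro s hs
    have hθ := add_smul_mem_closedBall (x := θs) hv (Set.Ico_subset_Icc_self hs)
    set θ := θs + s • v
    set b := inner ℝ u (hess (fun x => risk P ℓ x ηs) θ u) with hb
    have hbκ : |b| ≤ κ := by
      have := h.curvature θ hθ u
      rw [hu1] at this
      rw [abs_le]
      constructor <;> linarith [this.1, this.2]
    have hpt : ∀ z, ‖inner ℝ (lossHess ℓ θ ηs z v) v‖ₑ ^ (2 : ℝ) =
        ENNReal.ofReal (‖v‖ ^ 4) *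
          ‖inner ℝ u ((lossHess ℓ θ ηs z - hess (fun x => risk P ℓ x ηs) θ) u) + b‖ₑ ^ (2 : ℝ) := by
      intro z
      have e1 : inner ℝ (lossHess ℓ θ ηs z v) v = ‖v‖ ^ 2 *
          (inner ℝ u ((lossHess ℓ θ ηs z - hess (fun x => risk P ℓ x ηs) θ) u) + b) := by
        rw [hb, ← inner_add_right, sub_apply, sub_add_cancel]
        conv_lhs => rw [hvu]
        rw [map_smul, inner_smul_left, inner_smul_right, real_inner_comm]
        simp; ring
      rw [e1, enorm_mul, ENNReal.mul_rpow_of_nonneg _ _ (by norm_num)]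
      congr 1
      rw [Real.enorm_of_nonneg (by positivity), ENNReal.ofReal_rpow_of_nonneg (by positivity)
        (by norm_num), Real.rpow_ofNat]
      congr 1; ring
    simp_rw [hpt]
    rw [lintegral_const_mul' _ _ ENNReal.ofReal_ne_top]
    calc _ ≤ ENNReal.ofReal (‖v‖ ^ 4) * ∫⁻ z, (2 * ‖inner ℝ u ((lossHess ℓ θ ηs z -
            hess (fun x => risk P ℓ x ηs) θ) u)‖ₑ ^ r₂ + ENNReal.ofReal (2 + 2 * κ ^ 2)) ∂P := by
          gcongr with z
          exact enorm_add_sq_le hr₂ hbκ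
      _ ≤ ENNReal.ofReal (‖v‖ ^ 4) * (2 * ENNReal.ofReal σ₂ + ENNReal.ofReal (2 + 2 * κ ^ 2)) := by
          rw [lintegral_add_right _ measurable_const, lintegral_const_mul' _ _ (by simp)]
          gcongr
          · exact h.hess_moment θ hθ u hu1
          · simp
      _ = _ := by
          have e2 : (2 : ℝ≥0∞) * ENNReal.ofReal σ₂ = ENNReal.ofReal (2 * σ₂) := by
            rw [ENNReal.ofReal_mul (by norm_num)]; simp
          rw [e2, ← ENNReal.ofReal_add (by positivity) (by positivity),
            ← ENNReal.ofReal_mul (by positivity)]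
          congr 1; ring

/-- The Lipschitz bound on the Hessian compares the two nuisances at the same `θ`. A second-order
expansion of the difference of the losses then gives the factor `‖v‖²`. -/
theorem enorm_remainder_sub_le (hM : 0 ≤ M) {v : Param d} (hv : ‖v‖ ≤ M) {η : H}
    (hη : η ∈ Metric.closedBall ηs M) (z : Z) :
    ‖remainder (fun x => ℓ x η z) θs (score ℓ θs η z) v -
      remainder (fun x => ℓ x ηs z) θs (score ℓ θs ηs z) v‖ₑ ≤
      hessLip ℓ θs ηs M z * ‖η - ηs‖ₑ * ENNReal.ofReal (‖v‖ ^ 2) := by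
  have hη' : ηs ∈ Metric.closedBall ηs M := Metric.mem_closedBall_self hM
  rcases eq_or_ne v 0 with rfl | hv0
  · simp [remainder_zero]
  rcases eq_or_ne η ηs with rfl | hne
  · simp
  have hvp : 0 < ‖v‖ := norm_pos_iff.2 hv0
  have hnp : 0 < ‖η - ηs‖ := norm_pos_iff.2 (sub_ne_zero.2 hne)
  rcases eq_or_ne (hessLip ℓ θs ηs M z) ∞ with htop | hfin
  · rw [htop, ENNReal.top_mul (by simpa using sub_ne_zero.2 hne),
      ENNReal.top_mul (by simp; positivity)]
    exact le_top
  set L := (hessLip ℓ θs ηs M z).toReal with hL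
  have hLip : ∀ θ ∈ Metric.closedBall θs M,
      ‖lossHess ℓ θ η z - lossHess ℓ θ ηs z‖ ≤ L * ‖η - ηs‖ := by
    intro θ hθ
    have h1 : ENNReal.ofReal (‖lossHess ℓ θ η z - lossHess ℓ θ ηs z‖ / ‖η - ηs‖) ≤
        hessLip ℓ θs ηs M z := by
      unfold hessLip
      refine le_iSup_of_le (θ, η) (le_iSup_of_le ⟨hθ, hη⟩ (le_iSup_of_le (θ, ηs)
        (le_iSup_of_le ⟨hθ, hη'⟩ (le_iSup_of_le (fun e => hne (Prod.ext_iff.1 e).2) ?_))))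
      simp
    have h2 := (ENNReal.ofReal_le_iff_le_toReal hfin).1 h1
    rwa [div_le_iff₀ hnp] at h2
  have h1 := taylor_two_bounds
    (g := fun s => ℓ (θs + s • v) η z - ℓ (θs + s • v) ηs z)
    (g' := fun s => inner ℝ (score ℓ (θs + s • v) η z) v -
      inner ℝ (score ℓ (θs + s • v) ηs z) v)
    (g'' := fun s => inner ℝ (lossHess ℓ (θs + s • v) η z v) v -
      inner ℝ (lossHess ℓ (θs + s • v) ηs z v) v)
    (a := -(L * ‖η - ηs‖ * ‖v‖ ^ 2)) (b := L * ‖η - ηs‖ * ‖v‖ ^ 2)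
    (fun s hs => (h.hasDerivAt_loss hv hη z hs).sub (h.hasDerivAt_loss hv hη' z hs))
    (fun s hs => (h.hasDerivAt_score hv hη z hs).sub (h.hasDerivAt_score hv hη' z hs))
    (fun s hs => by
      rw [← abs_le, ← inner_sub_left, ← sub_apply]
      calc |inner ℝ ((lossHess ℓ (θs + s • v) η z - lossHess ℓ (θs + s • v) ηs z) v) v|
          ≤ ‖(lossHess ℓ (θs + s • v) η z - lossHess ℓ (θs + s • v) ηs z) v‖ * ‖v‖ :=
            abs_real_inner_le_norm _ _
        _ ≤ ‖lossHess ℓ (θs + s • v) η z - lossHess ℓ (θs + s • v) ηs z‖ * ‖v‖ * ‖v‖ := by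
            gcongr; exact ContinuousLinearMap.le_opNorm _ _
        _ ≤ L * ‖η - ηs‖ * ‖v‖ * ‖v‖ := by
            gcongr; exact hLip _ (add_smul_mem_closedBall hv hs)
        _ = _ := by ring)
  have hL0 : 0 ≤ L * ‖η - ηs‖ * ‖v‖ ^ 2 := by positivity
  have h2 : |remainder (fun x => ℓ x η z) θs (score ℓ θs η z) v -
      remainder (fun x => ℓ x ηs z) θs (score ℓ θs ηs z) v| ≤ L * ‖η - ηs‖ * ‖v‖ ^ 2 := by
    simp only [one_smul, zero_smul, add_zero] at h1
    simp only [remainder]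
    rw [abs_le]
    constructor <;> linarith [h1.1, h1.2]
  rw [Real.enorm_eq_ofReal_abs]
  refine (ENNReal.ofReal_le_ofReal h2).trans (le_of_eq ?_)
  rw [ENNReal.ofReal_mul (by positivity), ENNReal.ofReal_mul (by positivity), hL,
    ENNReal.ofReal_toReal hfin, ofReal_norm]

end LossRegularity

theorem line_mem_segment {H : Type*} [AddCommGroup H] [Module ℝ H] {ηs η : H} {c s : ℝ}
    (hc : c ∈ Set.Icc (0 : ℝ) 1)
    (hs : s ∈ Set.Icc (0 : ℝ) 1) : ηs + s • c • (η - ηs) ∈ segment ℝ ηs η := by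
  rw [segment_eq_image']
  exact ⟨s * c, ⟨mul_nonneg hs.1 hc.1, mul_le_one₀ hs.2 hc.1 hc.2⟩, by simp only [smul_smul]⟩

namespace LossRegularity

variable {d : ℕ} {H Z : Type*} [NormedAddCommGroup H] [NormedSpace ℝ H] [MeasurableSpace H]
  [MeasurableSpace Z] {M ρ κ σ₁ σ₂ σ₃ σ₅ r₁ r₂ : ℝ} {P : Measure Z}
  {ℓ : Param d → H → Z → ℝ} {θs : Param d} {ηs : H} {T : Set H}
  (h : LossRegularity M ρ κ σ₁ σ₂ σ₃ σ₅ r₁ r₂ P ℓ θs ηs T)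
include h

theorem hasDerivAt_score_line {η : H} (hη : η ∈ T) {c : ℝ} (hc : c ∈ Set.Icc (0 : ℝ) 1) (z : Z)
    {s : ℝ} (hs : s ∈ Set.Icc (0 : ℝ) 1) :
    HasDerivAt (fun s : ℝ => score ℓ θs (ηs + s • c • (η - ηs)) z)
      (c • scoreD ℓ θs (ηs + s • c • (η - ηs)) z (η - ηs)) s := by
  exact hasDerivAt_of_lineDifferentiableAt (h.gdiff₁ η hη _ (line_mem_segment hc hs) z)

theorem hasDerivAt_scoreD_line {η : H} (hη : η ∈ T) {c : ℝ} (hc : c ∈ Set.Icc (0 : ℝ) 1) (z : Z)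
    {s : ℝ} (hs : s ∈ Set.Icc (0 : ℝ) 1) :
    HasDerivAt (fun s : ℝ => c • scoreD ℓ θs (ηs + s • c • (η - ηs)) z (η - ηs))
      (c • c • scoreD2 ℓ θs (ηs + s • c • (η - ηs)) z (η - ηs)) s := by
  exact (hasDerivAt_of_lineDifferentiableAt
    (h.gdiff₂ η hη _ (line_mem_segment hc hs) z)).const_smul c

variable [BorelSpace H]

theorem measurable_score_line (hM : 0 ≤ M) {η : H} (hη : ‖η - ηs‖ ≤ M) {c : ℝ}
    (hc : c ∈ Set.Icc (0 : ℝ) 1) :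
    Measurable fun x : ℝ × Z => (Set.Ico (0 : ℝ) 1).indicator
      (fun s => score ℓ θs (ηs + s • c • (η - ηs)) x.2) x.1 := by
  have h1 := h.measurable_score_indicator (Metric.mem_closedBall_self hM)
  have h2 : Measurable fun x : ℝ × Z => (ηs + x.1 • c • (η - ηs), x.2) := by
    have : Continuous fun s : ℝ => ηs + s • c • (η - ηs) := by fun_prop
    exact (this.measurable.comp measurable_fst).prodMk measurable_snd
  have h3 := measurable_indicator_Ico (g := fun s z =>
    (Metric.closedBall ηs M ×ˢ (Set.univ : Set Z)).indicator
      (fun x : H × Z => score ℓ θs x.1 x.2) (ηs + s • c • (η - ηs), z)) (h1.comp h2)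
  convert h3 using 1
  funext x
  by_cases hx : x.1 ∈ Set.Ico (0 : ℝ) 1
  · rw [Set.indicator_of_mem hx, Set.indicator_of_mem hx, Set.indicator_of_mem]
    refine ⟨add_smul_mem_closedBall ?_ (Set.Ico_subset_Icc_self hx), Set.mem_univ _⟩
    rw [norm_smul, Real.norm_of_nonneg hc.1]
    exact (mul_le_of_le_one_left (norm_nonneg _) hc.2).trans hη
  · rw [Set.indicator_of_notMem hx, Set.indicator_of_notMem hx]

variable [IsProbabilityMeasure P]

theorem lintegral_score_sub_sq_le (hM : 0 ≤ M) {η : H} (hη : η ∈ T) (hηM : ‖η - ηs‖ ≤ M) :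
    ∫⁻ z, ‖score ℓ θs η z - score ℓ θs ηs z‖ₑ ^ (2 : ℝ) ∂P ≤
      ENNReal.ofReal (σ₅ * ‖η - ηs‖ ^ 2) := by
  have h1 : (1 : ℝ) ∈ Set.Icc (0 : ℝ) 1 := by simp
  have hmain := lintegral_enorm_sub_rpow_le (P := P) (h.measurable_score_line hM hηM h1)
    (fun z s hs => h.hasDerivAt_score_line hη h1 z hs) one_le_two ENNReal.ofReal_ne_top
    (B := ENNReal.ofReal (σ₅ * ‖η - ηs‖ ^ 2)) fun s hs => by
      simp only [one_smul]
      have := line_mem_segment (ηs := ηs) (η := η) h1 (Set.Ico_subset_Icc_self hs)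
      rw [one_smul] at this
      exact h.gmoment₁ η hη _ this
  simpa using hmain

theorem lintegral_score_taylor_le (hM : 0 ≤ M) {η : H} (hη : η ∈ T) (hηM : ‖η - ηs‖ ≤ M)
    {c : ℝ} (hc : c ∈ Set.Icc (0 : ℝ) 1) :
    ∫⁻ z, ‖score ℓ θs (ηs + c • (η - ηs)) z - score ℓ θs ηs z -
      c • scoreD ℓ θs ηs z (η - ηs)‖ₑ ∂P ≤
      ENNReal.ofReal (c ^ 2 * (σ₅ * ‖η - ηs‖ ^ 2)) := by
  have hmain := lintegral_enorm_taylor_rpow_le (P := P) (h.measurable_score_line hM hηM hc)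
    (fun z s hs => h.hasDerivAt_score_line hη hc z hs)
    (fun z s hs => h.hasDerivAt_scoreD_line hη hc z hs) le_rfl ENNReal.ofReal_ne_top
    (B := ENNReal.ofReal (c ^ 2 * (σ₅ * ‖η - ηs‖ ^ 2))) fun s hs => by
      simp only [ENNReal.rpow_one, smul_smul]
      simp_rw [enorm_smul]
      rw [lintegral_const_mul' _ _ enorm_ne_top, ENNReal.ofReal_mul (by positivity),
        Real.enorm_of_nonneg (mul_self_nonneg c), ← sq]
      gcongr
      have := line_mem_segment (ηs := ηs) (η := η) hc (Set.Ico_subset_Icc_self hs)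
      rw [smul_smul] at this
      exact h.gmoment₂ η hη _ this
  simpa using hmain

theorem integrable_scoreD (hM : 0 ≤ M) {η : H} (hη : η ∈ T) (hηM : ‖η - ηs‖ ≤ M) :
    Integrable (fun z => scoreD ℓ θs ηs z (η - ηs)) P := by
  have h1 : (1 : ℝ) ∈ Set.Icc (0 : ℝ) 1 := by simp
  have hm := measurable_section_indicator (s := 0) (measurable_indicator_deriv
    (h.measurable_score_line hM hηM h1)
    (fun z s hs => h.hasDerivAt_score_line hη h1 z (Set.Ico_subset_Icc_self hs))) (by simp)
  simp only [one_smul, zero_smul, add_zero] at hm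
  have h2 : MemLp (fun z => scoreD ℓ θs ηs z (η - ηs)) 2 P := by
    refine ⟨hm.aestronglyMeasurable, ?_⟩
    rw [eLpNorm_lt_top_iff_lintegral_rpow_enorm_lt_top two_ne_zero ENNReal.ofNat_ne_top]
    exact (h.gmoment₁ η hη ηs (left_mem_segment ℝ ηs η)).trans_lt ENNReal.ofReal_lt_top
  exact h2.integrable one_le_two

/-- Orthogonality removes the first-order term in the nuisance, leaving a bias quadratic in `‖η -
ηs‖`. -/
theorem norm_integral_score_sub_le (hM : 0 ≤ M) (hσ₅ : 0 ≤ σ₅) {η : H} (hη : η ∈ T)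
    (hηM : ‖η - ηs‖ ≤ M) :
    ‖∫ z, (score ℓ θs η z - score ℓ θs ηs z) ∂P‖ ≤ σ₅ * ‖η - ηs‖ ^ 2 := by
  set B := σ₅ * ‖η - ηs‖ ^ 2 with hB
  have hB0 : 0 ≤ B := by positivity
  have hself : θs ∈ Metric.closedBall θs M := Metric.mem_closedBall_self hM
  have hball : ∀ c ∈ Set.Icc (0 : ℝ) 1, ηs + c • (η - ηs) ∈ Metric.closedBall ηs M :=
    fun c hc => add_smul_mem_closedBall hηM hc
  set m : ℝ → Param d := fun c => ∫ z, score ℓ θs (ηs + c • (η - ηs)) z ∂P with hm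
  set D := ∫ z, scoreD ℓ θs ηs z (η - ηs) ∂P with hD
  have hint : ∀ c ∈ Set.Icc (0 : ℝ) 1, Integrable (score ℓ θs (ηs + c • (η - ηs))) P :=
    fun c hc => (h.integrable_score_and_hasGradientAt_risk hself (hball c hc)).1
  have hint0 : Integrable (score ℓ θs ηs) P := by simpa using hint 0 (by simp)
  have hDi := h.integrable_scoreD hM hη hηM
  have hm0 : m 0 = ∫ z, score ℓ θs ηs z ∂P := by simp [hm]
  have hT : ∀ c ∈ Set.Icc (0 : ℝ) 1, ‖m c - m 0 - c • D‖ ≤ c ^ 2 * B := by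
    intro c hc
    have h1 : Integrable (fun z => score ℓ θs (ηs + c • (η - ηs)) z - score ℓ θs ηs z) P :=
      (hint c hc).sub hint0
    have e : m c - m 0 - c • D = ∫ z, (score ℓ θs (ηs + c • (η - ηs)) z - score ℓ θs ηs z -
        c • scoreD ℓ θs ηs z (η - ηs)) ∂P := by
      have h2 : Integrable (fun z => c • scoreD ℓ θs ηs z (η - ηs)) P := hDi.smul c
      rw [integral_sub h1 h2, integral_sub (hint c hc) hint0, integral_smul, hm0]
    rw [e]
    have h2 := (enorm_integral_le_lintegral_enorm _).trans
      (h.lintegral_score_taylor_le hM hη hηM hc)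
    rw [← ofReal_norm] at h2
    exact (ENNReal.ofReal_le_ofReal_iff (by positivity)).1 h2
  -- The mean `D` of the Gateaux derivative is identified with the Gateaux derivative of the mean
  -- without differentiating under the integral. The expansion `hT` at step `c` has error `c² * B`,
  -- so dividing by `c` and letting `c` decrease to 0 gives `‖D‖ ≤ 0`.
  have hD0 : D = 0 := by
    have hgrad : ∀ c ∈ Set.Icc (0 : ℝ) 1,
        gradient (fun x => risk P ℓ x (ηs + c • (η - ηs))) θs = m c := fun c hc =>
      (h.integrable_score_and_hasGradientAt_risk hself (hball c hc)).2.gradient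
    have h1 : HasDerivAt (fun c : ℝ => gradient (fun x => risk P ℓ x (ηs + c • (η - ηs))) θs)
      0 0 := h.orthogonal η hη
    have h2 := h1.hasDerivWithinAt (s := Set.Ioi 0)
    rw [hasDerivWithinAt_iff_tendsto_slope' (by simp)] at h2
    have h3 : Tendsto (fun c : ℝ => ‖slope (fun c : ℝ =>
        gradient (fun x => risk P ℓ x (ηs + c • (η - ηs))) θs) 0 c‖ + c * B) (𝓝[>] 0) (𝓝 0) := by
      have h4 : Tendsto (fun c : ℝ => c * B) (𝓝[>] 0) (𝓝 0) := by
        have : Continuous fun c : ℝ => c * B := by fun_prop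
        have h5 := this.tendsto 0
        rw [zero_mul] at h5
        exact h5.mono_left nhdsWithin_le_nhds
      simpa using h2.norm.add h4
    have h4 : ‖D‖ ≤ 0 := by
      refine ge_of_tendsto h3 ?_
      filter_upwards [Ioo_mem_nhdsGT (zero_lt_one : (0 : ℝ) < 1)] with c hc
      have hcI : c ∈ Set.Icc (0 : ℝ) 1 := Set.Ioo_subset_Icc_self hc
      rw [slope_def_module, hgrad c hcI, hgrad 0 (by simp), sub_zero]
      have e1 : D = c⁻¹ • (m c - m 0) - c⁻¹ • (m c - m 0 - c • D) := by
        rw [smul_sub c⁻¹ (m c - m 0), smul_smul, inv_mul_cancel₀ hc.1.ne', one_smul]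
        abel
      calc ‖D‖ = ‖c⁻¹ • (m c - m 0) - c⁻¹ • (m c - m 0 - c • D)‖ := by rw [← e1]
        _ ≤ ‖c⁻¹ • (m c - m 0)‖ + ‖c⁻¹ • (m c - m 0 - c • D)‖ := norm_sub_le _ _
        _ ≤ ‖c⁻¹ • (m c - m 0)‖ + c * B := by
            gcongr
            rw [norm_smul, norm_inv, Real.norm_of_nonneg hc.1.le, inv_mul_le_iff₀ hc.1]
            exact (hT c hcI).trans_eq (by ring)
    exact norm_le_zero_iff.1 h4
  have h1 := hT 1 (by simp)
  rw [hD0, smul_zero, sub_zero, one_pow, one_mul] at h1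
  have h2 : m 1 - m 0 = ∫ z, (score ℓ θs η z - score ℓ θs ηs z) ∂P := by
    rw [integral_sub (by simpa using hint 1 (by simp)) hint0, hm0]
    simp [hm]
  rwa [h2] at h1

end LossRegularity

/-! ### Tail bounds under the sampling scheme -/

section Markov

variable {Ω : Type*} [MeasurableSpace Ω] {μ : Measure Ω}

theorem enorm_rpow_eq_ofReal {E : Type*} [NormedAddCommGroup E] (x : E) {r : ℝ} (hr : 0 ≤ r) :
    ‖x‖ₑ ^ r = ENNReal.ofReal (‖x‖ ^ r) := by
  rw [← ofReal_norm, ENNReal.ofReal_rpow_of_nonneg (norm_nonneg _) hr]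

theorem measure_ofReal_lt_le {f : Ω → ℝ≥0∞} (hf : AEMeasurable f μ) {x B : ℝ} (hx : 0 < x)
    (hB : ∫⁻ ω, f ω ∂μ ≤ ENNReal.ofReal B) :
    μ {ω | ENNReal.ofReal x < f ω} ≤ ENNReal.ofReal (B / x) := by
  have h1 : μ {ω | ENNReal.ofReal x < f ω} ≤ μ {ω | ENNReal.ofReal x ≤ f ω} :=
    measure_mono fun ω h => le_of_lt (show ENNReal.ofReal x < f ω from h)
  refine h1.trans ((meas_ge_le_lintegral_div hf (by simpa using hx) ENNReal.ofReal_ne_top).trans ?_)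
  rw [ENNReal.ofReal_div_of_pos hx]
  gcongr

theorem measure_lt_norm_le {E : Type*} [NormedAddCommGroup E] {X : Ω → E}
    (hX : AEMeasurable (fun ω => ‖X ω‖ₑ) μ) {r x B : ℝ} (hr : 0 < r) (hx : 0 < x)
    (hB : ∫⁻ ω, ‖X ω‖ₑ ^ r ∂μ ≤ ENNReal.ofReal B) :
    μ {ω | x < ‖X ω‖} ≤ ENNReal.ofReal (B / x ^ r) := by
  refine le_trans (measure_mono fun ω h => ?_)
    (measure_ofReal_lt_le (hX.pow_const r) (by positivity : 0 < x ^ r) hB)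
  simp only [Set.mem_ofPred_eq] at h ⊢
  rw [enorm_rpow_eq_ofReal _ hr.le, ENNReal.ofReal_lt_ofReal_iff (Real.rpow_pos_of_pos
    (hx.trans h) _)]
  exact Real.rpow_lt_rpow hx.le h hr

theorem measure_exists_le {ι : Type*} [Fintype ι] {A : ι → Ω → Prop} {B : ℝ}
    (h : ∀ i, μ {ω | A i ω} ≤ ENNReal.ofReal B) :
    μ {ω | ∃ i, A i ω} ≤ ENNReal.ofReal (Fintype.card ι * B) := by
  rw [show {ω | ∃ i, A i ω} = ⋃ i, {ω | A i ω} by ext; simp]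
  calc μ (⋃ i, {ω | A i ω}) ≤ ∑ i, μ {ω | A i ω} := measure_iUnion_fintype_le μ _
    _ ≤ ∑ _i : ι, ENNReal.ofReal B := Finset.sum_le_sum fun i _ => h i
    _ = _ := by
      rw [Finset.sum_const, Finset.card_univ, nsmul_eq_mul, ENNReal.ofReal_mul (by positivity),
        ENNReal.ofReal_natCast]

theorem lintegral_enorm_rpow_eq {E : Type*} [NormedAddCommGroup E] {X : Ω → E} {r : ℝ}
    (hr : 0 < r) (hX : MemLp X (ENNReal.ofReal r) μ) :
    ∫⁻ ω, ‖X ω‖ₑ ^ r ∂μ = ENNReal.ofReal (∫ ω, ‖X ω‖ ^ r ∂μ) := by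
  have h1 := hX.integrable_norm_rpow (by simpa using hr) ENNReal.ofReal_ne_top
  rw [ENNReal.toReal_ofReal hr.le] at h1
  rw [ofReal_integral_eq_lintegral_ofReal h1 (ae_of_all _ fun ω => by positivity)]
  exact lintegral_congr fun ω => enorm_rpow_eq_ofReal _ hr.le

theorem memLp_of_lintegral_rpow_le {E : Type*} [NormedAddCommGroup E] {X : Ω → E} {r : ℝ}
    (hr : 0 < r) (hX : AEStronglyMeasurable X μ) {B : ℝ≥0∞} (hB : B ≠ ∞)
    (h : ∫⁻ ω, ‖X ω‖ₑ ^ r ∂μ ≤ B) : MemLp X (ENNReal.ofReal r) μ := by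
  refine ⟨hX, ?_⟩
  rw [eLpNorm_lt_top_iff_lintegral_rpow_enorm_lt_top (by simpa using hr) ENNReal.ofReal_ne_top,
    ENNReal.toReal_ofReal hr.le]
  exact h.trans_lt hB.lt_top

theorem lintegral_comp_of_indepFun [IsProbabilityMeasure μ] {𝓧 𝓨 : Type*} [MeasurableSpace 𝓧]
    [MeasurableSpace 𝓨] {X : Ω → 𝓧} {Y : Ω → 𝓨} (hX : Measurable X) (hY : Measurable Y)
    (hi : IndepFun X Y μ) {G : 𝓧 × 𝓨 → ℝ≥0∞} (hG : Measurable G) :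
    ∫⁻ ω, G (X ω, Y ω) ∂μ = ∫⁻ ω', ∫⁻ ω, G (X ω', Y ω) ∂μ ∂μ := by
  have : IsProbabilityMeasure (μ.map Y) := Measure.isProbabilityMeasure_map hY.aemeasurable
  have h1 := (indepFun_iff_map_prod_eq_prod_map_map hX.aemeasurable hY.aemeasurable).1 hi
  rw [← lintegral_map hG (hX.prodMk hY), h1, lintegral_prod _ hG.aemeasurable,
    lintegral_map hG.lintegral_prod_right' hX]
  exact lintegral_congr fun ω' => lintegral_map (hG.comp measurable_prodMk_left) hY

end Markov

namespace SplitSample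

variable {d m : ℕ} {Ω : Type*} [MeasurableSpace Ω] {μ : Measure Ω}
  {H Z : Fin m → Type*} [∀ j, MeasurableSpace (H j)] [∀ j, MeasurableSpace (Z j)]
  {P : ∀ j, Measure (Z j)} {n : Fin m → ℕ}
  {D : ∀ j, Fin (n j) → Ω → Z j} {ηhat : ∀ j, Ω → H j} (hS : SplitSample μ P D ηhat)
include hS

theorem measurePreserving (j : Fin m) (i : Fin (n j)) : MeasurePreserving (D j i) μ (P j) :=
  ⟨hS.data_meas j i, hS.law j i⟩

theorem lintegral_comp (j : Fin m) (i : Fin (n j)) {f : Z j → ℝ≥0∞} (hf : AEMeasurable f (P j)) :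
    ∫⁻ ω, f (D j i ω) ∂μ = ∫⁻ z, f z ∂(P j) := by
  have h := hS.law j i
  rw [← h] at hf ⊢
  exact (lintegral_map' hf (hS.data_meas j i).aemeasurable).symm

theorem integral_comp {F : Type*} [NormedAddCommGroup F] [NormedSpace ℝ F] (j : Fin m)
    (i : Fin (n j)) {f : Z j → F} (hf : AEStronglyMeasurable f (P j)) :
    ∫ ω, f (D j i ω) ∂μ = ∫ z, f z ∂(P j) := by
  have h := hS.law j i
  rw [← h] at hf ⊢
  exact (integral_map (hS.data_meas j i).aemeasurable hf).symm

theorem iIndepFun_comp {F : Type*} [MeasurableSpace F] {φ : ∀ j, Z j → F}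
    (hφ : ∀ j, Measurable (φ j)) :
    iIndepFun (fun (p : Σ j, Fin (n j)) ω => φ p.1 (D p.1 p.2 ω)) μ :=
  hS.indep.comp (fun p => φ p.1) fun p => hφ p.1

/-- Sample splitting: with the nuisances frozen, the summands are independent and centred, so the
variances add. Integrating over the independent nuisances then gives the bound. The conditions on
`Γ` are required at every `η` so that freezing is always possible. -/
theorem lintegral_sum_sq_le [IsProbabilityMeasure μ] {F : Type*} [NormedAddCommGroup F]
    [InnerProductSpace ℝ F] [CompleteSpace F] [MeasurableSpace F] [BorelSpace F]
    [SecondCountableTopology F] {Γ : ∀ j, H j → Z j → F}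
    (hΓ : ∀ j, Measurable fun x : H j × Z j => Γ j x.1 x.2) {v : ∀ j, H j → ℝ≥0∞}
    (hv : ∀ j, Measurable (v j)) (hvt : ∀ j η, v j η ≠ ∞)
    (h0 : ∀ j η, ∫ z, Γ j η z ∂(P j) = 0)
    (h2 : ∀ j η, ∫⁻ z, ‖Γ j η z‖ₑ ^ (2 : ℝ) ∂(P j) ≤ v j η) (A : Finset (Fin m)) :
    ∫⁻ ω, ‖∑ j ∈ A, ∑ i, Γ j (ηhat j ω) (D j i ω)‖ₑ ^ (2 : ℝ) ∂μ ≤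
      ∑ j ∈ A, (n j : ℝ≥0∞) * ∫⁻ ω, v j (ηhat j ω) ∂μ := by
  classical
  have hΓ' : ∀ j η, Measurable (Γ j η) := fun j η => (hΓ j).comp measurable_prodMk_left
  have hsum : ∀ η : ∀ j, H j,
      ∫⁻ ω, ‖∑ j ∈ A, ∑ i, Γ j (η j) (D j i ω)‖ₑ ^ (2 : ℝ) ∂μ ≤
        ∑ j ∈ A, (n j : ℝ≥0∞) * v j (η j) := by
    intro η
    set X : (Σ j, Fin (n j)) → Ω → F := fun p ω => Γ p.1 (η p.1) (D p.1 p.2 ω) with hX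
    have hXm : ∀ p, Measurable (X p) := fun p => (hΓ' _ _).comp (hS.data_meas _ _)
    have hXl : ∀ p, ∫⁻ ω, ‖X p ω‖ₑ ^ (2 : ℝ) ∂μ ≤ v p.1 (η p.1) := fun p =>
      (hS.lintegral_comp p.1 p.2 ((hΓ' _ _).enorm.pow_const _).aemeasurable).trans_le (h2 _ _)
    have hX2' : ∀ p, MemLp (X p) (ENNReal.ofReal 2) μ := fun p =>
      memLp_of_lintegral_rpow_le two_pos (hXm p).aestronglyMeasurable (hvt _ _) (hXl p)
    have hX2 : ∀ p, MemLp (X p) 2 μ := fun p => by simpa using hX2' p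
    have hX0 : ∀ p, ∫ ω, X p ω ∂μ = 0 := fun p =>
      (hS.integral_comp p.1 p.2 (hΓ' _ _).aestronglyMeasurable).trans (h0 _ _)
    have hE : ∀ Y : Ω → F, MemLp Y 2 μ →
        ∫⁻ ω, ‖Y ω‖ₑ ^ (2 : ℝ) ∂μ = ENNReal.ofReal (∫ ω, ‖Y ω‖ ^ 2 ∂μ) := fun Y hY => by
      have := lintegral_enorm_rpow_eq (r := 2) two_pos (by simpa using hY)
      simpa using this
    have hmain := integral_norm_sq_sum_le hXm (hS.iIndepFun_comp (φ := fun j => Γ j (η j))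
      fun j => hΓ' j _) hX2 hX0 (A.sigma fun j => (Finset.univ : Finset (Fin (n j))))
    have e1 : ∀ ω, ∑ j ∈ A, ∑ i, Γ j (η j) (D j i ω) =
        ∑ p ∈ A.sigma fun j => (Finset.univ : Finset (Fin (n j))), X p ω := fun ω => by
      rw [Finset.sum_sigma]
    simp_rw [e1]
    rw [hE _ (memLp_finsetSum _ fun p _ => hX2 p), hmain,
      ENNReal.ofReal_sum_of_nonneg fun p _ => integral_nonneg fun ω => by positivity]
    calc ∑ p ∈ A.sigma fun j => (Finset.univ : Finset (Fin (n j))),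
          ENNReal.ofReal (∫ ω, ‖X p ω‖ ^ 2 ∂μ)
        ≤ ∑ p ∈ A.sigma fun j => (Finset.univ : Finset (Fin (n j))), v p.1 (η p.1) :=
          Finset.sum_le_sum fun p _ => by rw [← hE _ (hX2 p)]; exact hXl p
      _ = ∑ j ∈ A, (n j : ℝ≥0∞) * v j (η j) := by rw [Finset.sum_sigma]; simp
  have hG : Measurable fun x : (∀ j, H j) × (∀ p : Σ j, Fin (n j), Z p.1) =>
      ‖∑ j ∈ A, ∑ i, Γ j (x.1 j) (x.2 ⟨j, i⟩)‖ₑ ^ (2 : ℝ) := by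
    refine (Measurable.enorm ?_).pow_const _
    refine Finset.measurable_fun_sum _ fun j _ => Finset.measurable_fun_sum _ fun i _ => ?_
    exact (hΓ j).comp (((measurable_pi_apply j).comp measurable_fst).prodMk
      ((measurable_pi_apply (⟨j, i⟩ : Σ j, Fin (n j))).comp measurable_snd))
  have hsplit := lintegral_comp_of_indepFun (measurable_pi_lambda _ hS.nuis_meas)
    (measurable_pi_lambda _ fun p : Σ j, Fin (n j) => hS.data_meas p.1 p.2) hS.split hG
  simp only at hsplit
  rw [hsplit]
  calc ∫⁻ ω', ∫⁻ ω, ‖∑ j ∈ A, ∑ i, Γ j (ηhat j ω') (D j i ω)‖ₑ ^ (2 : ℝ) ∂μ ∂μ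
      ≤ ∫⁻ ω', ∑ j ∈ A, (n j : ℝ≥0∞) * v j (ηhat j ω') ∂μ :=
        lintegral_mono fun ω' => hsum fun j => ηhat j ω'
    _ = _ := by
        have hm : ∀ j ∈ A, Measurable fun ω => (n j : ℝ≥0∞) * v j (ηhat j ω) := fun j _ =>
          ((hv j).comp (hS.nuis_meas j)).const_mul _
        rw [lintegral_finsetSum A hm]
        exact Finset.sum_congr rfl fun j _ =>
          lintegral_const_mul _ ((hv j).comp (hS.nuis_meas j))

theorem measure_lt_norm_sum_le [IsProbabilityMeasure μ] {F : Type*} [NormedAddCommGroup F]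
    [InnerProductSpace ℝ F] [CompleteSpace F] [MeasurableSpace F] [BorelSpace F]
    [SecondCountableTopology F] {Γ : ∀ j, H j → Z j → F}
    (hΓ : ∀ j, Measurable fun x : H j × Z j => Γ j x.1 x.2) {v : ∀ j, H j → ℝ≥0∞}
    (hv : ∀ j, Measurable (v j)) (hvt : ∀ j η, v j η ≠ ∞)
    (h0 : ∀ j η, ∫ z, Γ j η z ∂(P j) = 0)
    (h2 : ∀ j η, ∫⁻ z, ‖Γ j η z‖ₑ ^ (2 : ℝ) ∂(P j) ≤ v j η) (A : Finset (Fin m))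
    {B : ℝ} (hB : ∀ j ∈ A, ∫⁻ ω, v j (ηhat j ω) ∂μ ≤ ENNReal.ofReal B) {x : ℝ} (hx : 0 < x) :
    μ {ω | x < ‖∑ j ∈ A, ∑ i, Γ j (ηhat j ω) (D j i ω)‖} ≤
      ENNReal.ofReal ((∑ j ∈ A, n j : ℕ) * B / x ^ (2 : ℝ)) := by
  have hmeas : ∀ j, Measurable fun ω => ∑ i, Γ j (ηhat j ω) (D j i ω) := fun j =>
    Finset.measurable_fun_sum _ fun i _ =>
      (hΓ j).comp ((hS.nuis_meas j).prodMk (hS.data_meas j i))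
  refine measure_lt_norm_le (Finset.measurable_fun_sum A fun j _ => hmeas j).enorm.aemeasurable
    two_pos hx ?_
  refine (hS.lintegral_sum_sq_le hΓ hv hvt h0 h2 A).trans ?_
  calc _ ≤ ∑ j ∈ A, (n j : ℝ≥0∞) * ENNReal.ofReal B := by
        gcongr with j hj
        exact hB j hj
    _ = _ := by
        rw [← Finset.sum_mul, ENNReal.ofReal_mul (Nat.cast_nonneg _), ENNReal.ofReal_natCast]
        push_cast; rfl

theorem lintegral_mul_lintegral_le {j : Fin m} {L : Z j → ℝ≥0∞} (hL : AEMeasurable L (P j))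
    {u : H j → ℝ≥0∞} (hu : Measurable u) :
    ∫⁻ ω, (∑ i, L (D j i ω)) * u (ηhat j ω) ∂μ =
      (n j : ℝ≥0∞) * (∫⁻ z, L z ∂(P j)) * ∫⁻ ω, u (ηhat j ω) ∂μ := by
  have hLD : ∀ i, AEMeasurable (fun ω => L (D j i ω)) μ := fun i =>
    AEMeasurable.comp_quasiMeasurePreserving hL (hS.measurePreserving j i).quasiMeasurePreserving
  have hum : Measurable fun ω => u (ηhat j ω) := hu.comp (hS.nuis_meas j)
  have hterm : ∀ i, ∫⁻ ω, L (D j i ω) * u (ηhat j ω) ∂μ =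
      (∫⁻ z, L z ∂(P j)) * ∫⁻ ω, u (ηhat j ω) ∂μ := by
    intro i
    -- `L` is only almost everywhere measurable, so independence is applied to a measurable version
    -- of it.
    have hmk : ∫⁻ ω, L (D j i ω) * u (ηhat j ω) ∂μ =
        ∫⁻ ω, hL.mk L (D j i ω) * u (ηhat j ω) ∂μ := by
      refine lintegral_congr_ae ?_
      have := (hS.measurePreserving j i).quasiMeasurePreserving.ae hL.ae_eq_mk
      filter_upwards [this] with ω hω
      rw [hω]
    have hind : IndepFun (fun ω => hL.mk L (D j i ω)) (fun ω => u (ηhat j ω)) μ := by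
      have h1 := hS.split.comp (φ := fun x : ∀ j, H j => u (x j))
        (ψ := fun y : ∀ p : Σ j, Fin (n j), Z p.1 => hL.mk L (y ⟨j, i⟩))
        (hu.comp (measurable_pi_apply j))
        (hL.measurable_mk.comp (measurable_pi_apply (⟨j, i⟩ : Σ j, Fin (n j))))
      exact h1.symm
    have hmul := lintegral_mul_eq_lintegral_mul_lintegral_of_indepFun
      (hL.measurable_mk.comp (hS.data_meas j i)) hum hind
    rw [hmk]
    refine Eq.trans hmul ?_
    congr 1
    exact (hS.lintegral_comp j i hL.measurable_mk.aemeasurable).trans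
      (lintegral_congr_ae hL.ae_eq_mk.symm)
  simp_rw [Finset.sum_mul]
  have hm : ∀ i ∈ (Finset.univ : Finset (Fin (n j))),
      AEMeasurable (fun ω => L (D j i ω) * u (ηhat j ω)) μ := fun i _ =>
    (hLD i).mul hum.aemeasurable
  rw [lintegral_finsetSum' _ hm]
  simp [hterm, mul_assoc]

theorem memLp_comp {F : Type*} [NormedAddCommGroup F] [MeasurableSpace F] [BorelSpace F]
    [SecondCountableTopology F] {r σ : ℝ} (hr : 0 < r) {j : Fin m} (i : Fin (n j)) {φ : Z j → F}
    (hφ : Measurable φ) (hB : ∫⁻ z, ‖φ z‖ₑ ^ r ∂(P j) ≤ ENNReal.ofReal σ) :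
    MemLp (fun ω => φ (D j i ω)) (ENNReal.ofReal r) μ :=
  memLp_of_lintegral_rpow_le hr (hφ.comp (hS.data_meas j i)).aestronglyMeasurable
    ENNReal.ofReal_ne_top
    ((hS.lintegral_comp j i (hφ.enorm.pow_const _).aemeasurable).trans_le hB)

theorem integral_norm_rpow_comp_le {F : Type*} [NormedAddCommGroup F] [MeasurableSpace F]
    [BorelSpace F] [SecondCountableTopology F] {r σ : ℝ} (hr : 0 < r) (hσ : 0 ≤ σ) {j : Fin m}
    (i : Fin (n j)) {φ : Z j → F} (hφ : Measurable φ)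
    (hB : ∫⁻ z, ‖φ z‖ₑ ^ r ∂(P j) ≤ ENNReal.ofReal σ) :
    ∫ ω, ‖φ (D j i ω)‖ ^ r ∂μ ≤ σ := by
  have h1 := (hS.lintegral_comp j i (hφ.enorm.pow_const r).aemeasurable).trans_le hB
  rwa [lintegral_enorm_rpow_eq hr (hS.memLp_comp hr i hφ hB),
    ENNReal.ofReal_le_ofReal_iff hσ] at h1

end SplitSample

theorem sum_sigma_univ {m : ℕ} {n : Fin m → ℕ} {F : Type*} [AddCommMonoid F]
    (A : Finset (Fin m)) (f : ∀ j, Fin (n j) → F) :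
    ∑ p ∈ A.sigma fun j => (Finset.univ : Finset (Fin (n j))), f p.1 p.2 =
      ∑ j ∈ A, ∑ i, f j i := by
  rw [Finset.sum_sigma]

/-- Markov's inequality at order `r`. A union over `K` clusters can then be absorbed by a factor `K
^ (1 / r)` in the threshold. -/
theorem exists_measure_lt_norm_sum_le (d : ℕ) (r σ : ℝ) (hr : 2 ≤ r) (hσ : 0 ≤ σ) :
    ∃ A₁ : ℝ, 0 < A₁ ∧ ∀ {m : ℕ} {Ω : Type*} [MeasurableSpace Ω] {μ : Measure Ω}
      [IsProbabilityMeasure μ] {H Z : Fin m → Type*} [∀ j, MeasurableSpace (H j)]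
      [∀ j, MeasurableSpace (Z j)] {P : ∀ j, Measure (Z j)} {n : Fin m → ℕ}
      {D : ∀ j, Fin (n j) → Ω → Z j} {ηhat : ∀ j, Ω → H j}, SplitSample μ P D ηhat →
      ∀ {φ : ∀ j, Z j → Param d}, (∀ j, Measurable (φ j)) → (∀ j, ∫ z, φ j z ∂(P j) = 0) →
      (∀ j, ∫⁻ z, ‖φ j z‖ₑ ^ r ∂(P j) ≤ ENNReal.ofReal σ) →
      ∀ (A : Finset (Fin m)) (x : ℝ), 0 < x →
      μ {ω | x < ‖∑ j ∈ A, ∑ i, φ j (D j i ω)‖} ≤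
        ENNReal.ofReal (A₁ * ((∑ j ∈ A, n j : ℕ) : ℝ) ^ (r / 2) / x ^ r) := by
  obtain ⟨A₁, hA₁, hmom⟩ := exists_integral_norm_rpow_sum_le (E := Param d) r σ hr hσ
  refine ⟨A₁, hA₁, ?_⟩
  intro m Ω _ μ _ H Z _ _ P n D ηhat hS φ hφ h0 hB A x hx
  have hr0 : 0 < r := by linarith
  have hXm : ∀ p : Σ j, Fin (n j), Measurable fun ω => φ p.1 (D p.1 p.2 ω) :=
    fun p => (hφ _).comp (hS.data_meas _ _)
  have hXr : ∀ p : Σ j, Fin (n j),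
      MemLp (fun ω => φ p.1 (D p.1 p.2 ω)) (ENNReal.ofReal r) μ :=
    fun p => hS.memLp_comp hr0 p.2 (hφ _) (hB _)
  have hX0 : ∀ p : Σ j, Fin (n j), ∫ ω, φ p.1 (D p.1 p.2 ω) ∂μ = 0 := fun p =>
    (hS.integral_comp p.1 p.2 (hφ _).aestronglyMeasurable).trans (h0 _)
  have hXB : ∀ p : Σ j, Fin (n j), ∫ ω, ‖φ p.1 (D p.1 p.2 ω)‖ ^ r ∂μ ≤ σ := fun p =>
    hS.integral_norm_rpow_comp_le hr0 hσ p.2 (hφ _) (hB _)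
  have hmain := hmom hXm (hS.iIndepFun_comp hφ) hXr hX0 hXB
    (A.sigma fun j => (Finset.univ : Finset (Fin (n j))))
  have e2 : (A.sigma fun j => (Finset.univ : Finset (Fin (n j)))).card = ∑ j ∈ A, n j := by
    simp [Finset.card_sigma]
  rw [e2] at hmain
  have hmem := memLp_finsetSum (A.sigma fun j => (Finset.univ : Finset (Fin (n j))))
    fun p _ => hXr p
  have hle := (lintegral_enorm_rpow_eq hr0 hmem).trans_le (ENNReal.ofReal_le_ofReal hmain)
  have h := measure_lt_norm_le hmem.1.enorm hr0 hx hle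
  have e1 : (fun ω => ∑ p ∈ A.sigma fun j => (Finset.univ : Finset (Fin (n j))),
      φ p.1 (D p.1 p.2 ω)) = fun ω => ∑ j ∈ A, ∑ i, φ j (D j i ω) :=
    funext fun ω => sum_sigma_univ A fun j i => φ j (D j i ω)
  have e3 := fun ω => congrFun e1 ω
  simp only [e3] at h
  exact h

/-! ### Nuisance rates -/

theorem IsNuisanceRate.exists_le {s : ℕ → ℝ} (hs : IsNuisanceRate s) :
    ∃ C : ℝ, 0 < C ∧ ∀ n : ℕ, 1 ≤ n → s n ≤ C * (n : ℝ) ^ (1 / 2 : ℝ) := by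
  obtain ⟨C, hC⟩ := hs.upper.bound
  obtain ⟨N, hN⟩ := eventually_atTop.1 hC
  have hN0 : 0 < s (max N 1) := hs.pos _ (le_max_right _ _)
  refine ⟨|C| + s (max N 1), by positivity, fun n hn => ?_⟩
  have h1 : (1 : ℝ) ≤ (n : ℝ) ^ (1 / 2 : ℝ) :=
    Real.one_le_rpow (by exact_mod_cast hn) (by norm_num)
  rcases le_total n N with h | h
  · have h2 : s n ≤ s (max N 1) := hs.mono (h.trans (le_max_left _ _))
    nlinarith [abs_nonneg C]
  · have h2 := hN n h
    rw [Real.norm_of_nonneg (hs.pos n hn).le, Real.norm_of_nonneg (by linarith)] at h2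
    nlinarith [le_abs_self C]

/-- Monotonicity and positivity extend the asymptotic bound to the finitely many small `n`, so that
the constants depend on `s` alone. -/
theorem IsNuisanceRate.exists_ge {s : ℕ → ℝ} (hs : IsNuisanceRate s) :
    ∃ c : ℝ, 0 < c ∧ ∀ n : ℕ, 1 ≤ n → c * (n : ℝ) ^ (1 / 4 : ℝ) ≤ s n := by
  obtain ⟨N, hN⟩ := eventually_atTop.1 (hs.lower.bound one_pos)
  have hN0 : (0 : ℝ) < (max N 1 : ℕ) := by exact_mod_cast lt_max_of_lt_right one_pos
  have h10 := hs.pos 1 le_rfl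
  have hP : 0 < ((max N 1 : ℕ) : ℝ) ^ (1 / 4 : ℝ) := by positivity
  refine ⟨min 1 (s 1 / ((max N 1 : ℕ) : ℝ) ^ (1 / 4 : ℝ)), by positivity, fun n hn => ?_⟩
  have h0 : (0 : ℝ) ≤ (n : ℝ) ^ (1 / 4 : ℝ) := by positivity
  rcases le_total n N with h | h
  · calc _ ≤ s 1 / ((max N 1 : ℕ) : ℝ) ^ (1 / 4 : ℝ) * ((max N 1 : ℕ) : ℝ) ^ (1 / 4 : ℝ) := by
          gcongr
          · exact min_le_right _ _
          · exact h.trans (le_max_left _ _)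
      _ = s 1 := by field_simp
      _ ≤ s n := hs.mono hn
  · have h2 := hN n h
    rw [Real.norm_of_nonneg (hs.pos n hn).le, Real.norm_of_nonneg h0, one_mul] at h2
    calc _ ≤ 1 * (n : ℝ) ^ (1 / 4 : ℝ) := by gcongr; exact min_le_left _ _
      _ ≤ s n := by linarith

/-! ### Centred fluctuation of the score caused by the nuisance -/

theorem lintegral_enorm_sub_integral_sq_le {Z F : Type*} [MeasurableSpace Z] {P : Measure Z}
    [IsProbabilityMeasure P] [NormedAddCommGroup F] [InnerProductSpace ℝ F] [CompleteSpace F]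
    {X : Z → F} (h2 : Integrable X P) {B : ℝ≥0∞} (hB : B ≠ ∞)
    (h1 : ∫⁻ z, ‖X z‖ₑ ^ (2 : ℝ) ∂P ≤ B) :
    ∫⁻ z, ‖X z - ∫ z, X z ∂P‖ₑ ^ (2 : ℝ) ∂P ≤ B := by
  have hX2 : MemLp X (ENNReal.ofReal 2) P := memLp_of_lintegral_rpow_le two_pos h2.1 hB h1
  set b := ∫ z, X z ∂P with hb
  have hXb : MemLp (fun z => X z - b) (ENNReal.ofReal 2) P := hX2.sub (memLp_const b)
  refine le_trans ?_ h1
  rw [lintegral_enorm_rpow_eq two_pos hXb, lintegral_enorm_rpow_eq two_pos hX2]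
  refine ENNReal.ofReal_le_ofReal ?_
  have hX2' : MemLp X 2 P := by simpa using hX2
  have i1 : Integrable (fun z => ‖X z‖ ^ 2) P := hX2'.integrable_norm_pow two_ne_zero
  have i2 : Integrable (fun z => 2 * inner ℝ (X z) b) P := (h2.inner_const b).const_mul 2
  have i12 : Integrable (fun z => ‖X z‖ ^ 2 - 2 * inner ℝ (X z) b) P := i1.sub i2
  have e1 : ∀ z, ‖X z - b‖ ^ (2 : ℝ) = ‖X z‖ ^ 2 - 2 * inner ℝ (X z) b + ‖b‖ ^ 2 := fun z => by
    rw [Real.rpow_ofNat, norm_sub_sq_real]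
  simp_rw [e1, Real.rpow_ofNat]
  rw [integral_add i12 (integrable_const _), integral_sub i1 i2, integral_const_mul,
    show ∫ z, inner ℝ (X z) b ∂P = inner ℝ b b by
      simp_rw [real_inner_comm b]; exact integral_inner h2 b, real_inner_self_eq_norm_sq]
  simp
  nlinarith [sq_nonneg ‖b‖]

/-- The centred score difference `∇ℓ(θs, η, z) - ∇ℓ(θs, ηs, z) - E[…]` for `η ∈ T` within distance
`M` of `ηs`, and `0` for other `η`. -/
noncomputable def scoreFluct {d : ℕ} {H Z : Type*} [NormedAddCommGroup H] [MeasurableSpace Z]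
    (P : Measure Z) (ℓ : Param d → H → Z → ℝ) (θs : Param d) (ηs : H) (T : Set H) (M : ℝ)
    (η : H) (z : Z) : Param d :=
  (T ∩ Metric.closedBall ηs M).indicator (fun η => score ℓ θs η z - score ℓ θs ηs z -
    ∫ z, (score ℓ θs η z - score ℓ θs ηs z) ∂P) η

theorem score_eq_add_scoreFluct {d : ℕ} {H Z : Type*} [NormedAddCommGroup H] [MeasurableSpace Z]
    {M : ℝ} {P : Measure Z} {ℓ : Param d → H → Z → ℝ} {θs : Param d} {ηs : H} {T : Set H} {η : H}
    (hη : η ∈ T ∩ Metric.closedBall ηs M) (z : Z) :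
    score ℓ θs η z = score ℓ θs ηs z + scoreFluct P ℓ θs ηs T M η z +
      ∫ z, (score ℓ θs η z - score ℓ θs ηs z) ∂P := by
  simp only [scoreFluct, Set.indicator_of_mem hη]
  abel

namespace LossRegularity

variable {d : ℕ} {H Z : Type*} [NormedAddCommGroup H] [NormedSpace ℝ H] [MeasurableSpace H]
  [MeasurableSpace Z] {M ρ κ σ₁ σ₂ σ₃ σ₅ r₁ r₂ : ℝ} {P : Measure Z}
  {ℓ : Param d → H → Z → ℝ} {θs : Param d} {ηs : H} {T : Set H}
  (h : LossRegularity M ρ κ σ₁ σ₂ σ₃ σ₅ r₁ r₂ P ℓ θs ηs T)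
include h

theorem integrable_score_sub (hM : 0 ≤ M) {η : H} (hη : η ∈ Metric.closedBall ηs M) :
    Integrable (fun z => score ℓ θs η z - score ℓ θs ηs z) P :=
  have hself : θs ∈ Metric.closedBall θs M := Metric.mem_closedBall_self hM
  (h.integrable_score_and_hasGradientAt_risk hself hη).1.sub
    (h.integrable_score_and_hasGradientAt_risk hself (Metric.mem_closedBall_self hM)).1

variable [IsProbabilityMeasure P]

/-- Joint measurability of the score is known only over the ball, where the gradient exists. The
mean is therefore taken of the truncated score, with which the true one agrees on `T ∩ closedBall ηs
M`. -/
theorem measurable_scoreFluct [BorelSpace H] (hM : 0 ≤ M) (hT : MeasurableSet T) :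
    Measurable fun x : H × Z => scoreFluct P ℓ θs ηs T M x.1 x.2 := by
  classical
  have hself : θs ∈ Metric.closedBall θs M := Metric.mem_closedBall_self hM
  have h1 := h.measurable_score_indicator hself
  have h2 := h.measurable_score hself (Metric.mem_closedBall_self hM)
  set S : H × Z → Param d := (Metric.closedBall ηs M ×ˢ (Set.univ : Set Z)).indicator
      (fun x : H × Z => score ℓ θs x.1 x.2) with hS
  have h3 : Measurable fun x : H × Z => S x - score ℓ θs ηs x.2 := h1.sub (h2.comp measurable_snd)
  have h4 : Measurable fun η : H => ∫ z, (S (η, z) - score ℓ θs ηs z) ∂P :=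
    (h3.stronglyMeasurable.integral_prod_right' (ν := P)).measurable
  have h5 := (h3.sub (h4.comp measurable_fst)).indicator (s := (T ∩ Metric.closedBall ηs M) ×ˢ
    (Set.univ : Set Z))
    ((hT.inter Metric.isClosed_closedBall.measurableSet).prod MeasurableSet.univ)
  convert h5 using 1
  funext ⟨η, z⟩
  by_cases hη : η ∈ T ∩ Metric.closedBall ηs M
  · have hS' : ∀ z, S (η, z) = score ℓ θs η z := fun z => by
      exact Set.indicator_of_mem (Set.mk_mem_prod hη.2 (Set.mem_univ z)) _
    simp only [scoreFluct, Set.indicator_of_mem hη]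
    rw [Set.indicator_of_mem (Set.mk_mem_prod hη (Set.mem_univ z))]
    simp [hS']
  · rw [scoreFluct, Set.indicator_of_notMem hη, Set.indicator_of_notMem]
    simpa using hη

theorem integral_scoreFluct (hM : 0 ≤ M) (η : H) :
    ∫ z, scoreFluct P ℓ θs ηs T M η z ∂P = 0 := by
  by_cases hη : η ∈ T ∩ Metric.closedBall ηs M
  · simp only [scoreFluct, Set.indicator_of_mem hη]
    rw [integral_sub (h.integrable_score_sub hM hη.2) (integrable_const _)]
    simp
  · simp [scoreFluct, Set.indicator_of_notMem hη]

theorem lintegral_scoreFluct_sq_le [BorelSpace H] (hM : 0 ≤ M) (η : H) :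
    ∫⁻ z, ‖scoreFluct P ℓ θs ηs T M η z‖ₑ ^ (2 : ℝ) ∂P ≤ ENNReal.ofReal (σ₅ * ‖η - ηs‖ ^ 2) := by
  by_cases hη : η ∈ T ∩ Metric.closedBall ηs M
  · simp only [scoreFluct, Set.indicator_of_mem hη]
    have hηM : ‖η - ηs‖ ≤ M := mem_closedBall_iff_norm.1 hη.2
    have h1 := h.lintegral_score_sub_sq_le hM hη.1 hηM
    have h2 := h.integrable_score_sub hM hη.2
    exact lintegral_enorm_sub_integral_sq_le h2 ENNReal.ofReal_ne_top h1
  · simp [scoreFluct, Set.indicator_of_notMem hη]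

end LossRegularity

/-! ### Probability bounds for the evaluation sample -/

section

variable {d m K : ℕ} {n : Fin m → ℕ} {cl : Fin m → Fin K}
  {Ω : Type*} [MeasurableSpace Ω] {μ : Measure Ω}
  {H Z : Fin m → Type*} [∀ j, NormedAddCommGroup (H j)]
  [∀ j, MeasurableSpace (Z j)] {P : ∀ j, Measure (Z j)}
  {ℓ : ∀ j, Param d → H j → Z j → ℝ} {θs : Fin m → Param d} {ηs : ∀ j, H j} {T : ∀ j, Set (H j)}
  {D : ∀ j, Fin (n j) → Ω → Z j} {ηhat : ∀ j, Ω → H j}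
  {M ρ κ σ₁ σ₂ σ₃ σ₅ r₁ r₂ V : ℝ}

theorem measurable_norm_sub {E : Type*} [NormedAddCommGroup E] [MeasurableSpace E] [BorelSpace E]
    (x : E) : Measurable fun y : E => ‖y - x‖ :=
  (continuous_id.sub continuous_const).norm.measurable

theorem measurable_enorm_sub {E : Type*} [NormedAddCommGroup E] [MeasurableSpace E] [BorelSpace E]
    (x : E) : Measurable fun y : E => ‖y - x‖ₑ := by
  simp_rw [← ofReal_norm]
  exact (measurable_norm_sub x).ennreal_ofReal

theorem ofReal_mul_norm_sq {E : Type*} [NormedAddCommGroup E] {a : ℝ} (ha : 0 ≤ a) (x : E) :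
    ENNReal.ofReal (a * ‖x‖ ^ 2) = ENNReal.ofReal a * ‖x‖ₑ ^ (2 : ℝ) := by
  rw [ENNReal.ofReal_mul ha, enorm_rpow_eq_ofReal x two_pos.le, Real.rpow_ofNat]

theorem lintegral_nuisance_sq_le {a : ℝ} (ha : 0 ≤ a) {j : Fin m}
    (hV : ∫⁻ ω, ‖ηhat j ω - ηs j‖ₑ ^ (2 : ℝ) ∂μ ≤ ENNReal.ofReal V) :
    ∫⁻ ω, ENNReal.ofReal (a * ‖ηhat j ω - ηs j‖ ^ 2) ∂μ ≤ ENNReal.ofReal (a * V) := by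
  simp_rw [ofReal_mul_norm_sq ha]
  rw [lintegral_const_mul' _ _ ENNReal.ofReal_ne_top, ENNReal.ofReal_mul ha]
  gcongr

variable [∀ j, MeasurableSpace (H j)]

theorem measure_nuisance_far_le [∀ j, BorelSpace (H j)] (hm : ∀ j, Measurable (ηhat j)) (hM : 0 < M)
    (hV : ∀ j, ∫⁻ ω, ‖ηhat j ω - ηs j‖ₑ ^ (2 : ℝ) ∂μ ≤ ENNReal.ofReal V) :
    μ {ω | ∃ j, M < ‖ηhat j ω - ηs j‖} ≤ ENNReal.ofReal (m * (V / M ^ (2 : ℝ))) := by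
  have := measure_exists_le fun j => measure_lt_norm_le
    ((measurable_enorm_sub (ηs j)).comp (hm j)).aemeasurable two_pos hM (hV j)
  simpa using this

theorem measure_nuisance_cluster_le [∀ j, BorelSpace (H j)]
    (hm : ∀ j, Measurable (ηhat j)) {v : Fin m → ℝ}
    (hv : ∀ j, 0 ≤ v j)
    (hV : ∀ j, ∫⁻ ω, ‖ηhat j ω - ηs j‖ₑ ^ (2 : ℝ) ∂μ ≤ ENNReal.ofReal (v j))
    (A : Finset (Fin m)) {x : ℝ} (hx : 0 < x) :
    μ {ω | x < ∑ j ∈ A, (n j : ℝ) * ‖ηhat j ω - ηs j‖ ^ 2} ≤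
      ENNReal.ofReal ((∑ j ∈ A, n j * v j) / x) := by
  have hmj : ∀ j, Measurable fun ω => ENNReal.ofReal ((n j : ℝ) * ‖ηhat j ω - ηs j‖ ^ 2) :=
    fun j => ((((measurable_norm_sub (ηs j)).comp (hm j)).pow_const 2).const_mul _).ennreal_ofReal
  have hsum : ∀ ω, ENNReal.ofReal (∑ j ∈ A, (n j : ℝ) * ‖ηhat j ω - ηs j‖ ^ 2) =
      ∑ j ∈ A, ENNReal.ofReal ((n j : ℝ) * ‖ηhat j ω - ηs j‖ ^ 2) := fun ω =>
    ENNReal.ofReal_sum_of_nonneg fun j _ => by positivity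
  have hB : ∫⁻ ω, ENNReal.ofReal (∑ j ∈ A, (n j : ℝ) * ‖ηhat j ω - ηs j‖ ^ 2) ∂μ ≤
      ENNReal.ofReal (∑ j ∈ A, n j * v j) := by
    simp_rw [hsum]
    rw [lintegral_finsetSum A fun j _ => hmj j,
      ENNReal.ofReal_sum_of_nonneg fun j _ => mul_nonneg (Nat.cast_nonneg _) (hv j)]
    exact Finset.sum_le_sum fun j _ =>
      lintegral_nuisance_sq_le (a := (n j : ℝ)) (Nat.cast_nonneg _) (hV j)
  refine le_trans (measure_mono fun ω h => ?_) (measure_ofReal_lt_le (f := fun ω =>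
    ENNReal.ofReal (∑ j ∈ A, (n j : ℝ) * ‖ηhat j ω - ηs j‖ ^ 2)) ?_ hx hB)
  · exact (ENNReal.ofReal_lt_ofReal_iff (hx.trans h)).2 h
  · simp_rw [hsum]
    exact (Finset.measurable_fun_sum _ fun j _ => hmj j).aemeasurable

variable [IsProbabilityMeasure μ] [∀ j, NormedSpace ℝ (H j)] (hS : SplitSample μ P D ηhat)
  (hL : ∀ j, LossRegularity M ρ κ σ₁ σ₂ σ₃ σ₅ r₁ r₂ (P j) (ℓ j) (θs j) (ηs j) (T j))
include hS hL

theorem measure_scoreFluct_le [∀ j, BorelSpace (H j)] [∀ j, IsProbabilityMeasure (P j)]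
    (hM : 0 ≤ M) (hσ₅ : 0 ≤ σ₅)
    (hT : ∀ j, MeasurableSet (T j))
    (hV : ∀ j, ∫⁻ ω, ‖ηhat j ω - ηs j‖ₑ ^ (2 : ℝ) ∂μ ≤ ENNReal.ofReal V)
    (A : Finset (Fin m)) {x : ℝ} (hx : 0 < x) :
    μ {ω | x < ‖∑ j ∈ A, ∑ i, scoreFluct (P j) (ℓ j) (θs j) (ηs j) (T j) M (ηhat j ω)
      (D j i ω)‖} ≤ ENNReal.ofReal ((∑ j ∈ A, n j : ℕ) * (σ₅ * V) / x ^ (2 : ℝ)) := by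
  have hΓ := fun j => (hL j).measurable_scoreFluct hM (hT j)
  have hΓ0 := fun j => (hL j).integral_scoreFluct hM
  have hΓ2 := fun j => (hL j).lintegral_scoreFluct_sq_le hM
  exact hS.measure_lt_norm_sum_le
    (Γ := fun j => scoreFluct (P j) (ℓ j) (θs j) (ηs j) (T j) M) hΓ
    (v := fun j η => ENNReal.ofReal (σ₅ * ‖η - ηs j‖ ^ 2))
    (fun j => (((measurable_norm_sub (ηs j)).pow_const 2).const_mul _).ennreal_ofReal)
    (fun _ _ => ENNReal.ofReal_ne_top) hΓ0 hΓ2 A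
    (fun j _ => lintegral_nuisance_sq_le hσ₅ (hV j)) hx

/-- Chebyshev at one point `v`: numerator and squared threshold both scale as `‖v‖ ^ 4`, so the
failure probability is of order `1 / n j` whatever the radius at which the net is used. -/
theorem measure_remainder_le [∀ j, IsProbabilityMeasure (P j)] (hM : 0 ≤ M) (hρ : 0 < ρ)
    (hσ₂ : 0 ≤ σ₂) (hr₂ : 2 ≤ r₂)
    (hn : ∀ j, 0 < n j) {v : Param d} (hv : ‖v‖ ≤ M) {τ : ℝ} (hτ : 0 < τ) (j : Fin m) :
    μ {ω | n j * (τ * ‖v‖ ^ 2) < ‖∑ i, (remainder (fun x => ℓ j x (ηs j) (D j i ω)) (θs j)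
      (score (ℓ j) (θs j) (ηs j) (D j i ω)) v - ∫ z, remainder (fun x => ℓ j x (ηs j) z) (θs j)
      (score (ℓ j) (θs j) (ηs j) z) v ∂(P j))‖} ≤
      ENNReal.ofReal ((2 * σ₂ + (2 + 2 * κ ^ 2)) / τ ^ 2 * (n j : ℝ)⁻¹) := by
  rcases eq_or_ne v 0 with rfl | hv0
  · simp [remainder_zero]
  have hvp : 0 < ‖v‖ := norm_pos_iff.2 hv0
  have hnj : (0 : ℝ) < n j := by exact_mod_cast hn j
  set X : ∀ j, Z j → ℝ := fun j z => remainder (fun x => ℓ j x (ηs j) z) (θs j)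
      (score (ℓ j) (θs j) (ηs j) z) v with hX
  have hXm : ∀ j, Measurable (X j) := fun j => (hL j).measurable_remainder hM v
  have hXi : ∀ j, Integrable (X j) (P j) := fun j => ((hL j).integral_remainder hM v).1
  have hB : ∀ j, ∫⁻ z, ‖X j z‖ₑ ^ (2 : ℝ) ∂(P j) ≤
      ENNReal.ofReal ((2 * σ₂ + (2 + 2 * κ ^ 2)) * ‖v‖ ^ 4) := fun j =>
    (hL j).lintegral_remainder_sq_le hM hρ hσ₂ hr₂ hv
  have hcent : ∀ j, ∫⁻ z, ‖X j z - ∫ z, X j z ∂(P j)‖ₑ ^ (2 : ℝ) ∂(P j) ≤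
      ENNReal.ofReal ((2 * σ₂ + (2 + 2 * κ ^ 2)) * ‖v‖ ^ 4) := fun j =>
    (lintegral_enorm_sub_integral_sq_le (hXi j) ENNReal.ofReal_ne_top (hB j))
  have htail := hS.measure_lt_norm_sum_le (Γ := fun j _ z => X j z - ∫ z, X j z ∂(P j))
    (fun j => ((hXm j).sub_const _).comp measurable_snd)
    (v := fun _ _ => ENNReal.ofReal ((2 * σ₂ + (2 + 2 * κ ^ 2)) * ‖v‖ ^ 4))
    (fun _ => measurable_const) (fun _ _ => ENNReal.ofReal_ne_top)
    (fun j _ => by rw [integral_sub (hXi j) (integrable_const _)]; simp)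
    (fun j _ => hcent j) {j} (B := (2 * σ₂ + (2 + 2 * κ ^ 2)) * ‖v‖ ^ 4)
    (fun _ _ => by simp) (x := n j * (τ * ‖v‖ ^ 2)) (by positivity)
  simp only [Finset.sum_singleton] at htail
  refine htail.trans (ENNReal.ofReal_le_ofReal (le_of_eq ?_))
  rw [Real.rpow_ofNat]
  field_simp

/-- Only a first moment of the Lipschitz constant is assumed, so Markov's inequality is applied to
its product with the nuisance error, which factorizes by independence. The resulting bound decays
like `V ^ (1/2)`, the slowest of the failure probabilities, which forces `m * t` to be small
compared with `s nMin`. -/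
theorem measure_hessLip_le [∀ j, BorelSpace (H j)] (hσ₃ : 0 ≤ σ₃) (hV0 : 0 ≤ V)
    (hV : ∀ j, ∫⁻ ω, ‖ηhat j ω - ηs j‖ₑ ^ (2 : ℝ) ∂μ ≤ ENNReal.ofReal V)
    (hn : ∀ j, 0 < n j) {τ : ℝ} (hτ : 0 < τ) (j : Fin m) :
    μ {ω | ENNReal.ofReal (n j * τ) < (∑ i, hessLip (ℓ j) (θs j) (ηs j) M (D j i ω)) *
      ‖ηhat j ω - ηs j‖ₑ} ≤ ENNReal.ofReal (σ₃ * V ^ (1 / 2 : ℝ) / τ) := by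
  have hnj : (0 : ℝ) < n j := by exact_mod_cast hn j
  have hnm : Measurable fun ω => ‖ηhat j ω - ηs j‖ₑ :=
    (measurable_enorm_sub (ηs j)).comp (hS.nuis_meas j)
  have h1 : ∫⁻ ω, ‖ηhat j ω - ηs j‖ₑ ∂μ ≤ ENNReal.ofReal (V ^ (1 / 2 : ℝ)) := by
    have h3 := (lintegral_rpow_le_lintegral_rpow (μ := μ) hnm.aemeasurable
      (one_le_two (α := ℝ))).trans (hV j)
    have h4 := ENNReal.rpow_le_rpow h3 (by norm_num : (0 : ℝ) ≤ 1 / 2)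
    rwa [← ENNReal.rpow_mul, ENNReal.ofReal_rpow_of_nonneg hV0 (by norm_num),
      mul_one_div_cancel two_ne_zero, ENNReal.rpow_one] at h4
  have h2 := hS.lintegral_mul_lintegral_le (hL j).hess_lip_meas (measurable_enorm_sub (ηs j))
  have hB : ∫⁻ ω, (∑ i, hessLip (ℓ j) (θs j) (ηs j) M (D j i ω)) * ‖ηhat j ω - ηs j‖ₑ ∂μ ≤
      ENNReal.ofReal (n j * σ₃ * V ^ (1 / 2 : ℝ)) := by
    rw [h2, ENNReal.ofReal_mul (by positivity), ENNReal.ofReal_mul hnj.le, ENNReal.ofReal_natCast]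
    gcongr
    exact (hL j).hess_lip
  refine (measure_ofReal_lt_le ?_ (by positivity : 0 < n j * τ) hB).trans
    (ENNReal.ofReal_le_ofReal (le_of_eq (by field_simp)))
  refine AEMeasurable.mul (Finset.aemeasurable_fun_sum _ fun i _ => ?_) hnm.aemeasurable
  exact AEMeasurable.comp_quasiMeasurePreserving (g := hessLip (ℓ j) (θs j) (ηs j) M)
    (hL j).hess_lip_meas (hS.measurePreserving j i).quasiMeasurePreserving

end

/-! ### Sample sizes -/

section SampleSize

variable {m K : ℕ} {n : Fin m → ℕ} {cl : Fin m → Fin K}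

theorem nMin_le (j : Fin m) : nMin n ≤ n j := ciInf_le (OrderBot.bddBelow _) j

theorem le_nMax (j : Fin m) : n j ≤ nMax n := le_ciSup (Set.finite_range n).bddAbove j

theorem one_le_nMin (hm : 0 < m) (hn : ∀ j, 0 < n j) : 1 ≤ nMin n := by
  have : Nonempty (Fin m) := ⟨⟨0, hm⟩⟩
  exact le_ciInf fun j => hn j

theorem pooledMin_le (k : Fin K) : pooledMin n cl ≤ pooled n cl k :=
  ciInf_le (OrderBot.bddBelow _) k

theorem mem_cluster {k : Fin K} {j : Fin m} : j ∈ cluster cl k ↔ cl j = k := by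
  simp [cluster]

theorem cluster_nonempty (hcl : Function.Surjective cl) (k : Fin K) : (cluster cl k).Nonempty := by
  obtain ⟨j, hj⟩ := hcl k
  exact ⟨j, mem_cluster.2 hj⟩

theorem pooled_pos (hn : ∀ j, 0 < n j) (hcl : Function.Surjective cl) (k : Fin K) :
    0 < pooled n cl k :=
  Finset.sum_pos (fun j _ => hn j) (cluster_nonempty hcl k)

theorem le_pooled {j : Fin m} {k : Fin K} (hj : j ∈ cluster cl k) : n j ≤ pooled n cl k :=
  Finset.single_le_sum (f := n) (fun _ _ => Nat.zero_le _) hj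

theorem card_mul_nMin_le (k : Fin K) : (cluster cl k).card * nMin n ≤ pooled n cl k := by
  rw [pooled, ← smul_eq_mul]
  exact Finset.card_nsmul_le_sum _ _ _ fun j _ => nMin_le j

variable {s : ℕ → ℝ}

theorem le_iSup_cluster {j : Fin m} {k : Fin K} (hj : j ∈ cluster cl k) :
    (n j : ℝ) ^ (1 / 2 : ℝ) * (s (n j)) ^ (-2 : ℝ) ≤
      ⨆ j : {j // j ∈ cluster cl k}, (n j : ℝ) ^ (1 / 2 : ℝ) * (s (n j)) ^ (-2 : ℝ) :=
  le_ciSup (f := fun j : {j // j ∈ cluster cl k} =>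
    (n j : ℝ) ^ (1 / 2 : ℝ) * (s (n j)) ^ (-2 : ℝ)) (Set.finite_range _).bddAbove ⟨j, hj⟩

theorem bTerm_pos (hs : IsNuisanceRate s) (hn : ∀ j, 0 < n j) (hcl : Function.Surjective cl)
    (k : Fin K) : 0 < bTerm s n cl k := by
  obtain ⟨j, hj⟩ := cluster_nonempty hcl k
  have h1 : (0 : ℝ) < (n j : ℝ) ^ (1 / 2 : ℝ) * (s (n j)) ^ (-2 : ℝ) :=
    mul_pos (Real.rpow_pos_of_pos (by exact_mod_cast hn j) _)
      (Real.rpow_pos_of_pos (hs.pos _ (hn j)) _)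
  have h2 : (0 : ℝ) < ((cluster cl k).card : ℝ) := by
    exact_mod_cast (cluster_nonempty hcl k).card_pos
  have h3 : (0 : ℝ) < K := by exact_mod_cast k.pos
  exact mul_pos (mul_pos h3 (Real.rpow_pos_of_pos h2 _)) (h1.trans_le (le_iSup_cluster hj))

theorem sum_rpow_half_le (A : Finset (Fin m)) :
    ∑ j ∈ A, (n j : ℝ) ^ (1 / 2 : ℝ) ≤
      (A.card : ℝ) ^ (1 / 2 : ℝ) * ((∑ j ∈ A, n j : ℕ) : ℝ) ^ (1 / 2 : ℝ) := by
  simp_rw [← Real.sqrt_eq_rpow]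
  rw [← Real.sqrt_mul (Nat.cast_nonneg _)]
  refine Real.le_sqrt_of_sq_le (sq_sum_le_card_mul_sum_sq.trans (le_of_eq ?_))
  congr 1
  push_cast
  exact Finset.sum_congr rfl fun j _ => Real.sq_sqrt (Nat.cast_nonneg _)

/-- Cauchy–Schwarz for `∑ √(n j)`. The factor `K` pays for the union over clusters in the
first-moment Markov bound. -/
theorem sum_div_sq_le_bTerm (hs : IsNuisanceRate s) (hn : ∀ j, 0 < n j) (k : Fin K) :
    K * ∑ j ∈ cluster cl k, (n j : ℝ) / s (n j) ^ 2 ≤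
      bTerm s n cl k * (pooled n cl k : ℝ) ^ (1 / 2 : ℝ) := by
  set B := ⨆ j : {j // j ∈ cluster cl k}, (n j : ℝ) ^ (1 / 2 : ℝ) * (s (n j)) ^ (-2 : ℝ) with hB
  have hB0 : 0 ≤ B := Real.iSup_nonneg fun j =>
    mul_nonneg (by positivity) (Real.rpow_nonneg (hs.pos _ (hn j)).le _)
  have hterm : ∀ j ∈ cluster cl k, (n j : ℝ) / s (n j) ^ 2 ≤ (n j : ℝ) ^ (1 / 2 : ℝ) * B := by
    intro j hj
    have h1 : (n j : ℝ) / s (n j) ^ 2 =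
        (n j : ℝ) ^ (1 / 2 : ℝ) * ((n j : ℝ) ^ (1 / 2 : ℝ) * (s (n j)) ^ (-2 : ℝ)) := by
      rw [← mul_assoc, ← Real.rpow_add (by exact_mod_cast hn j), Real.rpow_neg (hs.pos _ (hn j)).le]
      norm_num [div_eq_mul_inv]
    rw [h1]
    gcongr
    exact le_iSup_cluster hj
  calc K * ∑ j ∈ cluster cl k, (n j : ℝ) / s (n j) ^ 2
      ≤ K * ∑ j ∈ cluster cl k, (n j : ℝ) ^ (1 / 2 : ℝ) * B := by
        gcongr with j hj; exact hterm j hj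
    _ ≤ K * (((cluster cl k).card : ℝ) ^ (1 / 2 : ℝ) *
          (pooled n cl k : ℝ) ^ (1 / 2 : ℝ) * B) := by
        rw [← Finset.sum_mul]; gcongr; exact sum_rpow_half_le _
    _ = _ := by rw [bTerm, ← hB]; ring

end SampleSize

/-- With `u = s nMin` and `N = nMin`, the union over `m` tasks turns the elementary failure
probabilities into `m / u`, `m / u²` and `m / N`. All three are `O(1 / t)` under the single
condition `m * t < c * u`. -/
theorem div_le_of_mul_lt {m t u c C N : ℝ} (hm : 1 ≤ m) (ht : 1 < t) (hc : 0 < c) (hc1 : c ≤ 1)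
    (hC : 0 < C) (hcC : c * C ≤ 1) (hN : 0 < N) (hu : m * t < c * u)
    (huN : u ≤ C * N ^ (1 / 2 : ℝ)) :
    m / u ≤ c / t ∧ m / u ^ 2 ≤ c / t ∧ m / N ≤ c * C / t := by
  have hmt : 0 < m * t := by positivity
  have hu0 : 0 < u := by
    by_contra h
    nlinarith
  have hmt1 : m * t ≤ (m * t) ^ 2 := by
    have : 1 ≤ m * t := one_le_mul_of_one_le_of_one_le hm ht.le
    nlinarith
  have hbound : ∀ X Y : ℝ, 0 < X → 0 < Y → (m * t) ≤ Y * X → m / X ≤ Y / t := by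
    intro X Y hX hY h
    rw [div_le_div_iff₀ hX (by positivity)]
    linarith
  refine ⟨hbound u c hu0 hc hu.le, hbound _ c (by positivity) hc ?_,
    hbound N _ hN (by positivity) ?_⟩
  · nlinarith
  · have h1 : N = (N ^ (1 / 2 : ℝ)) ^ 2 := by
      rw [← Real.rpow_natCast, ← Real.rpow_mul hN.le]; norm_num
    have h2 : m * t ≤ c * C * N ^ (1 / 2 : ℝ) := by nlinarith
    have h3 : (m * t) ^ 2 ≤ (c * C * N ^ (1 / 2 : ℝ)) ^ 2 :=
      pow_le_pow_left₀ hmt.le h2 2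
    rw [mul_pow (c * C), ← h1] at h3
    have h4 : (c * C) ^ 2 ≤ c * C := by nlinarith [mul_pos hc hC]
    nlinarith

/-! ### The good event -/

section Good

variable {d m K : ℕ} {n : Fin m → ℕ}
  {H Z : Fin m → Type*} [∀ j, NormedAddCommGroup (H j)] [∀ j, MeasurableSpace (Z j)]

/-- The deterministic properties of the nuisance estimates `η` and of the evaluation data `z` that
the analysis of the estimator uses: `η` is admissible and close to `ηs`, the scores and their
fluctuations are of the expected order, and the empirical Taylor remainders at the points of a
finite net are close to their means. -/
structure GoodSample (P : ∀ j, Measure (Z j)) (ℓ : ∀ j, Param d → H j → Z j → ℝ)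
    (θs : Fin m → Param d) (ηs : ∀ j, H j) (T : ∀ j, Set (H j)) (cl : Fin m → Fin K) (s : ℕ → ℝ)
    (M r₁ τ a a' t : ℝ) (W : Finset (Param d)) (R : Fin K → ℝ)
    (η : ∀ j, H j) (z : ∀ j, Fin (n j) → Z j) : Prop where
  mem : ∀ j, η j ∈ T j
  near : ∀ j, ‖η j - ηs j‖ ≤ M
  score_cluster : ∀ k, ‖∑ j ∈ cluster cl k, ∑ i, score (ℓ j) (θs j) (ηs j) (z j i)‖ ≤
    a * (K : ℝ) ^ (1 / r₁) * (pooled n cl k : ℝ) ^ (1 / 2 : ℝ) * t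
  fluct_cluster : ∀ k, ‖∑ j ∈ cluster cl k, ∑ i,
    scoreFluct (P j) (ℓ j) (θs j) (ηs j) (T j) M (η j) (z j i)‖ ≤
      (pooled n cl k : ℝ) ^ (1 / 2 : ℝ) * t
  nuisance_cluster : ∀ k, ∑ j ∈ cluster cl k, (n j : ℝ) * ‖η j - ηs j‖ ^ 2 ≤
    a' * bTerm s n cl k * (pooled n cl k : ℝ) ^ (1 / 2 : ℝ) * t
  score_task : ∀ j, ‖∑ i, score (ℓ j) (θs j) (ηs j) (z j i)‖ ≤ n j
  fluct_task : ∀ j, ‖∑ i, scoreFluct (P j) (ℓ j) (θs j) (ηs j) (T j) M (η j) (z j i)‖ ≤ n j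
  net : ∀ j, ∀ w ∈ W, ‖∑ i, (remainder (fun x => ℓ j x (ηs j) (z j i)) (θs j)
    (score (ℓ j) (θs j) (ηs j) (z j i)) (R (cl j) • w) -
      ∫ z, remainder (fun x => ℓ j x (ηs j) z) (θs j) (score (ℓ j) (θs j) (ηs j) z)
        (R (cl j) • w) ∂(P j))‖ ≤ n j * (τ * ‖R (cl j) • w‖ ^ 2)
  hessian : ∀ j, (∑ i, hessLip (ℓ j) (θs j) (ηs j) M (z j i)) * ‖η j - ηs j‖ₑ ≤
    ENNReal.ofReal (n j * τ)

end Good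

-- Apart from `mem`, the conditions of `GoodSample` fail through eight events, each of probability
-- at most `t⁻¹ / 8`. The cluster conditions `score_cluster` and `nuisance_cluster` obtain the
-- factor `t⁻¹` from the threshold itself; the others obtain it from `m * t < c * s nMin`.
set_option maxHeartbeats 1000000 in
theorem exists_measure_not_goodSample_le (d : ℕ) {M ρ κ σ₁ σ₂ σ₃ σ₄ σ₅ r₁ r₂ τ : ℝ} {s : ℕ → ℝ}
    (hM : 0 < M) (hρ : 0 < ρ) (hσ₁ : 0 < σ₁) (hσ₂ : 0 < σ₂) (hσ₃ : 0 < σ₃) (hσ₄ : 0 < σ₄)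
    (hσ₅ : 0 < σ₅) (hr₁ : 2 < r₁) (hr₂ : 2 < r₂) (hτ : 0 < τ) (hs : IsNuisanceRate s)
    (W : Finset (Param d)) :
    ∃ a a' c : ℝ, 0 < a ∧ 0 < a' ∧ 0 < c ∧ ∀ {m K : ℕ} {n : Fin m → ℕ} {cl : Fin m → Fin K}
      {Ω : Type*} [MeasurableSpace Ω] {μ : Measure Ω} [IsProbabilityMeasure μ]
      {H Z : Fin m → Type*} [∀ j, NormedAddCommGroup (H j)] [∀ j, NormedSpace ℝ (H j)]
      [∀ j, MeasurableSpace (H j)] [∀ j, BorelSpace (H j)] [∀ j, MeasurableSpace (Z j)]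
      {P : ∀ j, Measure (Z j)} [∀ j, IsProbabilityMeasure (P j)]
      {ℓ : ∀ j, Param d → H j → Z j → ℝ} {θs : Fin m → Param d} {ηs : ∀ j, H j}
      {T : ∀ j, Set (H j)} {D : ∀ j, Fin (n j) → Ω → Z j} {ηhat : ∀ j, Ω → H j}
      {R : Fin K → ℝ} {t : ℝ},
      0 < m → (∀ j, 0 < n j) → Function.Surjective cl → SplitSample μ P D ηhat →
      (∀ j, MeasurableSet (T j)) →
      (∀ j, LossRegularity M ρ κ σ₁ σ₂ σ₃ σ₅ r₁ r₂ (P j) (ℓ j) (θs j) (ηs j) (T j)) →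
      NuisanceRegularity μ s σ₄ n ηs ηhat → (∀ k, ∀ w ∈ W, ‖R k • w‖ ≤ M) →
      1 < t → m * t < c * s (nMin n) →
      μ {ω | (∀ j, ηhat j ω ∈ T j) ∧ ¬ GoodSample P ℓ θs ηs T cl s M r₁ τ a a' t W R
        (fun j => ηhat j ω) (fun j i => D j i ω)} ≤ ENNReal.ofReal t⁻¹ := by
  obtain ⟨Cs, hCs, hsC⟩ := hs.exists_le
  obtain ⟨A₁, hA₁, htail⟩ := exists_measure_lt_norm_sum_le d r₁ σ₁ hr₁.le hσ₁.le
  set q := 2 * σ₂ + (2 + 2 * κ ^ 2) with hq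
  have hq0 : 0 < q := by positivity
  -- `B` dominates every constant that multiplies `c / t` below, and `c = 1 / (8 * B)` turns each
  -- such product into at most `t⁻¹ / 8`. The summands `1` and `Cs` secure `c ≤ 1` and `c * Cs ≤ 1`.
  set B := 1 + Cs + σ₄ / M ^ (2 : ℝ) + σ₅ * σ₄ + A₁ * Cs + W.card * (q / τ ^ 2) * Cs +
    σ₃ * σ₄ ^ (1 / 2 : ℝ) / τ with hB
  have hB0 : 0 < B := by positivity
  set c := 1 / (8 * B) with hc
  have hc0 : 0 < c := by positivity
  have hcB : B * c = 1 / 8 := by rw [hc]; field_simp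
  have hp1 : 0 ≤ σ₄ / M ^ (2 : ℝ) := by positivity
  have hp2 : 0 ≤ σ₅ * σ₄ := by positivity
  have hp3 : 0 ≤ A₁ * Cs := by positivity
  have hp4 : 0 ≤ W.card * (q / τ ^ 2) * Cs := by positivity
  have hp5 : 0 ≤ σ₃ * σ₄ ^ (1 / 2 : ℝ) / τ := by positivity
  have hc1 : c ≤ 1 := by nlinarith
  have hcC : c * Cs ≤ 1 := by nlinarith
  -- As `a ≥ 1`, `a ^ r₁ ≥ a ≥ 8 * A₁`, which gives probability at most `t⁻¹ / (8 * K)` per cluster.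
  set a := max 1 (8 * A₁) with ha
  have ha1 : 1 ≤ a := le_max_left _ _
  refine ⟨a, 8 * σ₄, c, by positivity, by positivity, hc0, ?_⟩
  intro m K n cl Ω _ μ _ H Z _ _ _ _ _ P _ ℓ θs ηs T D ηhat R t hm hn hcl hS hT hL hN hR ht hmt
  set u := s (nMin n) with hu
  have hN1 := one_le_nMin hm hn
  have hN0 : (0 : ℝ) < nMin n := by exact_mod_cast hN1
  have hu0 : 0 < u := hs.pos _ hN1
  have hm1 : (1 : ℝ) ≤ m := by exact_mod_cast hm
  have hK : (K : ℝ) ≤ m := by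
    have := Fintype.card_le_of_surjective cl hcl
    simp only [Fintype.card_fin] at this
    exact_mod_cast this
  have hK0 : (0 : ℝ) < K := by exact_mod_cast (cl ⟨0, hm⟩).pos
  have ht0 : 0 < t := by linarith
  obtain ⟨hd1, hd2, hd3⟩ := div_le_of_mul_lt hm1 ht hc0 hc1 hCs hcC hN0 hmt (hsC _ hN1)
  set V := σ₄ / u ^ 2 with hV
  have hV0 : 0 ≤ V := by positivity
  have hnu : ∀ j, ∫⁻ ω, ‖ηhat j ω - ηs j‖ₑ ^ (2 : ℝ) ∂μ ≤ ENNReal.ofReal V := fun j => by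
    refine (hN j).trans (ENNReal.ofReal_le_ofReal ?_)
    have : u ≤ s (n j) := hs.mono (nMin_le j)
    rw [hV]; gcongr
  have hfin : ∀ {X x : ℝ}, X ≤ x * (c / t) → x ≤ B → X ≤ t⁻¹ / 8 := by
    intro X x h1 h2
    calc X ≤ (x * c) / t := by rw [mul_div_assoc]; exact h1
      _ ≤ (1 / 8) / t := by rw [← hcB]; gcongr
      _ = _ := by field_simp
  have hself : ∀ j, θs j ∈ Metric.closedBall (θs j) M := fun j => Metric.mem_closedBall_self hM.le
  have hselfη : ∀ j, ηs j ∈ Metric.closedBall (ηs j) M := fun j => Metric.mem_closedBall_self hM.le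
  have hsc := htail hS (φ := fun j => score (ℓ j) (θs j) (ηs j))
    (fun j => (hL j).measurable_score (hself j) (hselfη j))
    (fun j => (hL j).integral_score_eq_zero hM.le) (fun j => (hL j).score_moment)
  have hfl := fun A => fun {x : ℝ} (hx : 0 < x) =>
    measure_scoreFluct_le hS hL hM.le hσ₅.le hT hnu A hx
  have hNk : ∀ k, (0 : ℝ) < pooled n cl k := fun k => by exact_mod_cast pooled_pos hn hcl k
  have e1 : μ {ω | ∃ j, M < ‖ηhat j ω - ηs j‖} ≤ ENNReal.ofReal (t⁻¹ / 8) := by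
    refine (measure_nuisance_far_le hS.nuis_meas hM hnu).trans (ENNReal.ofReal_le_ofReal ?_)
    refine hfin (x := σ₄ / M ^ (2 : ℝ)) ?_ (by linarith)
    calc (m : ℝ) * (V / M ^ (2 : ℝ)) = σ₄ / M ^ (2 : ℝ) * (m / u ^ 2) := by rw [hV]; ring
      _ ≤ _ := by gcongr
  have e2 : μ {ω | ∃ k, a * (K : ℝ) ^ (1 / r₁) * (pooled n cl k : ℝ) ^ (1 / 2 : ℝ) * t <
      ‖∑ j ∈ cluster cl k, ∑ i, score (ℓ j) (θs j) (ηs j) (D j i ω)‖} ≤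
      ENNReal.ofReal (t⁻¹ / 8) := by
    refine (measure_exists_le (B := t⁻¹ / 8 / K) fun k => (hsc (cluster cl k) _
      (by have := hNk k; positivity)).trans (ENNReal.ofReal_le_ofReal ?_)).trans
      (ENNReal.ofReal_le_ofReal (le_of_eq ?_))
    · have hk := hNk k
      rw [show ((∑ j ∈ cluster cl k, n j : ℕ) : ℝ) = pooled n cl k from rfl,
        Real.mul_rpow (by positivity) ht0.le, Real.mul_rpow (by positivity) (by positivity),
        Real.mul_rpow (by positivity) (by positivity), ← Real.rpow_mul hK0.le,
        ← Real.rpow_mul hk.le, one_div_mul_cancel (by linarith), Real.rpow_one,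
        show 1 / 2 * r₁ = r₁ / 2 by ring]
      have h1 : a ≤ a ^ r₁ := Real.self_le_rpow_of_one_le ha1 (by linarith)
      have h2 : t ≤ t ^ r₁ := Real.self_le_rpow_of_one_le ht.le (by linarith)
      have h3 : 8 * A₁ ≤ a := le_max_right _ _
      have hp : (0 : ℝ) < (pooled n cl k : ℝ) ^ (r₁ / 2) := by positivity
      calc A₁ * (pooled n cl k : ℝ) ^ (r₁ / 2) /
            (a ^ r₁ * K * (pooled n cl k : ℝ) ^ (r₁ / 2) * t ^ r₁) =
            A₁ / (a ^ r₁ * K * t ^ r₁) := by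
            field_simp
        _ ≤ A₁ / (8 * A₁ * K * t) := by gcongr; linarith
        _ = _ := by field_simp
    · rw [Fintype.card_fin]; field_simp
  have e3 : μ {ω | ∃ k, (pooled n cl k : ℝ) ^ (1 / 2 : ℝ) * t < ‖∑ j ∈ cluster cl k, ∑ i,
      scoreFluct (P j) (ℓ j) (θs j) (ηs j) (T j) M (ηhat j ω) (D j i ω)‖} ≤
      ENNReal.ofReal (t⁻¹ / 8) := by
    refine (measure_exists_le (B := σ₅ * V) fun k => (hfl (cluster cl k)
      (by have := hNk k; positivity)).trans (ENNReal.ofReal_le_ofReal ?_)).trans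
      (ENNReal.ofReal_le_ofReal (hfin (x := σ₅ * σ₄) ?_ (by linarith)))
    · have hk := hNk k
      rw [show ((∑ j ∈ cluster cl k, n j : ℕ) : ℝ) = pooled n cl k from rfl,
        Real.mul_rpow (by positivity) ht0.le, ← Real.rpow_mul hk.le, one_div_mul_cancel two_ne_zero,
        Real.rpow_one, Real.rpow_ofNat, mul_div_mul_left _ _ hk.ne']
      exact div_le_self (by positivity) (by nlinarith)
    · rw [Fintype.card_fin]
      calc (K : ℝ) * (σ₅ * V) ≤ m * (σ₅ * V) := by gcongr
        _ = σ₅ * σ₄ * (m / u ^ 2) := by rw [hV]; ring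
        _ ≤ _ := by gcongr
  have e4 : μ {ω | ∃ k, 8 * σ₄ * bTerm s n cl k * (pooled n cl k : ℝ) ^ (1 / 2 : ℝ) * t <
      ∑ j ∈ cluster cl k, (n j : ℝ) * ‖ηhat j ω - ηs j‖ ^ 2} ≤ ENNReal.ofReal (t⁻¹ / 8) := by
    refine (measure_exists_le (B := t⁻¹ / 8 / K) fun k => (measure_nuisance_cluster_le
      hS.nuis_meas (fun j => by positivity) hN (cluster cl k)
      (by have := hNk k; have := bTerm_pos hs hn hcl k; positivity)).trans
        (ENNReal.ofReal_le_ofReal ?_)).trans (ENNReal.ofReal_le_ofReal (le_of_eq ?_))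
    · have hk := hNk k
      have hb := bTerm_pos hs hn hcl k
      have h1 := sum_div_sq_le_bTerm hs hn (cl := cl) k
      have h2 : ∑ j ∈ cluster cl k, (n j : ℝ) * (σ₄ / s (n j) ^ 2) =
          σ₄ * ∑ j ∈ cluster cl k, (n j : ℝ) / s (n j) ^ 2 := by
        rw [Finset.mul_sum]; exact Finset.sum_congr rfl fun j _ => by ring
      have hp : (0 : ℝ) < (pooled n cl k : ℝ) ^ (1 / 2 : ℝ) := by positivity
      rw [h2, div_le_iff₀ (by positivity)]
      calc σ₄ * ∑ j ∈ cluster cl k, (n j : ℝ) / s (n j) ^ 2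
          ≤ σ₄ * (bTerm s n cl k * (pooled n cl k : ℝ) ^ (1 / 2 : ℝ) / K) := by
            gcongr; rw [le_div_iff₀ hK0]; linarith
        _ = _ := by field_simp
    · rw [Fintype.card_fin]; field_simp
  have hnj : ∀ j, (0 : ℝ) < n j := fun j => by exact_mod_cast hn j
  have hnN : ∀ j, (nMin n : ℝ) ≤ n j := fun j => by exact_mod_cast nMin_le j
  have e5 : μ {ω | ∃ j, (n j : ℝ) < ‖∑ i, score (ℓ j) (θs j) (ηs j) (D j i ω)‖} ≤
      ENNReal.ofReal (t⁻¹ / 8) := by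
    refine (measure_exists_le (B := A₁ / nMin n) fun j => ?_).trans
      (ENNReal.ofReal_le_ofReal (hfin (x := A₁ * Cs) ?_ (by linarith)))
    · have h1 := hsc {j} (n j) (hnj j)
      simp only [Finset.sum_singleton] at h1
      refine h1.trans (ENNReal.ofReal_le_ofReal ?_)
      have h2 : (n j : ℝ) ≤ (n j : ℝ) ^ (r₁ / 2) :=
        Real.self_le_rpow_of_one_le (by exact_mod_cast hn j) (by linarith)
      have h3 : (n j : ℝ) ^ r₁ = (n j : ℝ) ^ (r₁ / 2) * (n j : ℝ) ^ (r₁ / 2) := by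
        rw [← Real.rpow_add (hnj j)]; congr 1; ring
      have hp : (0 : ℝ) < (n j : ℝ) ^ (r₁ / 2) := Real.rpow_pos_of_pos (hnj j) _
      rw [h3, mul_div_mul_right _ _ hp.ne']
      have := hnN j
      gcongr
      linarith
    · rw [Fintype.card_fin]
      calc (m : ℝ) * (A₁ / nMin n) = A₁ * (m / nMin n) := by ring
        _ ≤ A₁ * (c * Cs / t) := by gcongr
        _ = _ := by ring
  have e6 : μ {ω | ∃ j, (n j : ℝ) < ‖∑ i, scoreFluct (P j) (ℓ j) (θs j) (ηs j) (T j) M (ηhat j ω)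
      (D j i ω)‖} ≤ ENNReal.ofReal (t⁻¹ / 8) := by
    refine (measure_exists_le (B := σ₅ * V) fun j => ?_).trans
      (ENNReal.ofReal_le_ofReal (hfin (x := σ₅ * σ₄) ?_ (by linarith)))
    · have h1 := hfl {j} (hnj j)
      simp only [Finset.sum_singleton] at h1
      refine h1.trans (ENNReal.ofReal_le_ofReal ?_)
      have h2 : (1 : ℝ) ≤ n j := by exact_mod_cast hn j
      rw [Real.rpow_ofNat, pow_two, mul_div_mul_left _ _ (hnj j).ne']
      exact div_le_self (by positivity) h2
    · rw [Fintype.card_fin]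
      calc (m : ℝ) * (σ₅ * V) = σ₅ * σ₄ * (m / u ^ 2) := by rw [hV]; ring
        _ ≤ _ := by gcongr
  have e7 : μ {ω | ∃ j, ∃ w : W, n j * (τ * ‖R (cl j) • w.1‖ ^ 2) <
      ‖∑ i, (remainder (fun x => ℓ j x (ηs j) (D j i ω)) (θs j)
        (score (ℓ j) (θs j) (ηs j) (D j i ω)) (R (cl j) • w.1) -
        ∫ z, remainder (fun x => ℓ j x (ηs j) z) (θs j) (score (ℓ j) (θs j) (ηs j) z)
          (R (cl j) • w.1) ∂(P j))‖} ≤ ENNReal.ofReal (t⁻¹ / 8) := by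
    refine (measure_exists_le (B := W.card * (q / τ ^ 2 * (nMin n : ℝ)⁻¹)) fun j => ?_).trans
      (ENNReal.ofReal_le_ofReal (hfin (x := W.card * (q / τ ^ 2) * Cs) ?_ (by linarith)))
    · have h1 := measure_exists_le (μ := μ) (B := q / τ ^ 2 * (nMin n : ℝ)⁻¹) fun w : W =>
        (measure_remainder_le hS hL hM.le hρ hσ₂.le hr₂.le hn (hR (cl j) w.1 w.2) hτ j).trans
          (ENNReal.ofReal_le_ofReal (by have := hnN j; rw [← hq]; gcongr))
      simpa using h1
    · rw [Fintype.card_fin]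
      calc (m : ℝ) * (W.card * (q / τ ^ 2 * (nMin n : ℝ)⁻¹)) =
            W.card * (q / τ ^ 2) * (m / nMin n) := by ring
        _ ≤ W.card * (q / τ ^ 2) * (c * Cs / t) := by gcongr
        _ = _ := by ring
  have e8 : μ {ω | ∃ j, ENNReal.ofReal (n j * τ) <
      (∑ i, hessLip (ℓ j) (θs j) (ηs j) M (D j i ω)) * ‖ηhat j ω - ηs j‖ₑ} ≤
      ENNReal.ofReal (t⁻¹ / 8) := by
    refine (measure_exists_le fun j => measure_hessLip_le hS hL hσ₃.le hV0 hnu hn hτ j).trans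
      (ENNReal.ofReal_le_ofReal (hfin (x := σ₃ * σ₄ ^ (1 / 2 : ℝ) / τ) ?_ (by linarith)))
    have h1 : V ^ (1 / 2 : ℝ) = σ₄ ^ (1 / 2 : ℝ) / u := by
      rw [hV, Real.div_rpow hσ₄.le (by positivity), ← Real.rpow_natCast, ← Real.rpow_mul hu0.le]
      norm_num
    rw [Fintype.card_fin, h1]
    calc (m : ℝ) * (σ₃ * (σ₄ ^ (1 / 2 : ℝ) / u) / τ) = σ₃ * σ₄ ^ (1 / 2 : ℝ) / τ * (m / u) := by
          ring
      _ ≤ _ := by gcongr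
  refine le_trans (measure_mono ?_) ((measure_union_le _ _).trans (add_le_add e1
    ((measure_union_le _ _).trans (add_le_add e2 ((measure_union_le _ _).trans (add_le_add e3
    ((measure_union_le _ _).trans (add_le_add e4 ((measure_union_le _ _).trans (add_le_add e5
    ((measure_union_le _ _).trans (add_le_add e6 ((measure_union_le _ _).trans
      (add_le_add e7 e8)))))))))))))) |>.trans ?_
  · rintro ω ⟨hmem, hbad⟩
    by_contra hω
    simp only [Set.mem_union, Set.mem_ofPred_eq, not_or, not_exists, not_lt] at hω
    obtain ⟨h1, h2, h3, h4, h5, h6, h7, h8⟩ := hω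
    exact hbad ⟨hmem, h1, h2, h3, h4, h5, h6, fun j w hw => h7 j ⟨w, hw⟩, h8⟩
  · have h0 : ENNReal.ofReal t⁻¹ = 8 * ENNReal.ofReal (t⁻¹ / 8) := by
      rw [← ENNReal.ofReal_ofNat, ← ENNReal.ofReal_mul (by norm_num)]
      congr 1; ring
    rw [h0]
    exact le_of_eq (by ring)

/-! ### Growth of the empirical risk on the good event -/

theorem remainder_sum {E ι : Type*} [NormedAddCommGroup E] [InnerProductSpace ℝ E] [Fintype ι]
    (f : ι → E → ℝ) (x₀ : E) (g : ι → E) (v : E) :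
    remainder (fun x => ∑ i, f i x) x₀ (∑ i, g i) v = ∑ i, remainder (f i) x₀ (g i) v := by
  simp only [remainder, sum_inner, Finset.sum_sub_distrib]

theorem convexOn_finset_sum {E ι : Type*} [AddCommGroup E] [Module ℝ E] (s : Finset ι)
    {f : ι → E → ℝ} (h : ∀ i ∈ s, ConvexOn ℝ Set.univ (f i)) :
    ConvexOn ℝ Set.univ fun x => ∑ i ∈ s, f i x := by
  classical
  induction s using Finset.induction with
  | empty => simpa using convexOn_const (0 : ℝ) convex_univ
  | insert a s ha ih =>
    simp only [Finset.sum_insert ha]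
    exact (h a (Finset.mem_insert_self _ _)).add
      (ih fun i hi => h i (Finset.mem_insert_of_mem hi))

namespace LossRegularity

variable {d : ℕ} {H Z : Type*} [NormedAddCommGroup H] [NormedSpace ℝ H] [MeasurableSpace H]
  [MeasurableSpace Z] {M ρ κ σ₁ σ₂ σ₃ σ₅ r₁ r₂ : ℝ} {P : Measure Z}
  {ℓ : Param d → H → Z → ℝ} {θs : Param d} {ηs : H} {T : Set H}
  (h : LossRegularity M ρ κ σ₁ σ₂ σ₃ σ₅ r₁ r₂ P ℓ θs ηs T)
include h

theorem abs_sum_remainder_sub_le (hM : 0 ≤ M) {v : Param d} (hv : ‖v‖ ≤ M) {η : H}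
    (hη : ‖η - ηs‖ ≤ M) {N : ℕ} (z : Fin N → Z) {e : ℝ} (he : 0 ≤ e)
    (hhess : (∑ i, hessLip ℓ θs ηs M (z i)) * ‖η - ηs‖ₑ ≤ ENNReal.ofReal e) :
    |∑ i, remainder (fun x => ℓ x η (z i)) θs (score ℓ θs η (z i)) v -
      ∑ i, remainder (fun x => ℓ x ηs (z i)) θs (score ℓ θs ηs (z i)) v| ≤ e * ‖v‖ ^ 2 := by
  have hη' : η ∈ Metric.closedBall ηs M := mem_closedBall_iff_norm.2 hη
  rw [← Finset.sum_sub_distrib, ← ENNReal.ofReal_le_ofReal_iff (by positivity),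
    ← Real.enorm_eq_ofReal_abs, ENNReal.ofReal_mul he]
  calc _ ≤ ∑ i, ‖remainder (fun x => ℓ x η (z i)) θs (score ℓ θs η (z i)) v -
          remainder (fun x => ℓ x ηs (z i)) θs (score ℓ θs ηs (z i)) v‖ₑ := enorm_sum_le _ _
    _ ≤ ∑ i, hessLip ℓ θs ηs M (z i) * ‖η - ηs‖ₑ * ENNReal.ofReal (‖v‖ ^ 2) :=
        Finset.sum_le_sum fun i _ => h.enorm_remainder_sub_le hM hv hη' (z i)
    _ = (∑ i, hessLip ℓ θs ηs M (z i)) * ‖η - ηs‖ₑ * ENNReal.ofReal (‖v‖ ^ 2) := by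
        simp only [Finset.sum_mul]
    _ ≤ _ := by gcongr

/-- At a net point the mean remainder lies between `ρ / 2` and `κ / 2` times the squared norm. The
sampling error and the nuisance error take at most `ρ / 8` each, which leaves `ρ / 4` below and less
than `κ + ρ` above, as the net requires. -/
theorem hasGrowth_sum (hM : 0 ≤ M) (hρ : 0 < ρ) (hκ : 0 < κ) {W : Finset (Param d)} {c C : ℝ}
    (hnet : ∀ Q : Param d → ℝ, ConvexOn ℝ Set.univ Q → (∀ x, 0 ≤ Q x) → Q 0 = 0 → ∀ R : ℝ, 0 < R →
      (∀ w ∈ W, ρ / 4 * (‖w‖ * R) ^ 2 ≤ Q (R • w) ∧ Q (R • w) ≤ (κ + ρ) * (‖w‖ * R) ^ 2) →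
      (∀ u, R ≤ ‖u‖ → c * R ^ 2 ≤ Q u) ∧ ∀ u, ‖u‖ ≤ 4 * R → Q u ≤ C * R ^ 2)
    {R : ℝ} (hR : 0 < R) (hW : ∀ w ∈ W, ‖R • w‖ ≤ M) {η : H} (hη : ‖η - ηs‖ ≤ M) {N : ℕ}
    (hN : 0 < N) (z : Fin N → Z)
    (hz : ∀ w ∈ W, ‖∑ i, (remainder (fun x => ℓ x ηs (z i)) θs (score ℓ θs ηs (z i)) (R • w) -
      ∫ z, remainder (fun x => ℓ x ηs z) θs (score ℓ θs ηs z) (R • w) ∂P)‖ ≤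
        N * (ρ / 8 * ‖R • w‖ ^ 2))
    (hhess : (∑ i, hessLip ℓ θs ηs M (z i)) * ‖η - ηs‖ₑ ≤ ENNReal.ofReal (N * (ρ / 8))) :
    HasGrowth (fun x => ∑ i, ℓ x η (z i)) θs (∑ i, score ℓ θs η (z i)) N c C R := by
  have hη' : η ∈ Metric.closedBall ηs M := mem_closedBall_iff_norm.2 hη
  have hN0 : (0 : ℝ) < N := by exact_mod_cast hN
  have hconv : ConvexOn ℝ Set.univ fun x => ∑ i, ℓ x η (z i) :=
    convexOn_finset_sum _ fun i _ => h.convex η hη' (z i)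
  set F := remainder (fun x => ∑ i, ℓ x η (z i)) θs (∑ i, score ℓ θs η (z i)) with hF
  have hFe : ∀ v, F v = ∑ i, remainder (fun x => ℓ x η (z i)) θs (score ℓ θs η (z i)) v :=
    remainder_sum _ _ _
  have hF0 : ∀ v, 0 ≤ F v := fun v => by
    rw [hFe]; exact Finset.sum_nonneg fun i _ => h.remainder_nonneg hM hη' (z i) v
  have hQ := hnet (fun v => (N : ℝ)⁻¹ • F v)
    ((convexOn_remainder hconv _ _).smul (by positivity))
    (fun v => smul_nonneg (by positivity) (hF0 v)) (by simp [hF, remainder_zero]) R hR ?_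
  · simp only [smul_eq_mul] at hQ
    refine ⟨hconv, hF0, fun v hv => ?_, fun v hv => ?_⟩
    · have := hQ.1 v hv
      rwa [inv_mul_eq_div, le_div_iff₀ hN0, mul_comm] at this
    · have := hQ.2 v hv
      rwa [inv_mul_eq_div, div_le_iff₀ hN0, mul_comm] at this
  · intro w hw
    have h1 := h.abs_sum_remainder_sub_le hM (hW w hw) hη z (by positivity) hhess
    have h2 := hz w hw
    have h3 := h.integral_remainder_bounds hM hρ (hW w hw)
    rw [← hFe] at h1
    have e1 : ‖R • w‖ = ‖w‖ * R := by rw [norm_smul, Real.norm_of_nonneg hR.le, mul_comm]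
    rw [Finset.sum_sub_distrib, Finset.sum_const, Finset.card_univ, Fintype.card_fin,
      nsmul_eq_mul, Real.norm_eq_abs] at h2
    rw [e1] at h1 h2 h3
    set q := ∫ z, remainder (fun x => ℓ x ηs z) θs (score ℓ θs ηs z) (R • w) ∂P
    set S := ∑ i, remainder (fun x => ℓ x ηs (z i)) θs (score ℓ θs ηs (z i)) (R • w)
    rw [abs_le] at h1 h2
    set y := (‖w‖ * R) ^ 2 with hy
    have hy0 : 0 ≤ y := by positivity
    have hq1 : N * (ρ / 2 * y) ≤ N * q := by gcongr; exact h3.1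
    have hq2 : N * q ≤ N * (κ / 2 * y) := by gcongr; exact h3.2
    have hκy : 0 ≤ N * (κ / 2 * y) := by positivity
    have hρy : 0 ≤ N * (ρ / 2 * y) := by positivity
    simp only [smul_eq_mul, inv_mul_eq_div]
    rw [le_div_iff₀ hN0, div_le_iff₀ hN0]
    constructor <;> nlinarith [h1.1, h1.2, h2.1, h2.2]

end LossRegularity

/-! ### Scores at the estimated nuisances -/

namespace GoodSample

variable {d m K : ℕ} {n : Fin m → ℕ} {cl : Fin m → Fin K}
  {H Z : Fin m → Type*} [∀ j, NormedAddCommGroup (H j)] [∀ j, NormedSpace ℝ (H j)]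
  [∀ j, MeasurableSpace (H j)] [∀ j, BorelSpace (H j)] [∀ j, MeasurableSpace (Z j)]
  {P : ∀ j, Measure (Z j)} [∀ j, IsProbabilityMeasure (P j)]
  {ℓ : ∀ j, Param d → H j → Z j → ℝ} {θs : Fin m → Param d}
  {ηs : ∀ j, H j} {T : ∀ j, Set (H j)} {s : ℕ → ℝ} {M ρ κ σ₁ σ₂ σ₃ σ₅ r₁ r₂ τ a a' t : ℝ}
  {W : Finset (Param d)} {R : Fin K → ℝ} {η : ∀ j, H j} {z : ∀ j, Fin (n j) → Z j}
  (hG : GoodSample P ℓ θs ηs T cl s M r₁ τ a a' t W R η z)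
  (hL : ∀ j, LossRegularity M ρ κ σ₁ σ₂ σ₃ σ₅ r₁ r₂ (P j) (ℓ j) (θs j) (ηs j) (T j))
include hG hL

/-- The three sources of error are the noise at the true nuisance, the centred fluctuation and the
orthogonalized bias. With `A` a cluster it gives the statistical rate; with a single task, a crude
slope for the Lipschitz constant. -/
theorem norm_sum_score_le (hM : 0 ≤ M) (hσ₅ : 0 ≤ σ₅) (A : Finset (Fin m)) :
    ‖∑ j ∈ A, ∑ i, score (ℓ j) (θs j) (η j) (z j i)‖ ≤
      ‖∑ j ∈ A, ∑ i, score (ℓ j) (θs j) (ηs j) (z j i)‖ +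
      ‖∑ j ∈ A, ∑ i, scoreFluct (P j) (ℓ j) (θs j) (ηs j) (T j) M (η j) (z j i)‖ +
      σ₅ * ∑ j ∈ A, (n j : ℝ) * ‖η j - ηs j‖ ^ 2 := by
  have hmem : ∀ j, η j ∈ T j ∩ Metric.closedBall (ηs j) M := fun j =>
    ⟨hG.mem j, mem_closedBall_iff_norm.2 (hG.near j)⟩
  have e1 : ∑ j ∈ A, ∑ i, score (ℓ j) (θs j) (η j) (z j i) =
      ∑ j ∈ A, ∑ i, score (ℓ j) (θs j) (ηs j) (z j i) +
      ∑ j ∈ A, ∑ i, scoreFluct (P j) (ℓ j) (θs j) (ηs j) (T j) M (η j) (z j i) +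
      ∑ j ∈ A, (n j : ℝ) • ∫ z, (score (ℓ j) (θs j) (η j) z - score (ℓ j) (θs j) (ηs j) z)
        ∂(P j) := by
    rw [← Finset.sum_add_distrib, ← Finset.sum_add_distrib]
    refine Finset.sum_congr rfl fun j _ => ?_
    rw [Finset.sum_congr rfl fun i _ => score_eq_add_scoreFluct (P := P j) (hmem j) (z j i),
      Finset.sum_add_distrib, Finset.sum_add_distrib]
    simp [Nat.cast_smul_eq_nsmul]
  rw [e1]
  refine (norm_add₃_le ..).trans ?_
  gcongr
  rw [Finset.mul_sum]
  refine norm_sum_le_of_le _ fun j _ => ?_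
  rw [norm_smul, Real.norm_of_nonneg (Nat.cast_nonneg _), mul_left_comm]
  gcongr
  exact (hL j).norm_integral_score_sub_le hM hσ₅ (hG.mem j) (hG.near j)

theorem norm_sum_score_cluster_le (hM : 0 ≤ M) (hσ₅ : 0 ≤ σ₅) (ha : 0 ≤ a) (ha' : 0 ≤ a')
    (hr₁ : 0 ≤ r₁) (ht : 0 ≤ t) (k : Fin K) (hb : 0 ≤ bTerm s n cl k) :
    ‖∑ j ∈ cluster cl k, ∑ i, score (ℓ j) (θs j) (η j) (z j i)‖ ≤
      (a + 1 + σ₅ * a') * (((K : ℝ) ^ (1 / r₁) + bTerm s n cl k) *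
        (pooled n cl k : ℝ) ^ (1 / 2 : ℝ) * t) := by
  have h1 := hG.norm_sum_score_le hL hM hσ₅ (cluster cl k)
  have h2 := hG.score_cluster k
  have h3 := hG.fluct_cluster k
  have h4 := mul_le_mul_of_nonneg_left (hG.nuisance_cluster k) hσ₅
  have hK : (1 : ℝ) ≤ (K : ℝ) ^ (1 / r₁) :=
    Real.one_le_rpow (by exact_mod_cast k.pos) (by positivity)
  set x := (K : ℝ) ^ (1 / r₁)
  set b := bTerm s n cl k
  set y := (pooled n cl k : ℝ) ^ (1 / 2 : ℝ) * t with hy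
  have hy0 : 0 ≤ y := by positivity
  have e2 : a * x * (pooled n cl k : ℝ) ^ (1 / 2 : ℝ) * t = a * (x * y) := by rw [hy]; ring
  have e4 : σ₅ * (a' * b * (pooled n cl k : ℝ) ^ (1 / 2 : ℝ) * t) = σ₅ * a' * (b * y) := by
    rw [hy]; ring
  rw [e2] at h2
  rw [e4] at h4
  have e5 : (a + 1 + σ₅ * a') * ((x + b) * (pooled n cl k : ℝ) ^ (1 / 2 : ℝ) * t) =
      (a + 1 + σ₅ * a') * (x * y + b * y) := by rw [hy]; ring
  rw [e5]
  have hxy : y ≤ x * y := by nlinarith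
  have hby : 0 ≤ b * y := by positivity
  have p1 : 0 ≤ a * (b * y) := by positivity
  have p2 : 0 ≤ σ₅ * a' * (x * y) := by positivity
  nlinarith

theorem norm_sum_score_task_le (hM : 0 ≤ M) (hσ₅ : 0 ≤ σ₅) (j : Fin m) :
    ‖∑ i, score (ℓ j) (θs j) (η j) (z j i)‖ ≤ n j * (2 + σ₅ * M ^ 2) := by
  have h1 := hG.norm_sum_score_le hL hM hσ₅ {j}
  simp only [Finset.sum_singleton] at h1
  have h2 := hG.score_task j
  have h3 := hG.fluct_task j
  have h4 : σ₅ * ((n j : ℝ) * ‖η j - ηs j‖ ^ 2) ≤ σ₅ * ((n j : ℝ) * M ^ 2) := by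
    gcongr; exact hG.near j
  linarith

end GoodSample

/-! ### Minimizers on the good event -/

section Minimizer

variable {d m K : ℕ} {n : Fin m → ℕ} {cl : Fin m → Fin K}
  {H Z : Fin m → Type*} [∀ j, NormedAddCommGroup (H j)] [∀ j, NormedSpace ℝ (H j)]
  [∀ j, MeasurableSpace (H j)] [∀ j, BorelSpace (H j)] [∀ j, MeasurableSpace (Z j)]
  {P : ∀ j, Measure (Z j)} [∀ j, IsProbabilityMeasure (P j)]
  {ℓ : ∀ j, Param d → H j → Z j → ℝ} {θs : Fin m → Param d}
  {ηs : ∀ j, H j} {T : ∀ j, Set (H j)} {s : ℕ → ℝ} {M ρ κ σ₁ σ₂ σ₃ σ₅ r₁ r₂ a a' t : ℝ}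
  {W : Finset (Param d)} {R : Fin K → ℝ} {η : ∀ j, H j} {z : ∀ j, Fin (n j) → Z j}

/-- The statistical scale `(K^{1/r₁} + b_{k,n}) N_k^{-1/2} t + ξ_k` of the cluster `S_k`. -/
noncomputable def clusterScale (r₁ : ℝ) (s : ℕ → ℝ) (n : Fin m → ℕ) (cl : Fin m → Fin K)
    (ξ : Fin K → ℝ) (t : ℝ) (k : Fin K) : ℝ :=
  ((K : ℝ) ^ (1 / r₁) + bTerm s n cl k) * (pooled n cl k : ℝ) ^ (-(1 / 2) : ℝ) * t + ξ k

/-- The factor in `R k` is chosen so that the curvature `c * R k * N_k` exceeds the sum of the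
heterogeneity cost, twice the pooled score and twice the cross-cluster penalty `ε * m²`. The cap
`r₀` keeps the Lipschitz constant of the losses a fixed multiple of `nMax`. -/
theorem GoodSample.fusion_minimizers
    {c C r₀ : ℝ} (hc : 0 < c) (hC : 0 < C) {β : Fin K → Param d} {ξ : Fin K → ℝ}
    {lam : Fin m → Fin m → ℝ≥0∞} {Λ ε : ℝ}
    (hG : GoodSample P ℓ θs ηs T cl s M r₁ (ρ / 8) a a' t W R η z)
    (hL : ∀ j, LossRegularity M ρ κ σ₁ σ₂ σ₃ σ₅ r₁ r₂ (P j) (ℓ j) (θs j) (ηs j) (T j))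
    (hM : 0 ≤ M) (hρ : 0 < ρ) (hκ : 0 < κ) (hσ₅ : 0 ≤ σ₅) (ha : 0 ≤ a) (ha' : 0 ≤ a')
    (hr₁ : 0 ≤ r₁) (ht : 1 < t) (hs : IsNuisanceRate s) (hn : ∀ j, 0 < n j)
    (hcl : Function.Surjective cl)
    (hnet : ∀ Q : Param d → ℝ, ConvexOn ℝ Set.univ Q → (∀ x, 0 ≤ Q x) → Q 0 = 0 → ∀ R : ℝ, 0 < R →
      (∀ w ∈ W, ρ / 4 * (‖w‖ * R) ^ 2 ≤ Q (R • w) ∧ Q (R • w) ≤ (κ + ρ) * (‖w‖ * R) ^ 2) →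
      (∀ u, R ≤ ‖u‖ → c * R ^ 2 ≤ Q u) ∧ ∀ u, ‖u‖ ≤ 4 * R → Q u ≤ C * R ^ 2)
    (hξ : ∀ j, ‖θs j - β (cl j)‖ ≤ ξ (cl j))
    (hR : ∀ k, R k = ((C + 2 * (a + 1 + σ₅ * a') + 2) / c + 1) * clusterScale r₁ s n cl ξ t k)
    (hRr : ∀ k, R k ≤ r₀) (hW : ∀ k, ∀ w ∈ W, ‖R k • w‖ ≤ M)
    (hε : 0 ≤ ε) (hεN : ∀ k, ε * (m : ℝ) ^ 2 ≤ (pooled n cl k : ℝ) ^ (1 / 2 : ℝ))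
    (hd : ∀ j j', cl j ≠ cl j' → lam j j' = ENNReal.ofReal ε)
    (hsame : ∀ j j', cl j = cl j' → ENNReal.ofReal Λ ≤ lam j j')
    (hΛ : 2 * (nMax n * (2 + σ₅ * M ^ 2 + C * r₀)) < Λ) :
    (∀ k, 0 < R k ∧ ξ k ≤ R k) ∧
    (∃ θ, ∀ θ', objective ℓ η z lam θ ≤ objective ℓ η z lam θ') ∧
      ∀ θ, (∀ θ', objective ℓ η z lam θ ≤ objective ℓ η z lam θ') →
        (∀ j j', cl j = cl j' → θ j = θ j') ∧ ∀ j, ‖θ j - β (cl j)‖ < 2 * R (cl j) := by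
  have hξ0 : ∀ k, 0 ≤ ξ k := fun k => by
    obtain ⟨j, rfl⟩ := hcl k
    exact (norm_nonneg _).trans (hξ j)
  have ht0 : 0 < t := by linarith
  set A := a + 1 + σ₅ * a' with hA
  have hA0 : 0 ≤ A := by positivity
  set CR := (C + 2 * A + 2) / c + 1 with hCR
  have hCR1 : 1 ≤ CR := by rw [hCR]; linarith [show 0 ≤ (C + 2 * A + 2) / c by positivity]
  set X : Fin K → ℝ := fun k =>
    ((K : ℝ) ^ (1 / r₁) + bTerm s n cl k) * (pooled n cl k : ℝ) ^ (-(1 / 2) : ℝ) * t with hX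
  have hRX : ∀ k, R k = CR * (X k + ξ k) := hR
  have hNk : ∀ k, (0 : ℝ) < pooled n cl k := fun k => by exact_mod_cast pooled_pos hn hcl k
  have hK1 : ∀ k : Fin K, (1 : ℝ) ≤ (K : ℝ) ^ (1 / r₁) := fun k =>
    Real.one_le_rpow (by exact_mod_cast k.pos) (by positivity)
  have hhalf : ∀ k, (pooled n cl k : ℝ) * (pooled n cl k : ℝ) ^ (-(1 / 2) : ℝ) =
      (pooled n cl k : ℝ) ^ (1 / 2 : ℝ) := fun k => by
    nth_rewrite 1 [← Real.rpow_one (pooled n cl k : ℝ)]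
    rw [← Real.rpow_add (hNk k)]; norm_num
  have hNX : ∀ k, pooled n cl k * X k =
      ((K : ℝ) ^ (1 / r₁) + bTerm s n cl k) * (pooled n cl k : ℝ) ^ (1 / 2 : ℝ) * t := fun k => by
    rw [← hhalf k, hX]; ring
  have hX0 : ∀ k, 0 < X k := fun k => by
    have h1 := hK1 k
    have h2 := hNk k
    have h3 := bTerm_pos hs hn hcl k
    positivity
  have hRpos : ∀ k, 0 < R k := fun k => by
    rw [hRX]; have := hX0 k; have := hξ0 k; positivity
  have hξR : ∀ k, ξ k ≤ R k := fun k => by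
    rw [hRX]; have := hX0 k; have := hξ0 k; nlinarith
  have hgrow : ∀ j, HasGrowth (fun x => ∑ i, ℓ j x (η j) (z j i)) (θs j)
      (∑ i, score (ℓ j) (θs j) (η j) (z j i)) (n j) c C (R (cl j)) := fun j =>
    (hL j).hasGrowth_sum hM hρ hκ hnet (hRpos _) (hW _) (hG.near j) (hn j) (z j)
      (fun w hw => hG.net j w hw) (hG.hessian j)
  refine ⟨fun k => ⟨hRpos k, hξR k⟩, ?_⟩
  have hGn : 0 ≤ nMax n * (2 + σ₅ * M ^ 2 + C * r₀) := by
    rcases Nat.eq_zero_or_pos m with rfl | hm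
    · have : nMax n = 0 := by simp [nMax]
      simp [this]
    · have : 0 ≤ r₀ := (hRpos (cl ⟨0, hm⟩)).le.trans (hRr _)
      positivity
  refine fusionEstimate_of_fused ℓ η z (G := nMax n * (2 + σ₅ * M ^ 2 + C * r₀))
    (r := fun k => 2 * R k) hd hsame (fun j => (hgrow j).convex) hε hΛ (by linarith)
    (fun k => by linarith [hRpos k]) ?_ ?_
  · intro k y hy
    refine sum_lt_sum_on_sphere (S := cluster cl k)
      (f := fun j x => ∑ i, ℓ j x (η j) (z j i)) (e := ε * (m : ℝ) ^ 2) (x₀ := θs)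
      (N := fun j => (n j : ℝ)) (c := c) (C := C) (ξ := ξ k) (g := fun j => ∑ i, score (ℓ j) (θs j) (η j) (z j i))
      (fun j hj => ?_) (hRpos k) (hξR k) (fun j hj => ?_) ?_ hy
    · rw [← mem_cluster.1 hj]; exact hgrow j
    · rw [← mem_cluster.1 hj]; exact hξ j
    · have hsum : ∑ j ∈ cluster cl k, (n j : ℝ) = pooled n cl k := by rw [pooled]; push_cast; rfl
      rw [hsum]
      have h1 := hG.norm_sum_score_cluster_le hL hM hσ₅ ha ha' hr₁ ht0.le k
        (bTerm_pos hs hn hcl k).le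
      rw [← hNX k, ← hA] at h1
      -- The cross-cluster penalty is at most `√N_k`, and `N_k * X k` is at least that because `K ^
      -- (1 / r₁) ≥ 1` and `t > 1`. The bias from `ε` is thus hidden in the statistical term.
      have h2 : ε * (m : ℝ) ^ 2 ≤ pooled n cl k * X k := by
        refine (hεN k).trans ?_
        rw [hNX k]
        have h3 := hK1 k
        have h4 := bTerm_pos hs hn hcl k
        have h5 : (0 : ℝ) ≤ (pooled n cl k : ℝ) ^ (1 / 2 : ℝ) := by positivity
        calc (pooled n cl k : ℝ) ^ (1 / 2 : ℝ) = 1 * (pooled n cl k : ℝ) ^ (1 / 2 : ℝ) * 1 := by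
              ring
          _ ≤ _ := by gcongr; linarith
      have h6 : c * R k * pooled n cl k = (C + 2 * A + 2 + c) * (pooled n cl k * X k) +
          (C + 2 * A + 2 + c) * (pooled n cl k * ξ k) := by
        rw [hRX, hCR]; field_simp
      rw [h6]
      have p1 : 0 < pooled n cl k * X k := mul_pos (hNk k) (hX0 k)
      have p2 : 0 ≤ pooled n cl k * ξ k := mul_nonneg (hNk k).le (hξ0 k)
      nlinarith [mul_pos hC p1, mul_pos hc p1, mul_nonneg hc.le p2, mul_nonneg hA0 p2]
  · intro j x y hx hy
    -- The ball of radius `2 R` around the centroid lies in the ball of radius `3 R` around `θs j`,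
    -- since `ξ ≤ R`.
    have h1 := (hgrow j).sub_le (hRpos _) (x := x) (y := y) (by
      have h2 : ‖x - θs j‖ ≤ ‖x - β (cl j)‖ + ‖β (cl j) - θs j‖ :=
        norm_sub_le_norm_sub_add_norm_sub _ _ _
      have h3 := hξ j
      rw [norm_sub_rev] at h3
      linarith [hξR (cl j)])
    refine h1.trans ?_
    gcongr
    have h2 := hG.norm_sum_score_task_le hL hM hσ₅ j
    calc _ ≤ (n j : ℝ) * (2 + σ₅ * M ^ 2) + n j * (C * r₀) := by gcongr; exact hRr _
      _ = n j * (2 + σ₅ * M ^ 2 + C * r₀) := by ring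
      _ ≤ _ := by
        have : 0 ≤ r₀ := (hRpos (cl j)).le.trans (hRr _)
        have h3 : (n j : ℝ) ≤ nMax n := by exact_mod_cast le_nMax j
        gcongr

end Minimizer

/-! ### Penalties on the pilot event -/

section Penalty

variable {d m K : ℕ} {n : Fin m → ℕ} {cl : Fin m → Fin K}

theorem ofReal_le_weight {cw γ r : ℝ} (hcw : 0 < cw) (hγ : 0 ≤ γ) (hr : 0 < r) {a b : Param d}
    (h : ‖a - b‖ ≤ r) : ENNReal.ofReal (cw * r ^ (-γ)) ≤ weight cw γ a b := by
  rw [weight, ENNReal.ofReal_mul hcw.le, ← ENNReal.ofReal_rpow_of_pos hr, ENNReal.rpow_neg,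
    ENNReal.rpow_neg]
  gcongr

theorem weight_le_ofReal {cw γ r : ℝ} (hcw : 0 < cw) (hγ : 0 ≤ γ) (hr : 0 < r) {a b : Param d}
    (h : r ≤ ‖a - b‖) : weight cw γ a b ≤ ENNReal.ofReal (cw * r ^ (-γ)) := by
  rw [weight, ENNReal.ofReal_mul hcw.le, ← ENNReal.ofReal_rpow_of_pos hr, ENNReal.rpow_neg,
    ENNReal.rpow_neg]
  gcongr

/-- Let `r` be the base of the upper bound for `τ`. Pilots of one cluster are at distance at most
`r`; those of two clusters are at distance at least `δ - r`. The two weights therefore fall on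
opposite sides of `τ`. -/
theorem penalty_of_pilot {δ α cw γ τ ε : ℝ} {θs pilot : Fin m → Param d} {β : Fin K → Param d}
    {ξ : Fin K → ℝ} (hδ : 0 < δ) (hα : 0 ≤ α) (hcw : 0 < cw) (hγ : 0 ≤ γ) (hm : 0 < m)
    (hn : ∀ j, 0 < n j) (hcl : Function.Surjective cl)
    (hξ : ∀ j, ‖θs j - β (cl j)‖ ≤ ξ (cl j)) (hβ : ∀ k k', k ≠ k' → δ ≤ ‖β k - β k'‖)
    (hτ₁ : cw * (δ / 2) ^ (-γ) < τ)
    (hτ₂ : τ < cw * (δ / 2 * (nMin n : ℝ) ^ (-α) + 2 * ⨆ k, ξ k) ^ (-γ))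
    (hp : ∀ j, (n j : ℝ) ^ α * ‖pilot j - θs j‖ < δ / 4) :
    (∀ j j', cl j ≠ cl j' → penalty cw γ τ ε (pilot j) (pilot j') = ENNReal.ofReal ε) ∧
    ∀ j j', cl j = cl j' →
      ENNReal.ofReal (cw * (δ / 2 * (nMin n : ℝ) ^ (-α) + 2 * ⨆ k, ξ k) ^ (-γ)) ≤
        penalty cw γ τ ε (pilot j) (pilot j') := by
  have hN : (0 : ℝ) < nMin n := by exact_mod_cast one_le_nMin hm hn
  have hξ0 : ∀ k, 0 ≤ ξ k := fun k => by
    obtain ⟨j, rfl⟩ := hcl k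
    exact (norm_nonneg _).trans (hξ j)
  have hξm : ∀ k, ξ k ≤ ⨆ k, ξ k := fun k => le_ciSup (Set.finite_range ξ).bddAbove k
  set ξm := ⨆ k, ξ k with hξmdef
  have hξm0 : 0 ≤ ξm := (hξ0 (cl ⟨0, hm⟩)).trans (hξm _)
  set q := (nMin n : ℝ) ^ (-α) with hq
  have hq0 : 0 < q := Real.rpow_pos_of_pos hN _
  set r := δ / 2 * q + 2 * ξm with hr
  have hr0 : 0 < r := by positivity
  have hpj : ∀ j, ‖pilot j - θs j‖ < δ / 4 * q := fun j => by
    have h1 : (nMin n : ℝ) ≤ n j := by exact_mod_cast nMin_le j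
    have h2 : (nMin n : ℝ) ^ α * ‖pilot j - θs j‖ < δ / 4 :=
      lt_of_le_of_lt (by gcongr) (hp j)
    rw [hq, Real.rpow_neg hN.le, ← div_eq_mul_inv, lt_div_iff₀ (Real.rpow_pos_of_pos hN _)]
    linarith
  -- No smallness of `ξ` is assumed here. The window for `τ` is nonempty, and since `x ^ (-γ)` is
  -- nonincreasing this forces `r < δ / 2`.
  have hrδ : r < δ / 2 := by
    by_contra hcon
    have h1 : r ^ (-γ) ≤ (δ / 2) ^ (-γ) :=
      Real.rpow_le_rpow_of_nonpos (by positivity) (not_lt.1 hcon) (by linarith)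
    have h2 : cw * r ^ (-γ) ≤ cw * (δ / 2) ^ (-γ) := by gcongr
    linarith
  constructor
  · intro j j' hne
    have h1 : ‖β (cl j) - β (cl j')‖ ≤ ‖β (cl j) - θs j‖ + ‖θs j - pilot j‖ +
        ‖pilot j - pilot j'‖ + ‖pilot j' - θs j'‖ + ‖θs j' - β (cl j')‖ := by
      rw [show β (cl j) - β (cl j') = (β (cl j) - θs j) + (θs j - pilot j) + (pilot j - pilot j') +
        (pilot j' - θs j') + (θs j' - β (cl j')) by abel]
      exact (norm_add_le _ _).trans (add_le_add ((norm_add_le _ _).trans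
        (add_le_add (norm_add₃_le ..) le_rfl)) le_rfl)
    rw [norm_sub_rev _ (θs j), norm_sub_rev (θs j) (pilot j)] at h1
    have h2 : δ / 2 ≤ ‖pilot j - pilot j'‖ := by
      linarith [hβ _ _ hne, hpj j, hpj j', hξ j, hξ j', hξm (cl j), hξm (cl j')]
    rw [penalty, if_pos]
    exact (weight_le_ofReal hcw hγ (by positivity) h2).trans (ENNReal.ofReal_le_ofReal hτ₁.le)
  · intro j j' heq
    have h1 : ‖pilot j - pilot j'‖ ≤ ‖pilot j - θs j‖ + ‖θs j - β (cl j)‖ +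
        ‖β (cl j) - θs j'‖ + ‖θs j' - pilot j'‖ := by
      rw [show pilot j - pilot j' = (pilot j - θs j) + (θs j - β (cl j)) + (β (cl j) - θs j') +
        (θs j' - pilot j') by abel]
      exact (norm_add_le _ _).trans (add_le_add (norm_add₃_le ..) le_rfl)
    rw [norm_sub_rev _ (θs j'), norm_sub_rev (θs j') (pilot j'), heq] at h1
    have h2 : ‖θs j - β (cl j')‖ ≤ ξ (cl j') := heq ▸ hξ j
    have h3 : ‖pilot j - pilot j'‖ ≤ r := by
      linarith [hpj j, hpj j', hξ j', hξm (cl j')]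
    have h4 := ofReal_le_weight hcw hγ hr0 h3
    rw [penalty, if_neg]
    · exact h4
    · rw [not_le]
      refine lt_of_lt_of_le ?_ h4
      exact (ENNReal.ofReal_lt_ofReal_iff (mul_pos hcw (Real.rpow_pos_of_pos hr0 _))).2 hτ₂

/-- As `α ≤ 1/2`, the heterogeneity is also of order `nMin ^ (-α)`, so the within-cluster weight is
at least of order `nMin ^ (α * γ)`. -/
theorem rpow_separation_ge {δ α γ cξ : ℝ} {ξ : Fin K → ℝ} (hδ : 0 < δ) (hα' : α ≤ 1 / 2)
    (hγ : 0 ≤ γ) (hcξ : 0 < cξ) (hm : 0 < m) (hn : ∀ j, 0 < n j) (hcl : Function.Surjective cl)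
    (hξ0 : ∀ k, 0 ≤ ξ k) (hξ : ∀ j, ξ (cl j) ≤ cξ * (n j : ℝ) ^ (-(1 / 2) : ℝ)) :
    (δ / 2 + 2 * cξ) ^ (-γ) * (nMin n : ℝ) ^ (α * γ) ≤
      (δ / 2 * (nMin n : ℝ) ^ (-α) + 2 * ⨆ k, ξ k) ^ (-γ) := by
  have hN1 : (1 : ℝ) ≤ nMin n := by exact_mod_cast one_le_nMin hm hn
  have hN : (0 : ℝ) < nMin n := by linarith
  have : Nonempty (Fin K) := ⟨cl ⟨0, hm⟩⟩
  have h1 : ⨆ k, ξ k ≤ cξ * (nMin n : ℝ) ^ (-α) := by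
    refine ciSup_le fun k => ?_
    obtain ⟨j, rfl⟩ := hcl k
    have h2 : (nMin n : ℝ) ≤ n j := by exact_mod_cast nMin_le j
    refine (hξ j).trans ?_
    gcongr
    calc (n j : ℝ) ^ (-(1 / 2) : ℝ) ≤ (nMin n : ℝ) ^ (-(1 / 2) : ℝ) :=
          Real.rpow_le_rpow_of_nonpos hN h2 (by norm_num)
      _ ≤ _ := Real.rpow_le_rpow_of_exponent_le hN1 (by linarith)
  have h0 : 0 ≤ ⨆ k, ξ k := Real.iSup_nonneg hξ0
  have hq0 : 0 < (nMin n : ℝ) ^ (-α) := Real.rpow_pos_of_pos hN _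
  have e1 : (nMin n : ℝ) ^ (α * γ) = ((nMin n : ℝ) ^ (-α)) ^ (-γ) := by
    rw [← Real.rpow_mul hN.le]; congr 1; ring
  rw [e1, ← Real.mul_rpow (by positivity) hq0.le]
  exact Real.rpow_le_rpow_of_nonpos (by positivity) (by linarith) (by linarith)

end Penalty

/-! ### Size of the statistical scale -/

/-- All parts of the scale are at most a constant times `m * t * nMin ^ (-1/2)`, and this is at most
`c * Cs` by `s n ≲ √n`. For `bTerm`, `s n ≳ n ^ (1/4)` bounds the supremum, and `N_k ≥ card * nMin`
absorbs the square root of the cardinality. A small `c` thus keeps all radii below any prescribed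
`r₀`. -/
theorem clusterScale_le {m K : ℕ} {n : Fin m → ℕ} {cl : Fin m → Fin K} {s : ℕ → ℝ}
    {r₁ cξ t c Cs cs : ℝ} {ξ : Fin K → ℝ} (hr₁ : 1 ≤ r₁) (hcξ : 0 < cξ) (ht : 1 < t) (hc : 0 < c)
    (hCs : ∀ n : ℕ, 1 ≤ n → s n ≤ Cs * (n : ℝ) ^ (1 / 2 : ℝ)) (hcs0 : 0 < cs)
    (hcs : ∀ n : ℕ, 1 ≤ n → cs * (n : ℝ) ^ (1 / 4 : ℝ) ≤ s n)
    (hm : 0 < m) (hn : ∀ j, 0 < n j) (hcl : Function.Surjective cl)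
    (hξ : ∀ j, ξ (cl j) ≤ cξ * (n j : ℝ) ^ (-(1 / 2) : ℝ)) (hmt : m * t < c * s (nMin n))
    (k : Fin K) :
    clusterScale r₁ s n cl ξ t k ≤ c * (Cs * (1 + (cs ^ 2)⁻¹ + cξ)) := by
  have hN1 := one_le_nMin hm hn
  have hN : (0 : ℝ) < nMin n := by exact_mod_cast hN1
  have hm1 : (1 : ℝ) ≤ m := by exact_mod_cast hm
  have hK1 : (1 : ℝ) ≤ K := by exact_mod_cast k.pos
  have hKm : (K : ℝ) ≤ m := by
    have := Fintype.card_le_of_surjective cl hcl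
    simp only [Fintype.card_fin] at this
    exact_mod_cast this
  have ht0 : 0 < t := by linarith
  set q := (nMin n : ℝ) ^ (-(1 / 2) : ℝ) with hq
  have hq0 : 0 < q := Real.rpow_pos_of_pos hN _
  have hmtq : m * t * q ≤ c * Cs := by
    have h1 : m * t ≤ c * (Cs * (nMin n : ℝ) ^ (1 / 2 : ℝ)) :=
      hmt.le.trans (mul_le_mul_of_nonneg_left (hCs _ hN1) hc.le)
    calc m * t * q ≤ c * (Cs * (nMin n : ℝ) ^ (1 / 2 : ℝ)) * q := by gcongr
      _ = c * Cs * ((nMin n : ℝ) ^ (1 / 2 : ℝ) * q) := by ring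
      _ = c * Cs := by rw [hq, ← Real.rpow_add hN]; norm_num
  have hqmt : q ≤ m * t * q := le_mul_of_one_le_left hq0.le
    (one_le_mul_of_one_le_of_one_le hm1 ht.le)
  have hanti : ∀ {x : ℝ}, (nMin n : ℝ) ≤ x → x ^ (-(1 / 2) : ℝ) ≤ q := fun hx =>
    Real.rpow_le_rpow_of_nonpos hN hx (by norm_num)
  obtain ⟨j₀, hj₀⟩ := cluster_nonempty hcl k
  have hNk : (nMin n : ℝ) ≤ pooled n cl k := by
    exact_mod_cast (nMin_le j₀).trans (le_pooled hj₀)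
  have hNk0 : (0 : ℝ) < pooled n cl k := hN.trans_le hNk
  set p := (pooled n cl k : ℝ) ^ (-(1 / 2) : ℝ) with hp
  have hp0 : 0 < p := Real.rpow_pos_of_pos hNk0 _
  have h1 : (K : ℝ) ^ (1 / r₁) * p * t ≤ c * Cs := by
    have h2 : (K : ℝ) ^ (1 / r₁) ≤ K := by
      conv_rhs => rw [← Real.rpow_one (K : ℝ)]
      exact Real.rpow_le_rpow_of_exponent_le hK1 ((div_le_one (by linarith)).2 hr₁)
    calc (K : ℝ) ^ (1 / r₁) * p * t ≤ m * q * t := by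
          gcongr
          · exact h2.trans hKm
          · exact hanti hNk
      _ = m * t * q := by ring
      _ ≤ _ := hmtq
  have h2 : bTerm s n cl k * p * t ≤ c * Cs * (cs ^ 2)⁻¹ := by
    have hsup : ⨆ j : {j // j ∈ cluster cl k}, (n j : ℝ) ^ (1 / 2 : ℝ) * (s (n j)) ^ (-2 : ℝ) ≤
        (cs ^ 2)⁻¹ := by
      refine Real.iSup_le (fun j => ?_) (by positivity)
      have hnj : (0 : ℝ) < n j := by exact_mod_cast hn j
      have hsj := hcs (n j) (hn j)
      have hp4 : (0 : ℝ) < (n j : ℝ) ^ (1 / 4 : ℝ) := Real.rpow_pos_of_pos hnj _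
      have hs0 : 0 < s (n j) := (mul_pos hcs0 hp4).trans_le hsj
      have h3 : (n j : ℝ) ^ (1 / 2 : ℝ) = ((n j : ℝ) ^ (1 / 4 : ℝ)) ^ 2 := by
        rw [← Real.rpow_natCast, ← Real.rpow_mul hnj.le]; norm_num
      rw [Real.rpow_neg hs0.le, Real.rpow_ofNat, h3, ← div_eq_mul_inv, div_le_iff₀ (by positivity),
        inv_mul_eq_div, le_div_iff₀ (by positivity)]
      calc ((n j : ℝ) ^ (1 / 4 : ℝ)) ^ 2 * cs ^ 2 = (cs * (n j : ℝ) ^ (1 / 4 : ℝ)) ^ 2 := by ring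
        _ ≤ s (n j) ^ 2 := by gcongr
    have hcard : ((cluster cl k).card : ℝ) ^ (1 / 2 : ℝ) * p ≤ q := by
      have h3 : ((cluster cl k).card : ℝ) * nMin n ≤ pooled n cl k := by
        exact_mod_cast card_mul_nMin_le k
      have h4 : ((cluster cl k).card : ℝ) ^ (1 / 2 : ℝ) * (nMin n : ℝ) ^ (1 / 2 : ℝ) ≤
          (pooled n cl k : ℝ) ^ (1 / 2 : ℝ) := by
        rw [← Real.mul_rpow (by positivity) hN.le]; gcongr
      rw [hp, hq, Real.rpow_neg hNk0.le, Real.rpow_neg hN.le, ← div_eq_mul_inv,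
        div_le_iff₀ (by positivity), inv_mul_eq_div, le_div_iff₀ (by positivity)]
      exact h4
    calc bTerm s n cl k * p * t = K * (((cluster cl k).card : ℝ) ^ (1 / 2 : ℝ) * p) *
          (⨆ j : {j // j ∈ cluster cl k}, (n j : ℝ) ^ (1 / 2 : ℝ) * (s (n j)) ^ (-2 : ℝ)) * t := by
          rw [bTerm]; ring
      _ ≤ m * q * (cs ^ 2)⁻¹ * t := by
          have : 0 ≤ ⨆ j : {j // j ∈ cluster cl k},
              (n j : ℝ) ^ (1 / 2 : ℝ) * (s (n j)) ^ (-2 : ℝ) := Real.iSup_nonneg fun j =>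
            mul_nonneg (by positivity) (Real.rpow_nonneg (le_trans (by positivity)
              (hcs (n j) (hn j))) _)
          gcongr
      _ = m * t * q * (cs ^ 2)⁻¹ := by ring
      _ ≤ _ := by gcongr
  have h3 : ξ k ≤ cξ * (c * Cs) := by
    have h4 := hξ j₀
    rw [mem_cluster.1 hj₀] at h4
    have h5 : (nMin n : ℝ) ≤ n j₀ := by exact_mod_cast nMin_le j₀
    refine h4.trans ?_
    gcongr
    exact (hanti h5).trans (hqmt.trans hmtq)
  rw [clusterScale, ← hp]
  calc _ = (K : ℝ) ^ (1 / r₁) * p * t + bTerm s n cl k * p * t + ξ k := by ring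
    _ ≤ c * Cs + c * Cs * (cs ^ 2)⁻¹ + cξ * (c * Cs) := by gcongr
    _ = _ := by ring

theorem mul_sq_le_of_le_pooledMin {m K : ℕ} {n : Fin m → ℕ} {cl : Fin m → Fin K} {ε ζ : ℝ}
    (hm : 0 < m) (hn : ∀ j, 0 < n j) (hcl : Function.Surjective cl) (hζ : ζ < 1 / 2)
    (hε : ε ≤ 1 * (m : ℝ) ^ (-2 : ℝ) * (pooledMin n cl : ℝ) ^ ζ) (k : Fin K) :
    ε * (m : ℝ) ^ 2 ≤ (pooled n cl k : ℝ) ^ (1 / 2 : ℝ) := by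
  have hm0 : (0 : ℝ) < m := by exact_mod_cast hm
  have : Nonempty (Fin K) := ⟨k⟩
  have h1 : (1 : ℝ) ≤ pooledMin n cl := by
    have : 1 ≤ pooledMin n cl := le_ciInf fun k => pooled_pos hn hcl k
    exact_mod_cast this
  have h2 : (pooledMin n cl : ℝ) ≤ pooled n cl k := by exact_mod_cast pooledMin_le k
  calc ε * (m : ℝ) ^ 2 ≤ 1 * (m : ℝ) ^ (-2 : ℝ) * (pooledMin n cl : ℝ) ^ ζ * (m : ℝ) ^ 2 := by
        gcongr
    _ = (pooledMin n cl : ℝ) ^ ζ := by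
        rw [Real.rpow_neg hm0.le, Real.rpow_ofNat]; field_simp
    _ ≤ (pooledMin n cl : ℝ) ^ (1 / 2 : ℝ) := Real.rpow_le_rpow_of_exponent_le h1 hζ.le
    _ ≤ _ := by gcongr

theorem mul_lt_of_lt_tMax {c r₂ t : ℝ} {d m : ℕ} {s : ℕ → ℝ} {n : Fin m → ℕ} (hc : 0 < c)
    (hm : 0 < m) (ht : t < tMax c r₂ d s n) : m * t < c * s (nMin n) := by
  have hm0 : (0 : ℝ) < m := by exact_mod_cast hm
  have h1 : tMax c r₂ d s n ≤ c * (m : ℝ)⁻¹ * s (nMin n) := by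
    rw [tMax]; gcongr; exact min_le_right _ _
  calc m * t < m * (c * (m : ℝ)⁻¹ * s (nMin n)) := by gcongr; linarith
    _ = c * s (nMin n) := by field_simp

/-! ### Probability bookkeeping -/

/-- The events `E` and `B` need not be measurable. The witness is the complement of a measurable
hull of the bad set, which has the same outer measure. -/
theorem holdsWithProb_of_subset {Ω : Type*} [MeasurableSpace Ω] {μ : Measure Ω}
    [IsProbabilityMeasure μ] {S E B G : Set Ω} {t q : ℝ} (ht : 0 ≤ t⁻¹)
    (hE : μ E ≤ ENNReal.ofReal t⁻¹) (hG : MeasurableSet G) (hGp : 1 - q ≤ μ.real G)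
    (h : ∀ ω, ω ∉ E → ω ∉ B → ω ∈ G → ω ∈ S) :
    HoldsWithProb μ S (1 - t⁻¹ - q - μ.real B) := by
  set bad := E ∪ B ∪ Gᶜ with hbad
  refine ⟨(toMeasurable μ bad)ᶜ, fun ω hω => ?_, (measurableSet_toMeasurable μ bad).compl, ?_⟩
  · have h1 : ω ∉ bad := fun hb => hω (subset_toMeasurable μ bad hb)
    simp only [hbad, Set.mem_union, Set.mem_compl_iff, not_or, not_not] at h1
    exact h ω h1.1.1 h1.1.2 h1.2
  · rw [probReal_compl_eq_one_sub (measurableSet_toMeasurable μ bad)]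
    have h1 : μ.real (toMeasurable μ bad) = μ.real bad := by
      simp only [measureReal_def, measure_toMeasurable]
    have h2 : μ.real bad ≤ μ.real E + μ.real B + μ.real Gᶜ :=
      (measureReal_union_le _ _).trans (add_le_add (measureReal_union_le _ _) le_rfl)
    have h3 : μ.real E ≤ t⁻¹ := ENNReal.toReal_le_of_le_ofReal ht hE
    rw [probReal_compl_eq_one_sub hG] at h2
    linarith

end AdaptiveFusion

/-! ### Choice of the constants and conclusion -/

theorem theorem3 (d : ℕ) (M δ ρ κ σ₁ σ₂ σ₃ σ₄ σ₅ r₁ r₂ α cξ : ℝ) (s : ℕ → ℝ)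
    (hM : 0 < M) (hδ : 0 < δ) (hρ : 0 < ρ) (hκ : 0 < κ)
    (hσ₁ : 0 < σ₁) (hσ₂ : 0 < σ₂) (hσ₃ : 0 < σ₃) (hσ₄ : 0 < σ₄) (hσ₅ : 0 < σ₅)
    (hr₁ : 2 < r₁) (hr₂ : 2 < r₂) (hα : 0 < α) (hα' : α ≤ 1 / 2) (hcξ : 0 < cξ)
    (hs : IsNuisanceRate s) :
    -- constants that depend only on the quantities above
    ∃ c₁ c₃ C C' : ℝ, 0 < c₁ ∧ 0 < c₃ ∧ 0 < C ∧ 0 < C' ∧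
    ∀ cw γ : ℝ, 0 < cw → 0 ≤ γ →
    -- and one that may also depend on the fixed tuning constants `cw`, `γ`
    ∃ c₀ : ℝ, 0 < c₀ ∧
    -- tasks, sample sizes, latent partition
    ∀ (m K : ℕ) (n : Fin m → ℕ) (cl : Fin m → Fin K),
    0 < m → (∀ j, 0 < n j) → Function.Surjective cl →
    -- probability space, data spaces and laws, nuisance spaces
    ∀ (Ω : Type u) [MeasurableSpace Ω] (μ : Measure Ω) [IsProbabilityMeasure μ]
      (𝒵 : Fin m → Type v) [∀ j, MeasurableSpace (𝒵 j)]
      (P : ∀ j, Measure (𝒵 j)) [∀ j, IsProbabilityMeasure (P j)]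
      (ℋ : Fin m → Type w) [∀ j, NormedAddCommGroup (ℋ j)] [∀ j, NormedSpace ℝ (ℋ j)]
      [∀ j, MeasurableSpace (ℋ j)] [∀ j, BorelSpace (ℋ j)]
      -- losses, true parameters, nuisance realization sets, centroids, perturbation levels
      (ℓ : ∀ j, Param d → ℋ j → 𝒵 j → ℝ) (θs : Fin m → Param d) (ηs : ∀ j, ℋ j)
      (T : ∀ j, Set (ℋ j)) (β : Fin K → Param d) (ξ : Fin K → ℝ)
      -- evaluation data, nuisance estimators, pilot estimators
      (D : ∀ j, Fin (n j) → Ω → 𝒵 j) (ηhat : ∀ j, Ω → ℋ j) (pilot : Fin m → Ω → Param d)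
      (p : ℝ → ℕ → ℝ),
    -- near-homogeneous, separated clusters
    (∀ j, ‖θs j - β (cl j)‖ ≤ ξ (cl j)) →
    (∀ k k', k ≠ k' → δ ≤ ‖β k - β k'‖) →
    (∀ j, ξ (cl j) ≤ cξ * (n j : ℝ) ^ (-(1 / 2) : ℝ)) →
    -- sampling and regularity assumptions
    SplitSample μ P D ηhat →
    (∀ j, MeasurableSet (T j)) →
    (∀ j, LossRegularity M ρ κ σ₁ σ₂ σ₃ σ₅ r₁ r₂ (P j) (ℓ j) (θs j) (ηs j) (T j)) →
    NuisanceRegularity μ s σ₄ n ηs ηhat →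
    PilotConsistency μ α p n θs pilot →
    -- tuning parameters
    ∀ ζ ε τ : ℝ, ζ < 1 / 2 →
    c₀ * (nMax n : ℝ) ≤ (nMin n : ℝ) ^ (α * γ) →
    0 ≤ ε → ε ≤ c₁ * (m : ℝ) ^ (-2 : ℝ) * (pooledMin n cl : ℝ) ^ ζ →
    cw * (δ / 2) ^ (-γ) < τ →
    τ < cw * (δ / 2 * (nMin n : ℝ) ^ (-α) + 2 * ⨆ k, ξ k) ^ (-γ) →
    ∀ t : ℝ, 1 < t → t < tMax c₃ r₂ d s n →
    HoldsWithProb μ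
      {ω |
        -- the estimator exists, and
        (∃ θ, IsFusionEstimate ℓ cw γ τ ε (fun j => ηhat j ω) (fun j i => D j i ω)
          (fun j => pilot j ω) θ) ∧
        ∀ θ, IsFusionEstimate ℓ cw γ τ ε (fun j => ηhat j ω) (fun j i => D j i ω)
          (fun j => pilot j ω) θ →
          -- exact clustering
          (∀ j j', θ j = θ j' ↔ cl j = cl j') ∧
          -- oracle rate
          (∀ k, ∀ j ∈ cluster cl k, ‖θ j - θs j‖ ≤
            C * ((K : ℝ) ^ (1 / r₁) + bTerm s n cl k) * (pooled n cl k : ℝ) ^ (-(1 / 2) : ℝ) * t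
              + C' * ((pooled n cl k : ℝ) ^ (ζ - 1) + ξ k))}
      (1 - t⁻¹ - p (δ / 4) (nMin n) - μ.real {ω | ∃ j, ηhat j ω ∉ T j}) := by 
  obtain ⟨W, c, C, hc, hC, hnet⟩ := exists_net_convex_growth (E := Param d) (lo := ρ / 4)
    (hi := κ + ρ) (by positivity) (by positivity)
  obtain ⟨a, a', c', ha, ha', hc', hprob⟩ := exists_measure_not_goodSample_le d (κ := κ)
    (τ := ρ / 8) hM hρ hσ₁ hσ₂ hσ₃ hσ₄ hσ₅ hr₁ hr₂ (by positivity) hs W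
  obtain ⟨Cs, hCs0, hCs⟩ := hs.exists_le
  obtain ⟨cs, hcs0, hcs⟩ := hs.exists_ge
  set CR := (C + 2 * (a + 1 + σ₅ * a') + 2) / c + 1 with hCR
  have hCR0 : 0 < CR := by positivity
  set L := 1 + ∑ w ∈ W, ‖w‖ with hLdef
  have hL0 : 0 < L := by
    have : 0 ≤ ∑ w ∈ W, ‖w‖ := Finset.sum_nonneg fun _ _ => norm_nonneg _
    linarith
  -- `M / L` keeps the scaled net inside the ball where the regularity holds. `δ / 4` makes the
  -- balls of radius `2 * r₀` around distinct centroids disjoint up to boundary.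
  set r₀ := min (M / L) (δ / 4) with hr₀
  have hr₀0 : 0 < r₀ := by positivity
  set X := Cs * (1 + (cs ^ 2)⁻¹ + cξ) with hX
  have hX0 : 0 < X := by positivity
  set c₃ := min c' (r₀ / (CR * X)) with hc₃
  have hc₃0 : 0 < c₃ := by positivity
  set G := 2 + σ₅ * M ^ 2 + C * r₀ with hG
  have hG0 : 0 < G := by positivity
  refine ⟨1, c₃, 3 * CR, 3 * CR, one_pos, hc₃0, by positivity, by positivity, ?_⟩
  intro cw γ hcw hγ
  -- With this `c₀` the within-cluster level is at least `(2 * G + 1) * nMax`, strictly above the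
  -- threshold `2 * (nMax * G)` for merging because `nMax ≥ 1`.
  refine ⟨(2 * G + 1) * (δ / 2 + 2 * cξ) ^ γ / cw, by positivity, ?_⟩
  intro m K n cl hm hn hcl Ω _ μ _ 𝒵 _ P _ ℋ _ _ _ _ ℓ θs ηs T β ξ D ηhat pilot p hξ hβ hξn hS hT
    hL hN hpil ζ ε τ hζ hnn hε0 hε hτ₁ hτ₂ t ht hta
  have hmt : m * t < c₃ * s (nMin n) := mul_lt_of_lt_tMax hc₃0 hm hta
  have hN1 := one_le_nMin hm hn
  have hu0 : 0 < s (nMin n) := hs.pos _ hN1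
  have hξ0 : ∀ k, 0 ≤ ξ k := fun k => by
    obtain ⟨j, rfl⟩ := hcl k
    exact (norm_nonneg _).trans (hξ j)
  set R : Fin K → ℝ := fun k => CR * clusterScale r₁ s n cl ξ t k with hR
  have hRr : ∀ k, R k ≤ r₀ := fun k => by
    have h1 := clusterScale_le (by linarith : 1 ≤ r₁) hcξ ht hc₃0 hCs hcs0 hcs hm hn hcl hξn hmt k
    calc R k ≤ CR * (c₃ * X) := mul_le_mul_of_nonneg_left h1 hCR0.le
      _ ≤ CR * (r₀ / (CR * X) * X) := by gcongr; exact min_le_right _ _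
      _ = r₀ := by field_simp
  have hRn : ∀ k, 0 ≤ R k := fun k => by
    have h1 := bTerm_pos hs hn hcl k
    have h2 := hξ0 k
    rw [hR]
    simp only [clusterScale]
    positivity
  have hW : ∀ k, ∀ w ∈ W, ‖R k • w‖ ≤ M := fun k w hw => by
    have h1 : ‖w‖ ≤ L := by
      have := Finset.single_le_sum (f := fun w : Param d => ‖w‖) (fun _ _ => norm_nonneg _) hw
      linarith
    rw [norm_smul, Real.norm_of_nonneg (hRn k)]
    calc R k * ‖w‖ ≤ M / L * L := by
          gcongr
          exact (hRr k).trans (min_le_left _ _)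
      _ = M := by field_simp
  have hbad := hprob (R := R) hm hn hcl hS hT hL hN hW ht
    (hmt.trans_le (by gcongr; exact min_le_left _ _))
  have hpm : MeasurableSet {ω | ∀ j, (n j : ℝ) ^ α * ‖pilot j ω - θs j‖ < δ / 4} := by
    simp only [Set.ofPred_forall]
    refine MeasurableSet.iInter fun j => measurableSet_lt ?_ measurable_const
    exact (((hpil.meas j).sub_const _).norm).const_mul _
  have hbig : (2 * G + 1) * nMax n ≤
      cw * (δ / 2 * (nMin n : ℝ) ^ (-α) + 2 * ⨆ k, ξ k) ^ (-γ) := by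
    have h1 := rpow_separation_ge hδ hα' hγ hcξ hm hn hcl hξ0 hξn
    have h2 : (0 : ℝ) < (δ / 2 + 2 * cξ) ^ γ := by positivity
    calc (2 * G + 1) * nMax n = cw * ((δ / 2 + 2 * cξ) ^ (-γ) *
          ((2 * G + 1) * (δ / 2 + 2 * cξ) ^ γ / cw * nMax n)) := by
          rw [Real.rpow_neg (by positivity)]; field_simp
      _ ≤ cw * ((δ / 2 + 2 * cξ) ^ (-γ) * (nMin n : ℝ) ^ (α * γ)) := by gcongr
      _ ≤ _ := by gcongr
  have hnmax : (1 : ℝ) ≤ nMax n := by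
    exact_mod_cast (hn ⟨0, hm⟩).trans_le (le_nMax (n := n) ⟨0, hm⟩)
  refine holdsWithProb_of_subset (by positivity) hbad hpm (hpil.prob (δ / 4) (by positivity)) ?_
  intro ω hgood hmem hpilot
  simp only [Set.mem_ofPred_eq, not_and, not_not, not_exists] at hgood hmem hpilot
  obtain ⟨hdiff, hsame⟩ := penalty_of_pilot (ε := ε) hδ hα.le hcw hγ hm hn hcl hξ hβ hτ₁ hτ₂ hpilot
  obtain ⟨hRk, hex, hall⟩ := (hgood hmem).fusion_minimizers hc hC hL hM.le hρ hκ hσ₅.le ha.le ha'.le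
    (by linarith) ht hs hn hcl hnet hξ (fun _ => rfl) hRr hW hε0
    (mul_sq_le_of_le_pooledMin hm hn hcl hζ hε) hdiff hsame
    (lt_of_lt_of_le (by nlinarith) hbig)
  refine ⟨hex, fun θ hθ => ?_⟩
  obtain ⟨heq, hclose⟩ := hall θ hθ
  refine ⟨fun j j' => ⟨fun h => ?_, heq j j'⟩, fun k j hj => ?_⟩
  · by_contra hne
    have h1 := hβ _ _ hne
    have h2 : ‖β (cl j) - β (cl j')‖ ≤ ‖β (cl j) - θ j‖ + ‖θ j - β (cl j')‖ :=
      norm_sub_le_norm_sub_add_norm_sub _ _ _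
    rw [norm_sub_rev _ (θ j)] at h2
    have h3 := hclose j
    have h4 := hclose j'
    rw [← h] at h4
    have h5 : r₀ ≤ δ / 4 := min_le_right _ _
    linarith [hRr (cl j), hRr (cl j')]
  · rw [mem_cluster] at hj
    subst hj
    have h1 : ‖θ j - θs j‖ ≤ ‖θ j - β (cl j)‖ + ‖β (cl j) - θs j‖ :=
      norm_sub_le_norm_sub_add_norm_sub _ _ _
    rw [norm_sub_rev (β (cl j)) (θs j)] at h1
    have h2 := hclose j
    have h3 := (hRk (cl j)).2
    have h4 : R (cl j) = CR * (((K : ℝ) ^ (1 / r₁) + bTerm s n cl (cl j)) *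
      (pooled n cl (cl j) : ℝ) ^ (-(1 / 2) : ℝ) * t + ξ (cl j)) := rfl
    -- The distance to `θs j` is at most `2 R + ξ ≤ 3 R`, whence the constant `3 * CR`. The term
    -- `N_k ^ (ζ - 1)` is only added as slack, since the penalty bias is already part of `R`.
    have h5 : 0 ≤ 3 * CR * (pooled n cl (cl j) : ℝ) ^ (ζ - 1) := by positivity
    linarith [hξ j]
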